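/- Let $N\ge 1$, let $D\subset\mathbb{R}^N$ be a bounded open set and $\Omega\subseteq D$ an open subset (in particular, $\Omega\subset\subset D$ is allowed). Let $2\le p<\infty$ and $1/p+1/q=1$. $W_0^{1,p}(\Omega)$ is the closure of $C_c^\infty(\Omega)$ for the norm $(\int|y|^p+\sum_i\int|\partial_i y|^p)^{1/p}$, and $W^{-1,q}(D)$ is the dual of $W_0^{1,p}(D)$; functions in $W_0^{1,p}(\Omega)$ are extended by zero to $D$. For $\eta\in\mathbb{R}^N$ put $[\eta^{p-2}]=\mathrm{diag}(|\eta_1|^{p-2},\dots,|\eta_N|^{p-2})$. **Controls.** Let $0<\alpha\le\beta$. $M_p^{\alpha,\beta}(D)$ is the set of symmetric matrices $\mathcal U=[a_{ij}]\in L^\infty(D;\mathbb{R}^{N\times N})$ such that, for a.e. $x\in D$, $|a_{ij}(x)|\le\beta$ for all $i,j$, and for all $\zeta,\eta\in\mathbb{R}^N$ $$\big(\mathcal U(x)([\zeta^{p-2}]\zeta-[\eta^{p-2}]\eta),\zeta-\eta\big)\ge 0,\qquad \big(\mathcal U(x)[\zeta^{p-2}]\zeta,\zeta\big)\ge\alpha\sum_k|\zeta_k|^p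 .$$ Let $\xi_1,\xi_2\in L^\infty(D)$ with $0\le\xi_1\le\xi_2$ a.e., and let $Q_1,\dots,Q_N$ be nonempty compact convex subsets of $W^{-1,q}(D)$. $U_{ad}$ is the set of $\mathcal U=[a_{ij}]=[u_1,\dots,u_N]\in M_p^{\alpha,\beta}(D)$ with $\xi_1\le a_{ij}\le\xi_2$ a.e. in $D$ for all $i,j$ and $\mathrm{div}\,u_i\in Q_i$ for all $i$, where $\langle\mathrm{div}\,u,\varphi\rangle=-\int_D(u,\nabla\varphi)\,dx$ for $\varphi\in W_0^{1,p}(D)$. **Equations.** Let $f\in W^{-1,q}(D)$, $g\in L^p(D)$, let $B:L^q(\Omega)\to L^p(\Omega)$ and $F:W_0^{1,p}(\Omega)\times L^p(\Omega)\to L^q(\Omega)$ be given, and write $\langle\nu,z\rangle=\int_\Omega\nu z\,dx$. For $\mathcal U\in U_{ad}$, $y\in W_0^{1,p}(\Omega)$ is a weak solution of the state equation if $$\int_\Omega(\mathcal U[(\nabla y)^{p-2}]\nabla y,\nabla v)\,dx+\int_\Omega|y|^{p-2}y\,v\,dx=\langle f,v\rangle\quad\forall v\in W_0^{1,p}(\Omega).$$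 For $y\in W_0^{1,p}(\Omega)$ let $\mathcal H(y)$ be the set of $z\in L^p(\Omega)$ with $z+BF(y,z)=g$ in the sense of distributions in $\Omega$. Let $\Xi_{sol}$ be the set of triplets $(\mathcal U,y,z)\in L^\infty(D;\mathbb{R}^{N\times N})\times W_0^{1,p}(\Omega)\times L^p(\Omega)$ such that $\mathcal U\in U_{ad}$, $y$ is a weak solution of the state equation for $\mathcal U$, and $z\in\mathcal H(y)$. Let $\tau$ be the product of the weak-$*$ topology of $L^\infty(D;\mathbb{R}^{N\times N})$ and the weak topologies of $W_0^{1,p}(\Omega)$ and $L^p(\Omega)$. **Hypotheses.** 1. $B$ is linear, continuous and positive: $\langle\nu,B\nu\rangle>0$ for all $\nu\ne 0$. $B_r^{-1}$ is a right inverse of $B$ on the range of $B$, that is, $BB_r^{-1}h=h$ for all $h$ in the range, and $g|_\Omega$ belongs to the range of $B$ (which is automatic if $B$ has a right inverse on all of $L^p(\Omega)$). 2. $F$ has uniformly semi-bounded variation: for every bounded $Y_0\subset W_0^{1,p}(\Omega)$ there are a seminorm $|||\cdot|||$ on $L^p(\Omega)$ that is compact with respect to the norm (the unit ball of $L^p(\Omega)$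 is totally bounded for it) and functions $C_y:[0,\infty)^2\to\mathbb{R}$, $y\in Y_0$, continuous and with $C_y(r,t)/t\to0$ as $t\to0^+$ for every $r>0$, such that $\langle F(y,z_1)-F(y,z_2),z_1-z_2\rangle\ge-\inf_{y'\in Y_0}C_{y'}(R,|||z_1-z_2|||)$ for all $R>0$, $y\in Y_0$ and $\|z_1\|,\|z_2\|\le R$. 3. For every $y\in W_0^{1,p}(\Omega)$, $F(y,\cdot)$ is radially continuous: for all $z_1,z_2\in L^p(\Omega)$ there is $\varepsilon>0$ such that $t\mapsto\langle F(y,z_1+tz_2),z_2\rangle$ is continuous on $[0,\varepsilon]$. 4. For every bounded $Y_0\subset W_0^{1,p}(\Omega)$ there is $\lambda>0$ such that $\langle F(y,z)-B_r^{-1}(g|_\Omega),z\rangle\ge0$ for all $y\in Y_0$ and all $z\in L^p(\Omega)$ with $\|z\|>\lambda$. 5. For every $z\in L^p(\Omega)$: if $y_k\to y_0$ weakly in $W_0^{1,p}(\Omega)$, then $F(y_k,z)\to F(y_0,z)$ strongly in $L^q(\Omega)$. **Conclusion.** If a sequence $(\mathcal U_k,y_k,z_k)\in\Xi_{sol}$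 $\tau$-converges to $(\mathcal U_0,y_0,z_0)\in L^\infty(D;\mathbb{R}^{N\times N})\times W_0^{1,p}(\Omega)\times L^p(\Omega)$, then $\mathcal U_0\in U_{ad}$, $y_0$ is the unique weak solution $y(\mathcal U_0)$ of the state equation for $\mathcal U_0$, $z_0\in\mathcal H(y_0)$, and therefore $(\mathcal U_0,y_0,z_0)\in\Xi_{sol}$. That is, $\Xi_{sol}$ is sequentially $\tau$-closed. Moreover, $\Xi_{sol}$ is sequentially $\tau$-compact: every sequence in $\Xi_{sol}$ has a subsequence that $\tau$-converges to an element of $\Xi_{sol}$. -/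

import Mathlib

open MeasureTheory Set Filter Topology TopologicalSpace
open scoped ENNReal Distributions

noncomputable section

namespace HammersteinControl

/-- The Euclidean space `ℝ^N`. -/
abbrev Eucl (N : ℕ) : Type := EuclideanSpace ℝ (Fin N)

/-- `L^r(Ω)` for an open set `Ω ⊆ ℝ^N`, with Lebesgue measure. -/
abbrev LSp {N : ℕ} (r : ℝ≥0∞) (Ω : Opens (Eucl N)) : Type :=
  Lp ℝ r (volume.restrict (Ω : Set (Eucl N)))

/-- The duality pairing `⟨ν, z⟩ = ∫_Ω ν z dx` between `L^q(Ω)` and `L^p(Ω)`. -/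
def pairing {N : ℕ} {p q : ℝ≥0∞} {Ω : Opens (Eucl N)} (ν : LSp q Ω) (z : LSp p Ω) : ℝ :=
  ∫ x in (Ω : Set (Eucl N)), ν x * z x

/-- The restriction map `L^p(D) → L^p(Ω)` for `Ω ⊆ D`. -/
def restrictL {N : ℕ} {p : ℝ≥0∞} {Ω D : Opens (Eucl N)} (h : Ω ≤ D) (g : LSp p D) : LSp p Ω :=
  ((Lp.memLp g).mono_measure (Measure.restrict_mono_set volume h)).toLp g

/-! ### The space `W₀^{1,p}(Ω)` -/

/-- Tuples `(y, ∂₁y, …, ∂_N y)` of functions in `L^p(ℝ^N)`: the entry `none` is the function and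
the entry `some i` its `i`-th partial derivative. The `ℓ^p` norm on tuples is
`(∫ |y|^p + ∑ᵢ ∫ |∂ᵢy|^p)^{1/p}`. -/
abbrev Jet (N : ℕ) (p : ℝ≥0∞) : Type :=
  PiLp p (fun _ : Option (Fin N) => Lp ℝ p (volume : Measure (Eucl N)))

/-- `C_c^∞(Ω)`, each test function `φ` being identified with `(φ, ∂₁φ, …, ∂_Nφ)`. -/
def testJets {N : ℕ} (p : ℝ≥0∞) [Fact (1 ≤ p)] (Ω : Opens (Eucl N)) :
    Submodule ℝ (Jet N p) where
  carrier := {w | ∃ φ : 𝓓(Ω, ℝ), (w none =ᵐ[volume] fun x => φ x) ∧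
    ∀ i : Fin N, w (some i) =ᵐ[volume] fun x => fderiv ℝ φ x (EuclideanSpace.single i 1)}
  zero_mem' := by
    refine ⟨0, ?_, fun i => ?_⟩
    · exact Lp.coeFn_zero ℝ p volume
    · filter_upwards [Lp.coeFn_zero ℝ p (volume : Measure (Eucl N))] with x hx
      have h0 : (⇑(0 : 𝓓(Ω, ℝ)) : Eucl N → ℝ) = 0 := rfl
      rw [h0]
      simp
  add_mem' := by
    rintro v w ⟨φ, hφ, hφ'⟩ ⟨ψ, hψ, hψ'⟩
    refine ⟨φ + ψ, ?_, fun i => ?_⟩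
    · filter_upwards [Lp.coeFn_add (v none) (w none), hφ, hψ] with x h1 h2 h3
      change (v none + w none : Lp ℝ p volume) x = φ x + ψ x
      rw [h1, Pi.add_apply, h2, h3]
    · filter_upwards [Lp.coeFn_add (v (some i)) (w (some i)), hφ' i, hψ' i] with x h1 h2 h3
      change (v (some i) + w (some i) : Lp ℝ p volume) x =
        fderiv ℝ ((φ : Eucl N → ℝ) + (ψ : Eucl N → ℝ)) x (EuclideanSpace.single i 1)
      rw [h1, Pi.add_apply, h2, h3, fderiv_add
        (φ.contDiff.contDiffAt.differentiableAt (by simp))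
        (ψ.contDiff.contDiffAt.differentiableAt (by simp))]
      rfl
  smul_mem' := by
    rintro c v ⟨φ, hφ, hφ'⟩
    refine ⟨c • φ, ?_, fun i => ?_⟩
    · filter_upwards [Lp.coeFn_smul c (v none), hφ] with x h1 h2
      change (c • v none : Lp ℝ p volume) x = c • φ x
      rw [h1, Pi.smul_apply, h2]
    · filter_upwards [Lp.coeFn_smul c (v (some i)), hφ' i] with x h1 h2
      change (c • v (some i) : Lp ℝ p volume) x =
        fderiv ℝ (c • (φ : Eucl N → ℝ)) x (EuclideanSpace.single i 1)
      rw [h1, Pi.smul_apply, h2, fderiv_const_smul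
        (φ.contDiff.contDiffAt.differentiableAt (by simp))]
      rfl

/-- `W₀^{1,p}(Ω)`: the closure of `C_c^∞(Ω)` in the Sobolev norm. Elements are carried as functions
on `ℝ^N` (zero outside `Ω`) together with their weak gradients, so that `Ω ⊆ D` gives the
inclusion `W₀^{1,p}(Ω) ⊆ W₀^{1,p}(D)` by extension by zero. -/
def sobolevZero {N : ℕ} (p : ℝ≥0∞) [Fact (1 ≤ p)] (Ω : Opens (Eucl N)) : Submodule ℝ (Jet N p) :=
  (testJets p Ω).topologicalClosure

/-- `W₀^{1,p}(Ω)` as a normed space. -/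
abbrev W0 {N : ℕ} (p : ℝ≥0∞) [Fact (1 ≤ p)] (Ω : Opens (Eucl N)) : Type := sobolevZero p Ω

theorem sobolevZero_mono {N : ℕ} (p : ℝ≥0∞) [Fact (1 ≤ p)] {Ω D : Opens (Eucl N)} (h : Ω ≤ D) :
    sobolevZero p Ω ≤ sobolevZero p D := by
  refine Submodule.topologicalClosure_mono ?_
  rintro w ⟨φ, h0, h1⟩
  exact ⟨⟨φ, φ.contDiff, φ.hasCompactSupport, φ.tsupport_subset.trans h⟩, h0, h1⟩

/-- Extension by zero `W₀^{1,p}(Ω) → W₀^{1,p}(D)`. -/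
def extendZero {N : ℕ} {p : ℝ≥0∞} [Fact (1 ≤ p)] {Ω D : Opens (Eucl N)} (h : Ω ≤ D) :
    W0 p Ω →ₗ[ℝ] W0 p D :=
  Submodule.inclusion (sobolevZero_mono p h)

/-- The function underlying an element of `W₀^{1,p}(Ω)`. -/
def W0.fn {N : ℕ} {p : ℝ≥0∞} [Fact (1 ≤ p)] {Ω : Opens (Eucl N)} (y : W0 p Ω) : Eucl N → ℝ :=
  (y : Jet N p) none

/-- The weak partial derivative `∂ᵢ y`. -/
def W0.grad {N : ℕ} {p : ℝ≥0∞} [Fact (1 ≤ p)] {Ω : Opens (Eucl N)} (y : W0 p Ω) (i : Fin N) :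
    Eucl N → ℝ :=
  (y : Jet N p) (some i)

/-- `W^{-1,q}(D)`, the dual space of `W₀^{1,p}(D)`, where `1/p + 1/q = 1`. -/
abbrev WNeg {N : ℕ} (p : ℝ≥0∞) [Fact (1 ≤ p)] (D : Opens (Eucl N)) : Type :=
  StrongDual ℝ (W0 p D)

/-! ### Controls -/

/-- `L^∞(D; ℝ^{N×N})`, a matrix being given by its entries. -/
abbrev Control {N : ℕ} (D : Opens (Eucl N)) : Type := Fin N → Fin N → LSp ∞ D

/-- `t ↦ |t|^{p-2} t`. -/
def powMap (p : ℝ≥0∞) (t : ℝ) : ℝ := |t| ^ (p.toReal - 2) * t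

/-- `(A [ζ^{p-2}]ζ, η) = ∑_{i,j} a_{ij} |ζ_j|^{p-2} ζ_j η_i`, for `A = (a_{ij})`. -/
def flux {N : ℕ} (p : ℝ≥0∞) (A : Fin N → Fin N → ℝ) (ζ η : Fin N → ℝ) : ℝ :=
  ∑ i, ∑ j, A i j * powMap p (ζ j) * η i

/-- The class `M_p^{α,β}(D)`. -/
structure IsMClass {N : ℕ} (p : ℝ≥0∞) (α β : ℝ) {D : Opens (Eucl N)} (U : Control D) : Prop where
  symm : ∀ i j, U i j = U j i
  growth : ∀ i j, ∀ᵐ x ∂(volume.restrict (D : Set (Eucl N))), |U i j x| ≤ β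
  monotone : ∀ᵐ x ∂(volume.restrict (D : Set (Eucl N))), ∀ ζ η : Fin N → ℝ,
    0 ≤ flux p (fun i j => U i j x) ζ (ζ - η) - flux p (fun i j => U i j x) η (ζ - η)
  coercive : ∀ᵐ x ∂(volume.restrict (D : Set (Eucl N))), ∀ ζ : Fin N → ℝ,
    α * ∑ k, |ζ k| ^ p.toReal ≤ flux p (fun i j => U i j x) ζ ζ

/-- `ℓ ∈ W^{-1,q}(D)` is the divergence of the bounded vector field `u`. -/
def IsDivergence {N : ℕ} {p : ℝ≥0∞} [Fact (1 ≤ p)] {D : Opens (Eucl N)} (u : Fin N → LSp ∞ D)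
    (ℓ : WNeg p D) : Prop :=
  ∀ φ : W0 p D, ℓ φ = -∫ x in (D : Set (Eucl N)), ∑ j, u j x * W0.grad φ j x

/-- The set `U_b`. -/
def boundedControls {N : ℕ} (p : ℝ≥0∞) (α β : ℝ) {D : Opens (Eucl N)} (ξ₁ ξ₂ : LSp ∞ D) :
    Set (Control D) :=
  {U | IsMClass p α β U ∧ ∀ i j, ∀ᵐ x ∂(volume.restrict (D : Set (Eucl N))),
    ξ₁ x ≤ U i j x ∧ U i j x ≤ ξ₂ x}

/-- The set `U_sol`: the `i`-th column `u_i` of the matrix has divergence in `Q_i`. -/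
def solenoidalControls {N : ℕ} (p : ℝ≥0∞) [Fact (1 ≤ p)] (α β : ℝ) {D : Opens (Eucl N)}
    (Q : Fin N → Set (WNeg p D)) : Set (Control D) :=
  {U | IsMClass p α β U ∧ ∀ i, ∃ ℓ ∈ Q i, IsDivergence (fun j => U j i) ℓ}

/-- The set `U_ad = U_b ∩ U_sol` of admissible controls of solenoidal type. -/
def admissibleControls {N : ℕ} (p : ℝ≥0∞) [Fact (1 ≤ p)] (α β : ℝ) {D : Opens (Eucl N)}
    (ξ₁ ξ₂ : LSp ∞ D) (Q : Fin N → Set (WNeg p D)) : Set (Control D) :=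
  boundedControls p α β ξ₁ ξ₂ ∩ solenoidalControls p α β Q

/-! ### The state equations -/

/-- `y ∈ W₀^{1,p}(Ω)` is a weak solution of
`-div (U [(∇y)^{p-2}] ∇y) + |y|^{p-2} y = f` in `Ω`. -/
def IsWeakSolution {N : ℕ} {p : ℝ≥0∞} [Fact (1 ≤ p)] {Ω D : Opens (Eucl N)} (h : Ω ≤ D)
    (f : WNeg p D) (U : Control D) (y : W0 p Ω) : Prop :=
  ∀ v : W0 p Ω,
    (∫ x in (Ω : Set (Eucl N)), flux p (fun i j => U i j x) (fun j => W0.grad y j x)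
        (fun i => W0.grad v i x)) +
      (∫ x in (Ω : Set (Eucl N)), powMap p (W0.fn y x) * W0.fn v x) =
    f (extendZero h v)

/-- The set `H(y)` of all `z ∈ L^p(Ω)` such that `z + B F(y, z) = g` in the sense of distributions
in `Ω`. -/
def hammersteinSet {N : ℕ} {p q : ℝ≥0∞} [Fact (1 ≤ p)] [Fact (1 ≤ q)] {Ω D : Opens (Eucl N)}
    (B : LSp q Ω →L[ℝ] LSp p Ω) (F : W0 p Ω → LSp p Ω → LSp q Ω) (g : LSp p D) (y : W0 p Ω) :
    Set (LSp p Ω) :=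
  {z | ∀ φ : 𝓓(Ω, ℝ), (∫ x in (Ω : Set (Eucl N)), z x * φ x) +
      (∫ x in (Ω : Set (Eucl N)), B (F y z) x * φ x) = ∫ x in (Ω : Set (Eucl N)), g x * φ x}

/-- The set `Ξ_sol` of admissible triplets. -/
def admissibleTriplets {N : ℕ} {p q : ℝ≥0∞} [Fact (1 ≤ p)] [Fact (1 ≤ q)] {Ω D : Opens (Eucl N)}
    (h : Ω ≤ D) (α β : ℝ) (ξ₁ ξ₂ : LSp ∞ D) (Q : Fin N → Set (WNeg p D))
    (B : LSp q Ω →L[ℝ] LSp p Ω) (F : W0 p Ω → LSp p Ω → LSp q Ω) (f : WNeg p D) (g : LSp p D) :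
    Set (Control D × W0 p Ω × LSp p Ω) :=
  {t | t.1 ∈ admissibleControls p α β ξ₁ ξ₂ Q ∧ IsWeakSolution h f t.1 t.2.1 ∧
    t.2.2 ∈ hammersteinSet B F g t.2.1}

/-! ### The topology `τ` -/

/-- The duality pairings `∫_D a_{ij} φ dx` of `U = (a_{ij}) ∈ L^∞(D; ℝ^{N×N})` with all
`φ ∈ L^1(D)`. The weak-* topology of `L^∞(D; ℝ^{N×N}) = L^1(D; ℝ^{N×N})*` is the topology of
pointwise convergence of these pairings. -/
def weakStarEval {N : ℕ} {D : Opens (Eucl N)} (U : Control D) : Fin N → Fin N → LSp 1 D → ℝ :=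
  fun i j φ => ∫ x in (D : Set (Eucl N)), U i j x * φ x

/-- The product `τ` of the weak-* topology of `L^∞(D; ℝ^{N×N})`, the weak topology of
`W₀^{1,p}(Ω)` and the weak topology of `L^p(Ω)`. -/
@[reducible] def tau {N : ℕ} (p : ℝ≥0∞) [Fact (1 ≤ p)] (Ω D : Opens (Eucl N)) :
    TopologicalSpace (Control D × W0 p Ω × LSp p Ω) :=
  TopologicalSpace.induced
    (fun t : Control D × W0 p Ω × LSp p Ω =>
      (weakStarEval t.1, toWeakSpace ℝ (W0 p Ω) t.2.1, toWeakSpace ℝ (LSp p Ω) t.2.2))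
    inferInstance

/-! ### Conditions on the Hammerstein operators -/

/-- Radial continuity of `G : L^p(Ω) → L^q(Ω) = L^p(Ω)*`. -/
def IsRadiallyContinuous {N : ℕ} {p q : ℝ≥0∞} [Fact (1 ≤ p)] {Ω : Opens (Eucl N)}
    (G : LSp p Ω → LSp q Ω) : Prop :=
  ∀ z₁ z₂ : LSp p Ω, ∃ ε > 0,
    ContinuousOn (fun t : ℝ => pairing (G (z₁ + t • z₂)) z₂) (Icc 0 ε)

/-- A seminorm is compact with respect to the norm if the unit ball of the norm is totally bounded
for the seminorm. -/
def IsCompactSeminorm {Z : Type*} [NormedAddCommGroup Z] [NormedSpace ℝ Z]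
    (S : Seminorm ℝ Z) : Prop :=
  ∀ ε > 0, ∃ T : Set Z, T.Finite ∧ ∀ z : Z, ‖z‖ ≤ 1 → ∃ c ∈ T, S (z - c) < ε

/-- Uniformly semi-bounded variation of `G : Y × L^p(Ω) → L^q(Ω)`. A lower bound by
`-inf_{y' ∈ Y₀} C_{y'}` is a lower bound by `-C_{y'}` for every `y' ∈ Y₀`. -/
def HasUSBV {N : ℕ} {p q : ℝ≥0∞} [Fact (1 ≤ p)] {Ω : Opens (Eucl N)} {Y : Type*}
    [NormedAddCommGroup Y] (G : Y → LSp p Ω → LSp q Ω) : Prop :=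
  ∀ Y₀ : Set Y, Bornology.IsBounded Y₀ →
    ∃ (S : Seminorm ℝ (LSp p Ω)) (C : Y → ℝ → ℝ → ℝ), IsCompactSeminorm S ∧
      (∀ y ∈ Y₀, ContinuousOn (fun s : ℝ × ℝ => C y s.1 s.2) (Ici 0 ×ˢ Ici 0) ∧
        ∀ r > 0, Tendsto (fun t => C y r t / t) (𝓝[>] 0) (𝓝 0)) ∧
      ∀ R > 0, ∀ y ∈ Y₀, ∀ z₁ z₂ : LSp p Ω, ‖z₁‖ ≤ R → ‖z₂‖ ≤ R →
        ∀ y' ∈ Y₀, -C y' R (S (z₁ - z₂)) ≤ pairing (G y z₁ - G y z₂) (z₁ - z₂)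

/-- Compactness of `F(·, z)`: weakly convergent sequences in `W₀^{1,p}(Ω)` are mapped to strongly
convergent sequences in `L^q(Ω)`. -/
def IsCompactInState {N : ℕ} {p q : ℝ≥0∞} [Fact (1 ≤ p)] [Fact (1 ≤ q)] {Ω : Opens (Eucl N)}
    (F : W0 p Ω → LSp p Ω → LSp q Ω) : Prop :=
  ∀ (z : LSp p Ω) (y : ℕ → W0 p Ω) (y₀ : W0 p Ω),
    Tendsto (fun k => toWeakSpace ℝ (W0 p Ω) (y k)) atTop (𝓝 (toWeakSpace ℝ (W0 p Ω) y₀)) →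
      Tendsto (fun k => F (y k) z) atTop (𝓝 (F y₀ z))

end HammersteinControl

end

open HammersteinControl

/-!
The states are bounded by testing the equation with the solution itself, and the solutions `z` of
the Hammerstein equation by the coercivity of `F` and the positivity of `B`. Bounded sets of
controls, states and solutions are sequentially relatively `τ`-compact, so everything reduces to
the closedness of `Ξ_sol`.

The conditions defining `U_ad` other than the one on the divergences are linear inequalities in the
matrix for fixed vectors, hence stable under weak-* convergence. Since each `Q i` is norm compact,
the divergences of the columns converge strongly along a subsequence, and the div-curl lemma then
passes to the limit in the products of the columns with weakly convergent gradients. This is what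
Minty's argument needs for the state equation: monotonicity moves the nonlinearity onto a fixed
element `v`, so that only the products `(u_i, ∇(y_k - v))` occur. The limit is unique by strict
monotonicity.

For the Hammerstein equation, let `ν_k = F(y_k, z_k)`. The semi-bounded variation bounds `ν_k`, so
that `ν_k` has a weak limit, and positivity of `B` bounds the products `⟨ν_k, z_k⟩` in the limit.
Minty's argument applies once more: the compact seminorm is continuous along weakly convergent
sequences, and its contribution `C(R, t)` is of order `o(t)`.
-/

namespace HammersteinControl

/-! ### The map `t ↦ |t|^{p-2} t` -/

section Scalar

variable {p : ℝ≥0∞}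

theorem ne_top_of_one_lt_toReal (hp : 1 < p.toReal) : p ≠ ∞ := by
  rintro rfl
  norm_num at hp

theorem one_lt_of_one_lt_toReal (hp : 1 < p.toReal) : 1 < p := by
  rw [← ENNReal.toReal_one] at hp
  exact (ENNReal.toReal_lt_toReal ENNReal.one_ne_top
    (ne_top_of_one_lt_toReal (by simpa using hp))).1 hp

theorem abs_powMap (hp : 1 < p.toReal) (t : ℝ) : |powMap p t| = |t| ^ (p.toReal - 1) := by
  rw [powMap, abs_mul, abs_of_nonneg (Real.rpow_nonneg (abs_nonneg t) _)]
  rcases eq_or_ne t 0 with rfl | ht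
  · rw [abs_zero, mul_zero, Real.zero_rpow (sub_pos.2 hp).ne']
  · rw [← Real.rpow_add_one (abs_ne_zero.2 ht)]
    ring_nf

theorem powMap_mul_self (hp : 1 < p.toReal) (t : ℝ) : powMap p t * t = |t| ^ p.toReal := by
  rw [powMap, mul_assoc, ← abs_mul_abs_self t, ← mul_assoc]
  rcases eq_or_ne t 0 with rfl | ht
  · rw [abs_zero, mul_zero, Real.zero_rpow (by linarith)]
  · rw [← Real.rpow_add_one (abs_ne_zero.2 ht), ← Real.rpow_add_one (abs_ne_zero.2 ht)]
    ring_nf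

theorem powMap_neg (t : ℝ) : powMap p (-t) = -powMap p t := by
  simp [powMap]

theorem powMap_of_nonneg (hp : 1 < p.toReal) {t : ℝ} (ht : 0 ≤ t) :
    powMap p t = t ^ (p.toReal - 1) := by
  have h : 0 ≤ powMap p t := mul_nonneg (Real.rpow_nonneg (abs_nonneg t) _) ht
  rw [← abs_of_nonneg h, abs_powMap hp, abs_of_nonneg ht]

/- For `p < 2` the factor `|t|^{p-2}` is singular at `0`, so continuity there is read off
from `|powMap p t| = |t|^{p-1}`. -/
theorem continuous_powMap (hp : 1 < p.toReal) : Continuous (powMap p) := by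
  refine continuous_iff_continuousAt.2 fun t => ?_
  rcases eq_or_ne t 0 with rfl | ht
  · have hlim : Tendsto (fun t : ℝ => |t| ^ (p.toReal - 1)) (𝓝 0) (𝓝 0) := by
      have hc : Continuous fun t : ℝ => |t| ^ (p.toReal - 1) :=
        continuous_abs.rpow_const fun _ => Or.inr (sub_pos.2 hp).le
      simpa [Real.zero_rpow (sub_pos.2 hp).ne'] using hc.tendsto 0
    have hzero : powMap p 0 = 0 := by simp [powMap]
    rw [ContinuousAt, hzero]
    exact squeeze_zero_norm (fun t => (abs_powMap hp t).le) hlim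
  · exact (continuous_abs.continuousAt.rpow_const (Or.inl (abs_ne_zero.2 ht))).mul continuousAt_id

theorem strictMono_powMap (hp : 1 < p.toReal) : StrictMono (powMap p) := by
  have hpos : StrictMonoOn (powMap p) (Ici 0) := by
    intro a ha b hb hab
    rw [powMap_of_nonneg hp ha, powMap_of_nonneg hp hb]
    exact Real.rpow_lt_rpow ha hab (sub_pos.2 hp)
  refine StrictMonoOn.Iic_union_Ici (a := 0) (fun a ha b hb hab => ?_) hpos
  have := hpos (mem_Ici.2 (neg_nonneg.2 hb)) (mem_Ici.2 (neg_nonneg.2 ha)) (neg_lt_neg hab)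
  rwa [powMap_neg, powMap_neg, neg_lt_neg_iff] at this

theorem powMap_sub_mul_sub_pos (hp : 1 < p.toReal) {a b : ℝ} (h : a ≠ b) :
    0 < (powMap p a - powMap p b) * (a - b) := by
  rcases lt_or_gt_of_ne h with h | h
  · exact mul_pos_of_neg_of_neg (sub_neg.2 (strictMono_powMap hp h)) (sub_neg.2 h)
  · exact mul_pos (sub_pos.2 (strictMono_powMap hp h)) (sub_pos.2 h)

theorem powMap_sub_mul_sub_nonneg (hp : 1 < p.toReal) (a b : ℝ) :
    0 ≤ (powMap p a - powMap p b) * (a - b) := by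
  rcases eq_or_ne a b with rfl | h
  · simp
  · exact (powMap_sub_mul_sub_pos hp h).le

end Scalar

section LpPowMap

variable {α : Type*} [MeasurableSpace α] {μ : Measure α} {p q : ℝ≥0∞}

theorem memLp_powMap [hpq : p.HolderConjugate q] (hp : 1 < p.toReal) {u : α → ℝ}
    (hu : MemLp u p μ) : MemLp (fun x => powMap p (u x)) q μ := by
  have hp1 := one_lt_of_one_lt_toReal hp
  have hp' := ne_top_of_one_lt_toReal hp
  have hq : q = p / (p - 1) := by
    rw [(ENNReal.isConjExponent_iff_eq_conjExponent hp1.le).1 hpq]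
    nth_rewrite 2 [← tsub_add_cancel_of_le hp1.le]
    rw [ENNReal.add_div, ENNReal.div_self (tsub_pos_of_lt hp1).ne' (ENNReal.sub_ne_top hp'),
      one_div]
  have h := hu.norm_rpow_div (p - 1)
  rw [← hq, ENNReal.toReal_sub_of_le hp1.le hp', ENNReal.toReal_one] at h
  refine h.of_le ((continuous_powMap hp).comp_aestronglyMeasurable hu.1) (ae_of_all _ fun x => ?_)
  simp only [Real.norm_eq_abs, abs_powMap hp]
  exact le_abs_self _

theorem integrable_mul_of_memLp [p.HolderConjugate q] {u v : α → ℝ} (hu : MemLp u q μ)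
    (hv : MemLp v p μ) : Integrable (fun x => u x * v x) μ :=
  memLp_one_iff_integrable.1 (hv.mul' hu)

theorem integrable_mul_mul_of_memLp [p.HolderConjugate q] {a u v : α → ℝ} (ha : MemLp a ∞ μ)
    (hu : MemLp u q μ) (hv : MemLp v p μ) : Integrable (fun x => a x * u x * v x) μ :=
  have hau : MemLp (fun x => a x * u x) q μ := hu.mul' ha
  integrable_mul_of_memLp hau hv

theorem Lp_norm_rpow_eq_integral [hp₁ : Fact (1 ≤ p)] (hp : p ≠ ∞) (v : Lp ℝ p μ) :
    ‖v‖ ^ p.toReal = ∫ x, |v x| ^ p.toReal ∂μ := by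
  have h0 : p ≠ 0 := (zero_lt_one.trans_le hp₁.out).ne'
  have hint : 0 ≤ ∫ x, ‖v x‖ ^ p.toReal ∂μ := integral_nonneg fun x => by positivity
  rw [Lp.norm_def, (Lp.memLp v).eLpNorm_eq_integral_rpow_norm h0 hp,
    ENNReal.toReal_ofReal (Real.rpow_nonneg hint _), Real.rpow_inv_rpow hint
    (ENNReal.toReal_pos h0 hp).ne']
  rfl

theorem integrable_abs_rpow [hp₁ : Fact (1 ≤ p)] (hp : p ≠ ∞) {v : α → ℝ} (hv : MemLp v p μ) :
    Integrable (fun x => |v x| ^ p.toReal) μ :=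
  hv.integrable_norm_rpow (zero_lt_one.trans_le hp₁.out).ne' hp

/- Dominated convergence, with `(|u| + |w|)^{p-1} |h|` as the dominating function. -/
theorem tendsto_integral_powMap_add_smul [p.HolderConjugate q] (hp : 1 < p.toReal)
    {u w h : α → ℝ} (hu : MemLp u p μ) (hw : MemLp w p μ) (hh : MemLp h p μ) :
    Tendsto (fun t : ℝ => ∫ x, powMap p (u x + t * w x) * h x ∂μ) (𝓝 0)
      (𝓝 (∫ x, powMap p (u x) * h x ∂μ)) := by
  have hdom : MemLp (fun x => powMap p (|u x| + |w x|)) q μ := memLp_powMap hp (hu.abs.add hw.abs)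
  refine tendsto_integral_filter_of_dominated_convergence
    (fun x => powMap p (|u x| + |w x|) * |h x|) ?_ ?_ (integrable_mul_of_memLp hdom hh.abs) ?_
  · exact Eventually.of_forall fun t => ((continuous_powMap hp).comp_aestronglyMeasurable
      (hu.1.add (hw.1.const_mul t))).mul hh.1
  · filter_upwards [Metric.ball_mem_nhds (0 : ℝ) one_pos] with t ht
    rw [mem_ball_zero_iff, Real.norm_eq_abs] at ht
    refine ae_of_all _ fun x => ?_
    simp only [norm_mul, Real.norm_eq_abs]
    gcongr
    rw [abs_powMap hp, powMap_of_nonneg hp (by positivity)]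
    refine Real.rpow_le_rpow (abs_nonneg _) ?_ (sub_pos.2 hp).le
    calc |u x + t * w x| ≤ |u x| + |t * w x| := abs_add_le _ _
      _ = |u x| + |t| * |w x| := by rw [abs_mul]
      _ ≤ |u x| + |w x| := by nlinarith [abs_nonneg (w x)]
  · refine ae_of_all _ fun x => ?_
    have hc : Continuous fun t : ℝ => powMap p (u x + t * w x) * h x := by
      have := continuous_powMap hp
      fun_prop
    simpa using hc.tendsto 0

end LpPowMap

/-! ### Duality of `L^p` and `L^q` -/

section LpDuality

variable {α : Type*} [MeasurableSpace α] {μ : Measure α} {p q : ℝ≥0∞}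

/-- Multiplication by an essentially bounded function on `L^p`. -/
noncomputable def lpMul [Fact (1 ≤ p)] (a : Lp ℝ ∞ μ) : Lp ℝ p μ →L[ℝ] Lp ℝ p μ :=
  (ContinuousLinearMap.mul ℝ ℝ).holderL μ ∞ p p a

theorem coeFn_lpMul [Fact (1 ≤ p)] (a : Lp ℝ ∞ μ) (f : Lp ℝ p μ) :
    lpMul a f =ᵐ[μ] fun x => a x * f x :=
  (ContinuousLinearMap.mul ℝ ℝ).coeFn_holder a f

theorem coeFn_lpMul_toLp [Fact (1 ≤ p)] {a : α → ℝ} (ha : MemLp a ∞ μ) (f : Lp ℝ p μ) :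
    lpMul (ha.toLp a) f =ᵐ[μ] fun x => a x * f x := by
  filter_upwards [coeFn_lpMul (ha.toLp a) f, ha.coeFn_toLp] with x hmul ha
  rw [hmul, ha]

theorem norm_lpMul_apply_le [Fact (1 ≤ p)] (a : Lp ℝ ∞ μ) (f : Lp ℝ p μ) :
    ‖lpMul a f‖ ≤ ‖a‖ * ‖f‖ := by
  have h := (ContinuousLinearMap.mul ℝ ℝ).norm_holder_apply_apply_le (r := p) a f
  rw [ContinuousLinearMap.opNorm_mul, one_mul] at h
  exact h

variable (μ p q) in
/-- The map `L^p → (L^q)*`, `f ↦ ∫ f ·`, for conjugate exponents. -/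
noncomputable def lpToDual [Fact (1 ≤ p)] [Fact (1 ≤ q)] [p.HolderConjugate q] :
    Lp ℝ p μ →L[ℝ] StrongDual ℝ (Lp ℝ q μ) :=
  (ContinuousLinearMap.mul ℝ ℝ).lpPairing μ p q

variable [Fact (1 ≤ p)] [Fact (1 ≤ q)] [hpq : p.HolderConjugate q]

theorem lpToDual_apply (f : Lp ℝ p μ) (g : Lp ℝ q μ) :
    lpToDual μ p q f g = ∫ x, f x * g x ∂μ := by
  simp [lpToDual, ContinuousLinearMap.lpPairing_eq_integral]

theorem lpToDual_toLp_apply {u : α → ℝ} (hu : MemLp u p μ) (g : Lp ℝ q μ) :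
    lpToDual μ p q (hu.toLp u) g = ∫ x, u x * g x ∂μ := by
  rw [lpToDual_apply]
  exact integral_congr_ae (hu.coeFn_toLp.mul (EventuallyEq.refl _ g))

theorem norm_lpToDual_le (f : Lp ℝ p μ) : ‖lpToDual μ p q f‖ ≤ ‖f‖ := by
  refine ContinuousLinearMap.opNorm_le_bound _ (norm_nonneg f) fun g => ?_
  have h : lpToDual μ p q f g = L1.integral ((ContinuousLinearMap.mul ℝ ℝ).holder 1 f g) := by
    rw [lpToDual_apply, L1.integral_eq_integral]
    exact integral_congr_ae
      ((ContinuousLinearMap.mul ℝ ℝ).coeFn_holder (r := 1) f g).symm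
  rw [h]
  refine (L1.norm_integral_le _).trans ?_
  have h := (ContinuousLinearMap.mul ℝ ℝ).norm_holder_apply_apply_le (r := 1) f g
  rwa [ContinuousLinearMap.opNorm_mul, one_mul] at h

theorem norm_toLp_powMap (hp : 1 < p.toReal) (f : Lp ℝ p μ) :
    ‖(memLp_powMap (q := q) hp (Lp.memLp f)).toLp (fun x => powMap p (f x))‖ =
      ‖f‖ ^ (p.toReal - 1) := by
  have hconj : p.toReal.HolderConjugate q.toReal := ENNReal.HolderConjugate.toReal hp
  have hq := ne_top_of_one_lt_toReal (p := q) hconj.symm.lt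
  have hae := (memLp_powMap (q := q) hp (Lp.memLp f)).coeFn_toLp
  rw [← Real.rpow_left_inj (norm_nonneg _) (by positivity) hconj.symm.ne_zero,
    ← Real.rpow_mul (norm_nonneg _), hconj.sub_one_mul_conj, Lp_norm_rpow_eq_integral hq,
    Lp_norm_rpow_eq_integral (ne_top_of_one_lt_toReal hp)]
  refine integral_congr_ae ?_
  filter_upwards [hae] with x hx
  rw [hx, abs_powMap hp, ← Real.rpow_mul (abs_nonneg _), hconj.sub_one_mul_conj]

/- The functional is tested with `|f|^{p-2} f`. -/
theorem norm_le_norm_lpToDual_of_one_lt (hp : 1 < p.toReal) (f : Lp ℝ p μ) :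
    ‖f‖ ≤ ‖lpToDual μ p q f‖ := by
  rcases eq_or_ne f 0 with rfl | hf
  · simp
  set g := (memLp_powMap (q := q) hp (Lp.memLp f)).toLp (fun x => powMap p (f x))
  have hpair : lpToDual μ p q f g = ‖f‖ * ‖f‖ ^ (p.toReal - 1) := by
    rw [lpToDual_apply, ← Real.rpow_one_add' (norm_nonneg f) (by linarith), add_sub_cancel,
      Lp_norm_rpow_eq_integral (ne_top_of_one_lt_toReal hp)]
    refine integral_congr_ae ?_
    filter_upwards [(memLp_powMap (q := q) hp (Lp.memLp f)).coeFn_toLp] with x hx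
    rw [hx, mul_comm, powMap_mul_self hp]
  have hle := (le_abs_self _).trans ((lpToDual μ p q f).le_opNorm g)
  rw [hpair, norm_toLp_powMap hp] at hle
  exact le_of_mul_le_mul_right hle (Real.rpow_pos_of_pos (norm_pos_iff.2 hf) _)

theorem lpToDual_indicatorConstLp (f : Lp ℝ p μ) {s : Set α} (hs : MeasurableSet s)
    (hμs : μ s ≠ ∞) : lpToDual μ p q f (indicatorConstLp q hs hμs 1) = ∫ x in s, f x ∂μ := by
  rw [lpToDual_apply, ← integral_indicator hs]
  refine integral_congr_ae ?_
  filter_upwards [indicatorConstLp_coeFn (p := q) (hs := hs) (hμs := hμs) (c := (1 : ℝ))]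
    with x hx
  rw [hx]
  by_cases hxs : x ∈ s <;> simp [hxs]

theorem norm_le_norm_lpToDual_top [IsFiniteMeasure μ] (f : Lp ℝ ∞ μ) :
    ‖f‖ ≤ ‖lpToDual μ ∞ 1 f‖ := by
  set M := ‖lpToDual μ ∞ 1 f‖
  have hset : ∀ s, MeasurableSet s → |∫ x in s, f x ∂μ| ≤ ∫ _ in s, M ∂μ := by
    intro s hs
    have h := (lpToDual μ ∞ 1 f).le_opNorm (indicatorConstLp 1 hs (measure_ne_top μ s) (1 : ℝ))
    rw [lpToDual_indicatorConstLp, norm_indicatorConstLp (by simp) (by simp)] at h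
    rw [setIntegral_const, smul_eq_mul, mul_comm]
    simpa using h
  have hint : Integrable f μ := (Lp.memLp f).integrable le_top
  have hle : f ≤ᵐ[μ] fun _ => M := ae_le_of_forall_setIntegral_le hint (integrable_const _)
    fun s hs _ => (le_abs_self _).trans (hset s hs)
  have hge : (fun x => -f x) ≤ᵐ[μ] fun _ => M :=
    ae_le_of_forall_setIntegral_le hint.neg (integrable_const _) fun s hs _ => by
      rw [integral_neg]
      exact (neg_le_abs _).trans (hset s hs)
  have hbound : ∀ᵐ x ∂μ, ‖f x‖ ≤ M := by
    filter_upwards [hle, hge] with x hx hx'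
    exact abs_le.2 ⟨neg_le.1 hx', hx⟩
  simpa using Lp.norm_le_of_ae_bound (norm_nonneg (lpToDual μ ∞ 1 f)) hbound

theorem norm_lpToDual [IsFiniteMeasure μ] (hq : q ≠ ∞) (f : Lp ℝ p μ) :
    ‖lpToDual μ p q f‖ = ‖f‖ := by
  refine le_antisymm (norm_lpToDual_le f) ?_
  rcases eq_or_ne p ∞ with rfl | hp
  · obtain rfl : q = 1 := (ENNReal.HolderConjugate.eq_top_iff_eq_one ∞ q).1 rfl
    exact norm_le_norm_lpToDual_top f
  · refine norm_le_norm_lpToDual_of_one_lt ?_ f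
    have hp1 : p ≠ 1 := fun h =>
      hq ((ENNReal.HolderConjugate.eq_top_iff_eq_one q p).2 h)
    have hlt : 1 < p := lt_of_le_of_ne Fact.out hp1.symm
    simpa using (ENNReal.toReal_lt_toReal ENNReal.one_ne_top hp).2 hlt

end LpDuality

/-! ### Representation of functionals on `L^p` -/

section RieszRepresentation

variable {α : Type*} [MeasurableSpace α] {μ : Measure α} {p q : ℝ≥0∞}

theorem strongDual_Lp_ext [Fact (1 ≤ p)] [IsFiniteMeasure μ] (hp : p ≠ ∞)
    {Λ Λ' : StrongDual ℝ (Lp ℝ p μ)}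
    (h : ∀ s (hs : MeasurableSet s), Λ (indicatorConstLp p hs (measure_ne_top μ s) 1) =
      Λ' (indicatorConstLp p hs (measure_ne_top μ s) 1)) : Λ = Λ' := by
  ext f
  induction f using Lp.induction hp with
  | @indicatorConst c s hs hμs =>
    have hc : indicatorConstLp p hs hμs.ne c = c • indicatorConstLp p hs hμs.ne (1 : ℝ) := by
      rw [indicatorConstLp, indicatorConstLp, ← MemLp.toLp_const_smul]
      exact MemLp.toLp_congr _ _ (ae_of_all _ fun x => by by_cases hx : x ∈ s <;> simp [hx])
    rw [Lp.simpleFunc.coe_indicatorConst, hc, map_smul, map_smul, h s hs]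
  | add _ _ _ ihf ihg => rw [map_add, map_add, ihf, ihg]
  | isClosed => exact isClosed_eq Λ.continuous Λ'.continuous

theorem lpMul_indicatorConstLp [Fact (1 ≤ p)] [IsFiniteMeasure μ] {A s : Set α}
    (hA : MeasurableSet A) (hs : MeasurableSet s) :
    lpMul (indicatorConstLp ∞ hA (measure_ne_top μ A) 1)
      (indicatorConstLp p hs (measure_ne_top μ s) 1) =
    indicatorConstLp p (hs.inter hA) (measure_ne_top μ _) 1 := by
  refine Lp.ext ?_
  filter_upwards [coeFn_lpMul (indicatorConstLp ∞ hA (measure_ne_top μ A) 1)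
      (indicatorConstLp p hs (measure_ne_top μ s) 1),
    indicatorConstLp_coeFn (p := ∞) (hs := hA) (hμs := measure_ne_top μ A) (c := (1 : ℝ)),
    indicatorConstLp_coeFn (p := p) (hs := hs) (hμs := measure_ne_top μ s) (c := (1 : ℝ)),
    indicatorConstLp_coeFn (p := p) (hs := hs.inter hA) (hμs := measure_ne_top μ _)
      (c := (1 : ℝ))] with x hmul hxA hxs hxsA
  rw [hmul, hxA, hxs, hxsA]
  by_cases h : x ∈ s <;> by_cases h' : x ∈ A <;> simp [h, h']

theorem tendsto_measure_biUnion_symmDiff_iUnion [IsFiniteMeasure μ] {s : ℕ → Set α}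
    (hs : ∀ i, MeasurableSet (s i)) :
    Tendsto (fun t : Finset ℕ => μ (symmDiff (⋃ i ∈ t, s i) (⋃ i, s i))) atTop (𝓝 0) := by
  have hsub : ∀ t : Finset ℕ, ⋃ i ∈ t, s i ⊆ ⋃ i, s i := fun t => iUnion₂_subset_iUnion _ _
  have hanti : Antitone fun t : Finset ℕ => (⋃ i, s i) \ ⋃ i ∈ t, s i :=
    fun t t' htt' => sdiff_subset_sdiff_right (biUnion_subset_biUnion_left htt')
  have hempty : ⋂ t : Finset ℕ, ((⋃ i, s i) \ ⋃ i ∈ t, s i) = ∅ := by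
    refine eq_empty_of_forall_notMem fun x hx => ?_
    rw [mem_iInter] at hx
    obtain ⟨i, hi⟩ := mem_iUnion.1 (hx ∅).1
    exact (hx {i}).2 (by simpa using hi)
  have hlim := tendsto_measure_iInter_atTop (μ := μ)
    (fun t : Finset ℕ => ((MeasurableSet.iUnion hs).diff
      (t.measurableSet_biUnion fun i _ => hs i)).nullMeasurableSet) hanti ⟨∅, measure_ne_top μ _⟩
  rw [hempty, measure_empty] at hlim
  exact hlim.congr fun t => by rw [Function.comp_apply, symmDiff_of_le (hsub t)]

theorem hasSum_apply_indicatorConstLp [Fact (1 ≤ p)] [IsFiniteMeasure μ] (hp : p ≠ ∞)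
    (Λ : StrongDual ℝ (Lp ℝ p μ)) {s : ℕ → Set α} (hs : ∀ i, MeasurableSet (s i))
    (hdisj : Pairwise (Function.onFun Disjoint s)) :
    HasSum (fun i => Λ (indicatorConstLp p (hs i) (measure_ne_top μ _) 1))
      (Λ (indicatorConstLp p (MeasurableSet.iUnion hs) (measure_ne_top μ _) 1)) := by
  have hlim := (Λ.continuous.tendsto _).comp (tendsto_indicatorConstLp_set
    (hs := MeasurableSet.iUnion hs) (hμs := measure_ne_top μ _) (c := (1 : ℝ))
    (ht := fun t : Finset ℕ => t.measurableSet_biUnion fun i _ => hs i)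
    (hμt := fun _ => measure_ne_top μ _) hp (tendsto_measure_biUnion_symmDiff_iUnion hs))
  refine hlim.congr fun t => ?_
  rw [Function.comp_apply, ← map_sum]
  congr 1
  classical
  induction t using Finset.induction_on with
  | empty => simp [indicatorConstLp_empty]
  | insert i t hi ih =>
    have hd : Disjoint (s i) (⋃ j ∈ t, s j) :=
      disjoint_iUnion₂_right.2 fun j hj => hdisj (ne_of_mem_of_not_mem hj hi).symm
    rw [Finset.sum_insert hi, ← ih, ← indicatorConstLp_disjoint_union _ _ _ _ hd]
    congr 1
    simp

/-- The signed measure `s ↦ Λ 1_s` attached to a functional `Λ` on `L^p`. -/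
noncomputable def signedMeasureOfDual [Fact (1 ≤ p)] [IsFiniteMeasure μ] (hp : p ≠ ∞)
    (Λ : StrongDual ℝ (Lp ℝ p μ)) : SignedMeasure α where
  measureOf' s := open Classical in
    if hs : MeasurableSet s then Λ (indicatorConstLp p hs (measure_ne_top μ s) 1) else 0
  empty' := by simp [indicatorConstLp_empty]
  not_measurable' s hs := dif_neg hs
  m_iUnion' s hs hdisj := by
    simpa only [hs, MeasurableSet.iUnion hs, dite_true] using
      hasSum_apply_indicatorConstLp hp Λ hs hdisj

theorem signedMeasureOfDual_apply [Fact (1 ≤ p)] [IsFiniteMeasure μ] (hp : p ≠ ∞)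
    (Λ : StrongDual ℝ (Lp ℝ p μ)) {s : Set α} (hs : MeasurableSet s) :
    signedMeasureOfDual hp Λ s = Λ (indicatorConstLp p hs (measure_ne_top μ s) 1) :=
  dif_pos hs

theorem exists_measurable_density [hp₁ : Fact (1 ≤ p)] [IsFiniteMeasure μ] (hp : p ≠ ∞)
    (Λ : StrongDual ℝ (Lp ℝ p μ)) :
    ∃ g : α → ℝ, Measurable g ∧ ∀ s (hs : MeasurableSet s),
      Λ (indicatorConstLp p hs (measure_ne_top μ s) 1) = ∫ x in s, g x ∂μ := by
  have hac : VectorMeasure.AbsolutelyContinuous (signedMeasureOfDual hp Λ)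
      μ.toENNRealVectorMeasure := by
    refine VectorMeasure.AbsolutelyContinuous.mk fun s hs hμs => ?_
    rw [Measure.toENNRealVectorMeasure_apply_measurable hs] at hμs
    have hzero : indicatorConstLp p hs (measure_ne_top μ s) (1 : ℝ) = 0 := by
      have h0 : p ≠ 0 := (zero_lt_one.trans_le hp₁.out).ne'
      rw [← norm_eq_zero, norm_indicatorConstLp h0 hp, measureReal_def, hμs, ENNReal.toReal_zero,
        Real.zero_rpow (one_div_ne_zero (ENNReal.toReal_pos h0 hp).ne'), mul_zero]
    rw [signedMeasureOfDual_apply hp Λ hs, hzero, map_zero]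
  refine ⟨(signedMeasureOfDual hp Λ).rnDeriv μ, SignedMeasure.measurable_rnDeriv _ _,
    fun s hs => ?_⟩
  rw [← signedMeasureOfDual_apply hp Λ hs,
    ← withDensityᵥ_apply (SignedMeasure.integrable_rnDeriv _ _) hs,
    SignedMeasure.withDensityᵥ_rnDeriv_eq _ _ hac]

variable [Fact (1 ≤ p)] [Fact (1 ≤ q)] [hpq : p.HolderConjugate q] [IsFiniteMeasure μ]

/- Cutting off at height `n` does not increase the norm of the functional, because the cut-off
density represents `v ↦ Λ (1_{|g| ≤ n} v)`. -/
theorem eLpNorm_truncation_le (hq : q ≠ ∞) (Λ : StrongDual ℝ (Lp ℝ q μ)) {g : α → ℝ}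
    (hg : Measurable g) (h : ∀ s (hs : MeasurableSet s),
      Λ (indicatorConstLp q hs (measure_ne_top μ s) 1) = ∫ x in s, g x ∂μ) (n : ℕ) :
    eLpNorm ({x | |g x| ≤ n}.indicator g) p μ ≤ ENNReal.ofReal ‖Λ‖ := by
  set A : Set α := {x | |g x| ≤ n}
  have hA : MeasurableSet A := measurableSet_le hg.abs measurable_const
  set χ : Lp ℝ ∞ μ := indicatorConstLp ∞ hA (measure_ne_top μ A) 1
  have hcut : MemLp (A.indicator g) p μ :=
    MemLp.of_bound (hg.indicator hA).aestronglyMeasurable n <| ae_of_all _ fun x => by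
      rw [norm_indicator_eq_indicator_norm]
      exact indicator_apply_le' (fun hx => hx) fun _ => Nat.cast_nonneg n
  have hrep : lpToDual μ p q (hcut.toLp _) = Λ.comp (lpMul χ) := by
    refine strongDual_Lp_ext hq fun s hs => ?_
    rw [lpToDual_indicatorConstLp, ContinuousLinearMap.comp_apply, lpMul_indicatorConstLp hA hs,
      h _ (hs.inter hA),
      ← setIntegral_indicator hA]
    exact integral_congr_ae (ae_restrict_of_ae hcut.coeFn_toLp)
  have hχ : ‖χ‖ ≤ 1 := by
    refine norm_indicatorConstLp_le.trans ?_
    simp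
  rw [← Lp.enorm_toLp hcut, ← ofReal_norm, ← norm_lpToDual (q := q) hq, hrep]
  refine ENNReal.ofReal_le_ofReal (ContinuousLinearMap.opNorm_le_bound _ (norm_nonneg Λ)
    fun v => Λ.le_opNorm_of_le ((norm_lpMul_apply_le χ v).trans ?_))
  exact mul_le_of_le_one_left (norm_nonneg v) hχ

theorem lpToDual_surjective (hq : q ≠ ∞) : Function.Surjective (lpToDual μ p q) := by
  intro Λ
  obtain ⟨g, hgm, hg⟩ := exists_measurable_density hq Λ
  have hlim : ∀ x, Tendsto (fun n : ℕ => {x | |g x| ≤ n}.indicator g x) atTop (𝓝 (g x)) := by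
    intro x
    refine tendsto_const_nhds.congr' ?_
    filter_upwards [eventually_ge_atTop ⌈|g x|⌉₊] with n hn
    rw [indicator_of_mem]
    exact Nat.ceil_le.1 hn
  have hmem : MemLp g p μ := by
    refine ⟨hgm.aestronglyMeasurable, lt_of_le_of_lt ?_ (ENNReal.ofReal_lt_top (r := ‖Λ‖))⟩
    refine (Lp.eLpNorm_lim_le_liminf_eLpNorm (fun n => (hgm.indicator
      (measurableSet_le hgm.abs measurable_const)).aestronglyMeasurable) g
      (ae_of_all _ hlim)).trans ?_
    exact (liminf_le_liminf (Eventually.of_forall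
      (eLpNorm_truncation_le (p := p) hq Λ hgm hg))).trans (by simp)
  refine ⟨hmem.toLp g, strongDual_Lp_ext hq fun s hs => ?_⟩
  rw [lpToDual_indicatorConstLp, hg s hs]
  exact integral_congr_ae (ae_restrict_of_ae hmem.coeFn_toLp)

end RieszRepresentation

/-! ### Weak convergence -/

section WeakConvergence

/-- Weak convergence of sequences in a normed space, tested by continuous functionals. -/
def TendstoWeak {E : Type*} [NormedAddCommGroup E] [NormedSpace ℝ E] (x : ℕ → E) (x₀ : E) : Prop :=
  ∀ ℓ : StrongDual ℝ E, Tendsto (fun k => ℓ (x k)) atTop (𝓝 (ℓ x₀))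

/-- Weak-* convergence of sequences in `L^∞`, tested by functions in `L¹`. -/
def TendstoWeakStar {α : Type*} [MeasurableSpace α] {μ : Measure α} (a : ℕ → Lp ℝ ∞ μ)
    (a₀ : Lp ℝ ∞ μ) : Prop :=
  ∀ v : Lp ℝ 1 μ, Tendsto (fun k => ∫ x, a k x * v x ∂μ) atTop (𝓝 (∫ x, a₀ x * v x ∂μ))

variable {E G : Type*} [NormedAddCommGroup E] [NormedSpace ℝ E] [NormedAddCommGroup G]
  [NormedSpace ℝ G] {x : ℕ → E} {x₀ : E}

theorem tendsto_toWeakSpace_iff :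
    Tendsto (fun k => toWeakSpace ℝ E (x k)) atTop (𝓝 (toWeakSpace ℝ E x₀)) ↔
      TendstoWeak x x₀ := by
  refine WeakBilin.tendsto_iff_forall_eval_tendsto _ (fun a b hab => ?_)
  by_contra hne
  obtain ⟨f, hf⟩ := SeparatingDual.exists_separating_of_ne (R := ℝ) (V := E) hne
  exact hf (LinearMap.congr_fun hab f)

theorem TendstoWeak.comp (h : TendstoWeak x x₀) {φ : ℕ → ℕ} (hφ : Tendsto φ atTop atTop) :
    TendstoWeak (x ∘ φ) x₀ :=
  fun ℓ => (h ℓ).comp hφ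

theorem TendstoWeak.map (h : TendstoWeak x x₀) (L : E →L[ℝ] G) :
    TendstoWeak (fun k => L (x k)) (L x₀) :=
  fun ℓ => h (ℓ.comp L)

theorem tendstoWeak_pi {ι : Type*} [Fintype ι] {X : ι → Type*} [∀ i, NormedAddCommGroup (X i)]
    [∀ i, NormedSpace ℝ (X i)] {x : ℕ → ∀ i, X i} {x₀ : ∀ i, X i}
    (h : ∀ i, TendstoWeak (fun k => x k i) (x₀ i)) : TendstoWeak x x₀ := by
  classical
  intro ℓ
  simp only [← ContinuousLinearMap.sum_comp_single ℝ X ℓ]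
  exact tendsto_finsetSum _ fun i _ => h i (ℓ.comp (ContinuousLinearMap.single ℝ X i))

theorem TendstoWeak.exists_mem_of_isClosed {S : Submodule ℝ E} (hS : IsClosed (S : Set E))
    {x : ℕ → S} {w : E} (h : TendstoWeak (fun k => (x k : E)) w) :
    ∃ x₀ : S, (x₀ : E) = w ∧ TendstoWeak x x₀ := by
  have hw : w ∈ S := by
    by_contra hne
    obtain ⟨f, u, hfu, huw⟩ := geometric_hahn_banach_closed_point S.convex hS hne
    exact absurd (le_of_tendsto' (h f) fun k => (hfu _ (x k).2).le) (not_le.2 huw)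
  refine ⟨⟨w, hw⟩, rfl, fun ℓ => ?_⟩
  obtain ⟨L, hLℓ, -⟩ := exists_extension_norm_eq S ℓ
  simpa only [hLℓ, hLℓ ⟨w, hw⟩] using h L

theorem exists_subseq_tendsto_apply [SeparableSpace E] {ℓ : ℕ → StrongDual ℝ E} {M : ℝ}
    (h : ∀ k, ‖ℓ k‖ ≤ M) :
    ∃ (φ : ℕ → ℕ) (ℓ₀ : StrongDual ℝ E), StrictMono φ ∧
      ∀ v, Tendsto (fun k => ℓ (φ k) v) atTop (𝓝 (ℓ₀ v)) := by
  obtain ⟨a, -, φ, hφ, ha⟩ := WeakDual.isSeqCompact_closedBall ℝ E 0 M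
    (x := fun k => StrongDual.toWeakDual (ℓ k)) (fun k => by simpa using h k)
  exact ⟨φ, WeakDual.toStrongDual a, hφ, fun v => ((WeakDual.eval_continuous v).tendsto a).comp ha⟩

theorem exists_common_subseq {ι : Type*} [Finite ι] {P : ι → (ℕ → ℕ) → Prop}
    (hmono : ∀ i (φ ψ : ℕ → ℕ), StrictMono ψ → P i φ → P i (φ ∘ ψ))
    (hex : ∀ i φ, StrictMono φ → ∃ ψ : ℕ → ℕ, StrictMono ψ ∧ P i (φ ∘ ψ)) :
    ∃ φ : ℕ → ℕ, StrictMono φ ∧ ∀ i, P i φ := by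
  classical
  have := Fintype.ofFinite ι
  suffices hfin : ∀ s : Finset ι, ∃ φ : ℕ → ℕ, StrictMono φ ∧ ∀ i ∈ s, P i φ by
    obtain ⟨φ, hφ, h⟩ := hfin Finset.univ
    exact ⟨φ, hφ, fun i => h i (Finset.mem_univ i)⟩
  intro s
  induction s using Finset.induction_on with
  | empty => exact ⟨id, strictMono_id, by simp⟩
  | insert i s _ ih =>
    obtain ⟨φ, hφ, hP⟩ := ih
    obtain ⟨ψ, hψ, hi⟩ := hex i φ hφ
    refine ⟨φ ∘ ψ, hφ.comp hψ, fun j hj => ?_⟩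
    rcases Finset.mem_insert.1 hj with rfl | hj
    · exact hi
    · exact hmono j φ ψ hψ (hP j hj)

end WeakConvergence

section LpWeakCompactness

variable {α : Type*} [MeasurableSpace α] {μ : Measure α} {p : ℝ≥0∞}

theorem TendstoWeakStar.comp {a : ℕ → Lp ℝ ∞ μ} {a₀ : Lp ℝ ∞ μ} (h : TendstoWeakStar a a₀)
    {φ : ℕ → ℕ} (hφ : Tendsto φ atTop atTop) : TendstoWeakStar (a ∘ φ) a₀ :=
  fun v => (h v).comp hφ

theorem TendstoWeakStar.tendsto_integral_mul {a : ℕ → Lp ℝ ∞ μ} {a₀ : Lp ℝ ∞ μ}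
    (h : TendstoWeakStar a a₀) {v : α → ℝ} (hv : Integrable v μ) :
    Tendsto (fun k => ∫ x, a k x * v x ∂μ) atTop (𝓝 (∫ x, a₀ x * v x ∂μ)) := by
  have hcongr : ∀ b : Lp ℝ ∞ μ, ∫ x, b x * hv.toL1 v x ∂μ = ∫ x, b x * v x ∂μ := fun b =>
    integral_congr_ae (hv.coeFn_toL1.mono fun x hx => by simp only [hx])
  simpa only [hcongr] using h (hv.toL1 v)

theorem exists_subseq_tendstoWeak_Lp [IsFiniteMeasure μ] [IsSeparable μ] [Fact (1 ≤ p)]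
    (hp : 1 < p.toReal) {z : ℕ → Lp ℝ p μ} {M : ℝ} (h : ∀ k, ‖z k‖ ≤ M) :
    ∃ (φ : ℕ → ℕ) (z₀ : Lp ℝ p μ), StrictMono φ ∧ TendstoWeak (z ∘ φ) z₀ := by
  let q := ENNReal.conjExponent p
  have hq : 1 < q.toReal := (ENNReal.HolderConjugate.toReal (q := q) hp).symm.lt
  have hq₁ : Fact (1 ≤ q) := ⟨(one_lt_of_one_lt_toReal hq).le⟩
  have hq_top : Fact (q ≠ ∞) := ⟨ne_top_of_one_lt_toReal hq⟩
  obtain ⟨φ, Λ, hφ, hΛ⟩ := exists_subseq_tendsto_apply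
    (ℓ := fun k => lpToDual μ p q (z k)) (fun k => (norm_lpToDual_le _).trans (h k))
  obtain ⟨z₀, rfl⟩ := lpToDual_surjective (p := p) hq_top.out Λ
  refine ⟨φ, z₀, hφ, fun ℓ => ?_⟩
  obtain ⟨ν, rfl⟩ := lpToDual_surjective (p := q) (ne_top_of_one_lt_toReal hp) ℓ
  have hν := hΛ ν
  simp only [lpToDual_apply, Function.comp_apply] at hν ⊢
  simpa only [mul_comm] using hν

theorem exists_subseq_tendstoWeakStar [IsFiniteMeasure μ] [IsSeparable μ] {a : ℕ → Lp ℝ ∞ μ}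
    {M : ℝ} (h : ∀ k, ‖a k‖ ≤ M) :
    ∃ (φ : ℕ → ℕ) (a₀ : Lp ℝ ∞ μ), StrictMono φ ∧ TendstoWeakStar (a ∘ φ) a₀ := by
  have h1_top : Fact ((1 : ℝ≥0∞) ≠ ∞) := ⟨ENNReal.one_ne_top⟩
  obtain ⟨φ, Λ, hφ, hΛ⟩ := exists_subseq_tendsto_apply
    (ℓ := fun k => lpToDual μ ∞ 1 (a k)) (fun k => (norm_lpToDual_le _).trans (h k))
  obtain ⟨a₀, rfl⟩ := lpToDual_surjective (p := ∞) h1_top.out Λ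
  exact ⟨φ, a₀, hφ, fun v => by simpa only [lpToDual_apply, Function.comp_apply] using hΛ v⟩

end LpWeakCompactness

/-! ### Sobolev spaces -/

section ExtensionByZero

variable {α : Type*} [MeasurableSpace α] {μ : Measure α} {p : ℝ≥0∞} [Fact (1 ≤ p)] {s : Set α}

/-- Extension by zero from a measurable set on `L^p`. -/
noncomputable def lpExtend (hs : MeasurableSet s) : Lp ℝ p (μ.restrict s) →ₗᵢ[ℝ] Lp ℝ p μ where
  toFun f := ((memLp_indicator_iff_restrict hs).2 (Lp.memLp f)).toLp (s.indicator f)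
  map_add' f g := by
    rw [← MemLp.toLp_add]
    refine MemLp.toLp_congr _ _ ?_
    filter_upwards [(ae_restrict_iff' hs).1 (Lp.coeFn_add f g)] with x hx
    by_cases hxs : x ∈ s
    · rw [indicator_of_mem hxs, hx hxs, Pi.add_apply, Pi.add_apply, indicator_of_mem hxs,
        indicator_of_mem hxs]
    · simp [hxs]
  map_smul' c f := by
    rw [RingHom.id_apply, ← MemLp.toLp_const_smul]
    refine MemLp.toLp_congr _ _ ?_
    filter_upwards [(ae_restrict_iff' hs).1 (Lp.coeFn_smul c f)] with x hx
    by_cases hxs : x ∈ s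
    · simp [hxs, hx hxs]
    · simp [hxs]
  norm_map' f := by
    change ‖((memLp_indicator_iff_restrict hs).2 (Lp.memLp f)).toLp (s.indicator f)‖ = _
    rw [Lp.norm_toLp, eLpNorm_indicator_eq_eLpNorm_restrict hs, Lp.norm_def]

theorem coeFn_lpExtend (hs : MeasurableSet s) (f : Lp ℝ p (μ.restrict s)) :
    lpExtend hs f =ᵐ[μ] s.indicator f :=
  ((memLp_indicator_iff_restrict hs).2 (Lp.memLp f)).coeFn_toLp

theorem exists_lpExtend_eq (hs : MeasurableSet s) {u : Lp ℝ p μ}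
    (hu : ∀ᵐ x ∂μ, x ∉ s → u x = 0) : ∃ v, lpExtend hs v = u := by
  have hv : MemLp u p (μ.restrict s) := (Lp.memLp u).mono_measure Measure.restrict_le_self
  refine ⟨hv.toLp u, ?_⟩
  rw [Lp.ext_iff]
  filter_upwards [coeFn_lpExtend hs (hv.toLp u), (ae_restrict_iff' hs).1 hv.coeFn_toLp, hu]
    with x hext hon hoff
  rw [hext]
  by_cases hx : x ∈ s
  · rw [indicator_of_mem hx, hon hx]
  · rw [indicator_of_notMem hx, hoff hx]

theorem exists_subseq_tendstoWeak_of_ae_eq_zero [IsSeparable (μ.restrict s)] (hp : 1 < p.toReal)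
    (hs : MeasurableSet s) (hμs : μ s ≠ ∞) {u : ℕ → Lp ℝ p μ}
    (hu : ∀ k, ∀ᵐ x ∂μ, x ∉ s → u k x = 0) {M : ℝ} (hM : ∀ k, ‖u k‖ ≤ M) :
    ∃ (φ : ℕ → ℕ) (u₀ : Lp ℝ p μ), StrictMono φ ∧ TendstoWeak (u ∘ φ) u₀ := by
  have : IsFiniteMeasure (μ.restrict s) := ⟨by simpa using hμs.lt_top⟩
  choose v hv using fun k => exists_lpExtend_eq hs (hu k)
  obtain ⟨φ, v₀, hφ, hweak⟩ := exists_subseq_tendstoWeak_Lp hp (z := v) (M := M)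
    (fun k => by rw [← (lpExtend hs).norm_map, hv]; exact hM k)
  refine ⟨φ, lpExtend hs v₀, hφ, ?_⟩
  have hmap := hweak.map (lpExtend hs).toContinuousLinearMap
  simp only [Function.comp_apply, LinearIsometry.coe_toContinuousLinearMap, hv] at hmap
  exact hmap

end ExtensionByZero

section Sobolev

open scoped ContDiff

variable {N : ℕ} {p : ℝ≥0∞}

variable (p) in
/-- The component of a tuple `(y, ∂₁y, …, ∂_N y)` with the given index. -/
noncomputable def jetProj [Fact (1 ≤ p)] (o : Option (Fin N)) :
    Jet N p →L[ℝ] Lp ℝ p (volume : Measure (Eucl N)) :=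
  PiLp.proj p (𝕜 := ℝ) (fun _ : Option (Fin N) => Lp ℝ p (volume : Measure (Eucl N))) o

theorem memLp_fderiv_apply {φ : Eucl N → ℝ} (h : ContDiff ℝ ∞ φ) (hc : HasCompactSupport φ)
    (v : Eucl N) (r : ℝ≥0∞) : MemLp (fun x => fderiv ℝ φ x v) r (volume : Measure (Eucl N)) :=
  ((h.continuous_fderiv (by simp)).clm_apply continuous_const).memLp_of_hasCompactSupport
    (hc.fderiv_apply (𝕜 := ℝ) v)

variable [Fact (1 ≤ p)] {Ω : Opens (Eucl N)}

theorem map_eq_zero_of_testJets {F : Type*} [NormedAddCommGroup F] [NormedSpace ℝ F]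
    (T : Jet N p →L[ℝ] F) (h : ∀ w ∈ testJets p Ω, T w = 0) (y : W0 p Ω) :
    T (y : Jet N p) = 0 :=
  closure_minimal (s := (testJets p Ω : Set (Jet N p))) h
    (isClosed_eq T.continuous continuous_const) y.2

theorem testJets_ae_eq_zero {w : Jet N p} (hw : w ∈ testJets p Ω) (o : Option (Fin N)) :
    ∀ᵐ x, x ∉ (Ω : Set (Eucl N)) → w o x = 0 := by
  obtain ⟨φ, hfn, hgrad⟩ := hw
  have hsupp : ∀ x, x ∉ (Ω : Set (Eucl N)) → x ∉ tsupport (φ : Eucl N → ℝ) :=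
    fun x hx hx' => hx (φ.tsupport_subset hx')
  cases o with
  | none =>
    filter_upwards [hfn] with x hφ hx
    rw [hφ, image_eq_zero_of_notMem_tsupport (hsupp x hx)]
  | some i =>
    filter_upwards [hgrad i] with x hφ hx
    have hzero : fderiv ℝ (φ : Eucl N → ℝ) x = 0 :=
      image_eq_zero_of_notMem_tsupport fun h => hsupp x hx (tsupport_fderiv_subset ℝ h)
    simp [hφ, hzero]

theorem jet_ae_eq_zero (y : W0 p Ω) (o : Option (Fin N)) :
    ∀ᵐ x, x ∉ (Ω : Set (Eucl N)) → (y : Jet N p) o x = 0 := by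
  have hχ : MemLp ((Ω : Set (Eucl N))ᶜ.indicator fun _ => (1 : ℝ)) ∞ volume :=
    (memLp_top_const (1 : ℝ)).indicator Ω.isOpen.measurableSet.compl
  have hcut := map_eq_zero_of_testJets (Ω := Ω) ((lpMul (hχ.toLp _)).comp (jetProj p o))
    (fun w hw => ?_) y
  · filter_upwards [coeFn_lpMul_toLp hχ ((y : Jet N p) o),
      Lp.eq_zero_iff_ae_eq_zero.1 hcut] with x hmul hzero hx
    have hzero' : lpMul (hχ.toLp _) ((y : Jet N p) o) x = 0 := hzero
    simpa [hx] using hmul.symm.trans hzero'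
  · change lpMul (hχ.toLp _) (w o) = 0
    rw [Lp.eq_zero_iff_ae_eq_zero]
    filter_upwards [coeFn_lpMul_toLp hχ (w o), testJets_ae_eq_zero hw o] with x hmul hzero
    rw [hmul]
    by_cases hx : x ∈ (Ω : Set (Eucl N))
    · simp [hx]
    · simp [hzero hx]

theorem setIntegral_eq_integral_of_jet {y : W0 p Ω} (o : Option (Fin N)) {G : Eucl N → ℝ}
    (hG : ∀ x, (y : Jet N p) o x = 0 → G x = 0) :
    ∫ x in (Ω : Set (Eucl N)), G x = ∫ x, G x := by
  refine setIntegral_eq_integral_of_ae_compl_eq_zero ?_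
  filter_upwards [jet_ae_eq_zero y o] with x hx hx'
  exact hG x (hx hx')

theorem integral_grad_mul (y : W0 p Ω) (i : Fin N) {ψ : Eucl N → ℝ} (hψ : ContDiff ℝ ∞ ψ)
    (hψc : HasCompactSupport ψ) :
    ∫ x, ψ x * W0.grad y i x = -∫ x, fderiv ℝ ψ x (EuclideanSpace.single i 1) * W0.fn y x := by
  let q := ENNReal.conjExponent p
  have hq : Fact (1 ≤ q) := ⟨ENNReal.HolderConjugate.one_le q p⟩
  have hm : MemLp ψ q volume := hψ.continuous.memLp_of_hasCompactSupport hψc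
  have hm' := memLp_fderiv_apply hψ hψc (EuclideanSpace.single i 1) q
  let T : StrongDual ℝ (Jet N p) :=
    (lpToDual volume q p (hm.toLp ψ)).comp (jetProj p (some i)) +
      (lpToDual volume q p (hm'.toLp _)).comp (jetProj p none)
  have hT : ∀ w : Jet N p, T w = (∫ x, ψ x * w (some i) x) +
      ∫ x, fderiv ℝ ψ x (EuclideanSpace.single i 1) * w none x := fun w =>
    congr_arg₂ (· + ·) (lpToDual_toLp_apply hm (w (some i))) (lpToDual_toLp_apply hm' (w none))
  have hzero := map_eq_zero_of_testJets (Ω := Ω) T (fun w hw => ?_) y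
  · exact eq_neg_of_add_eq_zero_left ((hT y).symm.trans hzero)
  · obtain ⟨φ, hfn, hgrad⟩ := hw
    have hφ : MemLp φ p (volume : Measure (Eucl N)) :=
      φ.contDiff.continuous.memLp_of_hasCompactSupport φ.hasCompactSupport
    have hφ' := memLp_fderiv_apply φ.contDiff φ.hasCompactSupport (EuclideanSpace.single i 1) p
    have hparts := integral_mul_fderiv_eq_neg_fderiv_mul_of_integrable
      (integrable_mul_of_memLp hm' hφ) (integrable_mul_of_memLp hm hφ')
      (integrable_mul_of_memLp hm hφ) (fun x _ => hψ.contDiffAt.differentiableAt (by simp))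
      (fun x _ => φ.contDiff.contDiffAt.differentiableAt (by simp))
    rw [hT]
    refine (congr_arg₂ (· + ·) (integral_congr_ae ((EventuallyEq.refl _ ψ).mul (hgrad i)))
      (integral_congr_ae ((EventuallyEq.refl _ fun x => fderiv ℝ ψ x _).mul hfn))).trans ?_
    exact (congr_arg (· + _) hparts).trans (neg_add_cancel _)

theorem eq_zero_of_fn_ae_eq_zero {y : W0 p Ω} (h : W0.fn y =ᵐ[volume] 0) : y = 0 := by
  ext o : 2
  rw [Lp.ext_iff]
  refine EventuallyEq.trans ?_ (Lp.coeFn_zero ℝ p volume).symm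
  cases o with
  | none => exact h
  | some i =>
    refine ae_eq_zero_of_integral_contDiff_smul_eq_zero
      ((Lp.memLp _).locallyIntegrable Fact.out) fun ψ hψ hψc => ?_
    refine (integral_grad_mul y i hψ hψc).trans (neg_eq_zero.2 (integral_eq_zero_of_ae ?_))
    filter_upwards [h] with x hx
    simp [hx]

theorem W0_norm_rpow (hp : p ≠ ⊤) (y : W0 p Ω) :
    ‖y‖ ^ p.toReal = (∫ x in (Ω : Set (Eucl N)), |W0.fn y x| ^ p.toReal) +
      ∑ i, ∫ x in (Ω : Set (Eucl N)), |W0.grad y i x| ^ p.toReal := by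
  have hpos : 0 < p.toReal :=
    ENNReal.toReal_pos (zero_lt_one.trans_le (Fact.out : 1 ≤ p)).ne' hp
  have hentry : ∀ o, ‖(y : Jet N p) o‖ ^ p.toReal =
      ∫ x in (Ω : Set (Eucl N)), |(y : Jet N p) o x| ^ p.toReal := fun o => by
    rw [Lp_norm_rpow_eq_integral hp, setIntegral_eq_integral_of_jet (y := y) o
      (fun x hx => by rw [hx, abs_zero, Real.zero_rpow hpos.ne'])]
  rw [← Submodule.norm_coe, PiLp.norm_eq_sum hpos, ← Real.rpow_mul
    (Finset.sum_nonneg fun o _ => Real.rpow_nonneg (norm_nonneg _) _),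
    one_div_mul_cancel hpos.ne', Real.rpow_one, Fintype.sum_option, hentry]
  exact congr_arg (_ + ·) (Finset.sum_congr rfl fun i _ => hentry (some i))

theorem tendstoWeak_jet {w : ℕ → Jet N p} {w₀ : Jet N p}
    (h : ∀ o, TendstoWeak (fun k => w k o) (w₀ o)) : TendstoWeak w w₀ :=
  (tendstoWeak_pi h).map (PiLp.continuousLinearEquiv p ℝ (fun _ : Option (Fin N) =>
    Lp ℝ p (volume : Measure (Eucl N)))).symm.toContinuousLinearMap

theorem exists_subseq_tendstoWeak_W0 (hp : 1 < p.toReal)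
    (hΩ : Bornology.IsBounded (Ω : Set (Eucl N))) {y : ℕ → W0 p Ω} {M : ℝ}
    (h : ∀ k, ‖y k‖ ≤ M) :
    ∃ (φ : ℕ → ℕ) (y₀ : W0 p Ω), StrictMono φ ∧ TendstoWeak (y ∘ φ) y₀ := by
  obtain ⟨φ, hφ, hcomp⟩ := exists_common_subseq
    (P := fun o φ => ∃ u₀, TendstoWeak (fun k => (y (φ k) : Jet N p) o) u₀)
    (fun o φ ψ hψ ⟨u₀, hu₀⟩ => ⟨u₀, hu₀.comp hψ.tendsto_atTop⟩)
    (fun o φ _ => by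
      obtain ⟨ψ, u₀, hψ, hu₀⟩ := exists_subseq_tendstoWeak_of_ae_eq_zero hp
        Ω.isOpen.measurableSet hΩ.measure_lt_top.ne (u := fun k => (y (φ k) : Jet N p) o)
        (fun k => jet_ae_eq_zero (y (φ k)) o)
        (fun k => (PiLp.norm_apply_le (y (φ k) : Jet N p) o).trans (h (φ k)))
      exact ⟨ψ, hψ, u₀, hu₀⟩)
  choose u₀ hu₀ using hcomp
  obtain ⟨y₀, -, hy₀⟩ := (tendstoWeak_jet (w₀ := WithLp.toLp p u₀) hu₀).exists_mem_of_isClosed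
    (Submodule.isClosed_topologicalClosure (testJets p Ω)) (x := y ∘ φ)
  exact ⟨φ, y₀, hφ, hy₀⟩

variable {ψ : Eucl N → ℝ}

/-- Multiplication by a test function `ψ` on tuples `(y, ∂₁y, …, ∂_N y)`, by the product rule. -/
noncomputable def jetMul (hψ : ContDiff ℝ ∞ ψ) (hψc : HasCompactSupport ψ) :
    Jet N p →L[ℝ] Jet N p :=
  (PiLp.continuousLinearEquiv p ℝ (fun _ : Option (Fin N) =>
      Lp ℝ p (volume : Measure (Eucl N)))).symm.toContinuousLinearMap.comp
    (ContinuousLinearMap.pi fun o => (lpMul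
        ((hψ.continuous.memLp_of_hasCompactSupport hψc).toLp ψ)).comp (jetProj p o) +
      o.elim 0 fun i => (lpMul ((memLp_fderiv_apply hψ hψc (EuclideanSpace.single i 1) ∞).toLp
        _)).comp (jetProj p none))

theorem jetMul_none (hψ : ContDiff ℝ ∞ ψ) (hψc : HasCompactSupport ψ) (w : Jet N p) :
    jetMul hψ hψc w none =ᵐ[volume] fun x => ψ x * w none x := by
  have h : jetMul hψ hψc w none =
      lpMul ((hψ.continuous.memLp_of_hasCompactSupport hψc).toLp ψ) (w none) := add_zero _
  rw [h]
  exact coeFn_lpMul_toLp _ _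

theorem jetMul_some (hψ : ContDiff ℝ ∞ ψ) (hψc : HasCompactSupport ψ) (w : Jet N p)
    (i : Fin N) : jetMul hψ hψc w (some i) =ᵐ[volume] fun x =>
      ψ x * w (some i) x + fderiv ℝ ψ x (EuclideanSpace.single i 1) * w none x :=
  (Lp.coeFn_add _ _).trans ((coeFn_lpMul_toLp _ _).add (coeFn_lpMul_toLp _ _))

theorem jetMul_mem_testJets (hψ : ContDiff ℝ ∞ ψ) (hψc : HasCompactSupport ψ) {w : Jet N p}
    (hw : w ∈ testJets p Ω) : jetMul hψ hψc w ∈ testJets p Ω := by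
  obtain ⟨φ, hfn, hgrad⟩ := hw
  have hsupp : tsupport (ψ * (φ : Eucl N → ℝ)) ⊆ Ω :=
    (tsupport_mul_subset_right (f := ψ) (g := φ)).trans φ.tsupport_subset
  refine ⟨⟨ψ * φ, hψ.mul φ.contDiff, hψc.mul_right, hsupp⟩, ?_, fun i => ?_⟩
  · filter_upwards [jetMul_none hψ hψc w, hfn] with x hmul hφ
    rw [hmul, hφ]
    rfl
  · filter_upwards [jetMul_some hψ hψc w i, hfn, hgrad i] with x hmul hφ hφ'
    rw [hmul, hφ, hφ']
    change _ = fderiv ℝ (ψ * (φ : Eucl N → ℝ)) x (EuclideanSpace.single i 1)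
    rw [fderiv_mul (hψ.contDiffAt.differentiableAt (by simp))
      (φ.contDiff.contDiffAt.differentiableAt (by simp))]
    simp only [add_apply, smul_apply, smul_eq_mul]
    ring

/-- Multiplication by a test function on `W₀^{1,p}(Ω)`. -/
noncomputable def W0.mulTest (Ω : Opens (Eucl N)) (hψ : ContDiff ℝ ∞ ψ)
    (hψc : HasCompactSupport ψ) : W0 p Ω →L[ℝ] W0 p Ω :=
  ((jetMul hψ hψc).comp (sobolevZero p Ω).subtypeL).codRestrict (sobolevZero p Ω) fun y =>
    map_mem_closure (f := jetMul (p := p) hψ hψc) (jetMul hψ hψc).continuous y.2 fun _ =>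
      jetMul_mem_testJets hψ hψc

theorem W0.grad_mulTest (hψ : ContDiff ℝ ∞ ψ) (hψc : HasCompactSupport ψ) (y : W0 p Ω)
    (i : Fin N) : W0.grad (W0.mulTest Ω hψ hψc y) i =ᵐ[volume] fun x =>
      ψ x * W0.grad y i x + fderiv ℝ ψ x (EuclideanSpace.single i 1) * W0.fn y x :=
  jetMul_some hψ hψc (y : Jet N p) i

end Sobolev

/-! ### Rellich's theorem -/

section Mollification

open scoped Convolution

theorem enorm_sub_convolution_le {E : Type*} [NormedAddCommGroup E] [MeasurableSpace E]
    [BorelSpace E] {μ : Measure E} [IsFiniteMeasureOnCompacts μ] {ρ φ : E → ℝ}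
    (hρ : Continuous ρ) (hρc : HasCompactSupport ρ) (hρ_one : ∫ x, ρ x ∂μ = 1)
    (hφ : Continuous φ) (x : E) :
    ‖φ x - (ρ ⋆[ContinuousLinearMap.mul ℝ ℝ, μ] φ) x‖ₑ ≤
      ∫⁻ h, ‖ρ h‖ₑ * ‖φ (x + -h) - φ x‖ₑ ∂μ := by
  have hconv : Integrable (fun h => ρ h * φ (x - h)) μ :=
    (by fun_prop : Continuous fun h => ρ h * φ (x - h)).integrable_of_hasCompactSupport
      hρc.mul_right
  have hsub : φ x - (ρ ⋆[ContinuousLinearMap.mul ℝ ℝ, μ] φ) x =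
      ∫ h, (ρ h * φ x - ρ h * φ (x - h)) ∂μ := by
    rw [integral_sub ((hρ.integrable_of_hasCompactSupport hρc).mul_const _) hconv,
      integral_mul_const, hρ_one, one_mul, convolution_mul]
  rw [hsub]
  refine (enorm_integral_le_lintegral_enorm _).trans_eq (lintegral_congr fun h => ?_)
  rw [← mul_sub, enorm_mul, ← enorm_neg (φ x - _), neg_sub, sub_eq_add_neg x]

variable {E : Type*} [NormedAddCommGroup E] [NormedSpace ℝ E] {φ : E → ℝ}

theorem enorm_sub_le_lintegral_fderiv (hφ : ContDiff ℝ 1 φ) (x h : E) :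
    ‖φ (x + h) - φ x‖ₑ ≤ ∫⁻ t in Ioc (0 : ℝ) 1, ‖fderiv ℝ φ (x + t • h) h‖ₑ := by
  have hderiv : ∀ t : ℝ,
      HasDerivAt (fun s : ℝ => φ (x + s • h)) (fderiv ℝ φ (x + t • h) h) t := fun t =>
    (hφ.differentiable one_ne_zero _).hasFDerivAt.comp_hasDerivAt t
      (by simpa using ((hasDerivAt_id t).smul_const h).const_add x)
  have hcont : Continuous fun t : ℝ => fderiv ℝ φ (x + t • h) h :=
    ((hφ.continuous_fderiv one_ne_zero).comp (by fun_prop)).clm_apply continuous_const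
  have hftc := intervalIntegral.integral_eq_sub_of_hasDerivAt (a := 0) (b := 1)
    (fun t _ => hderiv t) (hcont.intervalIntegrable 0 1)
  simp only [one_smul, zero_smul, add_zero] at hftc
  rw [← hftc, intervalIntegral.integral_of_le zero_le_one]
  exact enorm_integral_le_lintegral_enorm _

variable [MeasurableSpace E] [BorelSpace E] {μ : Measure E} [SFinite μ] [μ.IsAddRightInvariant]

theorem lintegral_translate_sub_le (hφ : ContDiff ℝ 1 φ) (h : E) :
    ∫⁻ x, ‖φ (x + h) - φ x‖ₑ ∂μ ≤ ‖h‖ₑ * ∫⁻ x, ‖fderiv ℝ φ x‖ₑ ∂μ := by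
  have hcont := hφ.continuous_fderiv one_ne_zero
  calc ∫⁻ x, ‖φ (x + h) - φ x‖ₑ ∂μ
      ≤ ∫⁻ x, (∫⁻ t in Ioc (0 : ℝ) 1, ‖fderiv ℝ φ (x + t • h) h‖ₑ) ∂μ :=
        lintegral_mono fun x => enorm_sub_le_lintegral_fderiv hφ x h
    _ = ∫⁻ t in Ioc (0 : ℝ) 1, ∫⁻ x, ‖fderiv ℝ φ (x + t • h) h‖ₑ ∂μ := by
        have hmeas : Continuous fun z : E × ℝ => ‖fderiv ℝ φ (z.1 + z.2 • h) h‖ₑ :=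
          ((hcont.comp (by fun_prop)).clm_apply continuous_const).enorm
        exact lintegral_lintegral_swap hmeas.measurable.aemeasurable
    _ = ∫⁻ _ in Ioc (0 : ℝ) 1, ∫⁻ x, ‖fderiv ℝ φ x h‖ₑ ∂μ :=
        lintegral_congr fun t => lintegral_add_right_eq_self (fun x => ‖fderiv ℝ φ x h‖ₑ) (t • h)
    _ = ∫⁻ x, ‖fderiv ℝ φ x h‖ₑ ∂μ := by simp
    _ ≤ ∫⁻ x, ‖h‖ₑ * ‖fderiv ℝ φ x‖ₑ ∂μ := lintegral_mono fun x =>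
        ((fderiv ℝ φ x).le_opENorm h).trans_eq (mul_comm _ _)
    _ = ‖h‖ₑ * ∫⁻ x, ‖fderiv ℝ φ x‖ₑ ∂μ := lintegral_const_mul _ hcont.enorm.measurable

theorem lintegral_sub_convolution_le [SecondCountableTopology E] [IsFiniteMeasureOnCompacts μ]
    {ρ : E → ℝ} (hρ : Continuous ρ) (hρc : HasCompactSupport ρ) (hρ_nonneg : ∀ x, 0 ≤ ρ x)
    (hρ_one : ∫ x, ρ x ∂μ = 1) {ε : ℝ} (hε : ∀ x, ρ x ≠ 0 → ‖x‖ ≤ ε) (hφ : ContDiff ℝ 1 φ) :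
    ∫⁻ x, ‖φ x - (ρ ⋆[ContinuousLinearMap.mul ℝ ℝ, μ] φ) x‖ₑ ∂μ ≤
      ENNReal.ofReal ε * ∫⁻ x, ‖fderiv ℝ φ x‖ₑ ∂μ := by
  have hφc := hφ.continuous
  have hρe : ∫⁻ h, ‖ρ h‖ₑ ∂μ = 1 := by
    rw [← ofReal_integral_norm_eq_lintegral_enorm (hρ.integrable_of_hasCompactSupport hρc)]
    simp_rw [fun h => Real.norm_of_nonneg (hρ_nonneg h), hρ_one, ENNReal.ofReal_one]
  have hmeas : Continuous fun z : E × E => ‖φ (z.1 + -z.2) - φ z.1‖ₑ := by fun_prop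
  calc ∫⁻ x, ‖φ x - (ρ ⋆[ContinuousLinearMap.mul ℝ ℝ, μ] φ) x‖ₑ ∂μ
      ≤ ∫⁻ x, (∫⁻ h, ‖ρ h‖ₑ * ‖φ (x + -h) - φ x‖ₑ ∂μ) ∂μ :=
        lintegral_mono (enorm_sub_convolution_le hρ hρc hρ_one hφc)
    _ = ∫⁻ h, (∫⁻ x, ‖ρ h‖ₑ * ‖φ (x + -h) - φ x‖ₑ ∂μ) ∂μ :=
        lintegral_lintegral_swap
          ((hρ.comp continuous_snd).enorm.measurable.mul hmeas.measurable).aemeasurable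
    _ = ∫⁻ h, ‖ρ h‖ₑ * (∫⁻ x, ‖φ (x + -h) - φ x‖ₑ ∂μ) ∂μ :=
        lintegral_congr fun h => lintegral_const_mul _
          (by fun_prop : Continuous fun x : E => ‖φ (x + -h) - φ x‖ₑ).measurable
    _ ≤ ∫⁻ h, ‖ρ h‖ₑ * (ENNReal.ofReal ε * ∫⁻ x, ‖fderiv ℝ φ x‖ₑ ∂μ) ∂μ := by
        refine lintegral_mono fun h => ?_
        by_cases hh : ρ h = 0
        · simp [hh]
        · refine mul_le_mul_right ((lintegral_translate_sub_le hφ (-h)).trans ?_) _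
          refine mul_le_mul_left ?_ _
          rw [enorm_neg, ← ofReal_norm]
          exact ENNReal.ofReal_le_ofReal (hε h hh)
    _ = ENNReal.ofReal ε * ∫⁻ x, ‖fderiv ℝ φ x‖ₑ ∂μ := by
        rw [lintegral_mul_const _ hρ.enorm.measurable, hρe, one_mul]

theorem exists_mollifier (E : Type*) [NormedAddCommGroup E] [NormedSpace ℝ E] [HasContDiffBump E]
    [FiniteDimensional ℝ E] [MeasureSpace E] [BorelSpace E]
    [(volume : Measure E).IsAddHaarMeasure] {ε : ℝ} (hε : 0 < ε) :
    ∃ ρ : E → ℝ, Continuous ρ ∧ HasCompactSupport ρ ∧ (∀ x, 0 ≤ ρ x) ∧ ∫ x, ρ x = 1 ∧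
      ∀ x, ρ x ≠ 0 → ‖x‖ ≤ ε := by
  let b : ContDiffBump (0 : E) := ⟨ε / 2, ε, half_pos hε, half_lt_self hε⟩
  refine ⟨b.normed volume, b.continuous_normed, b.hasCompactSupport_normed, b.nonneg_normed,
    b.integral_normed, fun x hx => ?_⟩
  have hmem : x ∈ Function.support (b.normed volume) := hx
  rw [b.support_normed_eq] at hmem
  exact (mem_ball_zero_iff.1 hmem).le

end Mollification

theorem TendstoWeak.exists_norm_le {E : Type*} [NormedAddCommGroup E] [NormedSpace ℝ E]
    {x : ℕ → E} {x₀ : E} (h : TendstoWeak x x₀) : ∃ M, ∀ k, ‖x k‖ ≤ M := by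
  obtain ⟨M, hM⟩ := banach_steinhaus
    (g := fun k => NormedSpace.inclusionInDoubleDualLi (E := E) ℝ (x k)) fun ℓ => by
      obtain ⟨C, hC⟩ := (h ℓ).norm.bddAbove_range
      exact ⟨C, fun k => hC (mem_range_self k)⟩
  exact ⟨M, fun k => by simpa only [LinearIsometry.norm_map] using hM k⟩

section Rellich

open scoped ContDiff Convolution

variable {N : ℕ} {p : ℝ≥0∞} [Fact (1 ≤ p)] {Ω : Opens (Eucl N)}

/-- The inclusion into `L¹` on a bounded open set of a component of `(y, ∂₁y, …, ∂_N y)`; it is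
the multiplication by the characteristic function of `Ω`. -/
noncomputable def W0.toL1 (hΩ : Bornology.IsBounded (Ω : Set (Eucl N))) (o : Option (Fin N)) :
    W0 p Ω →L[ℝ] Lp ℝ 1 (volume : Measure (Eucl N)) :=
  let q := ENNReal.conjExponent p
  have : Fact (1 ≤ q) := ⟨ENNReal.HolderConjugate.one_le q p⟩
  have hχ : MemLp ((Ω : Set (Eucl N)).indicator fun _ => (1 : ℝ)) q volume :=
    memLp_indicator_const q Ω.isOpen.measurableSet 1 (Or.inr hΩ.measure_lt_top.ne)
  ((ContinuousLinearMap.mul ℝ ℝ).holderL volume q p 1 (hχ.toLp _)).comp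
    ((jetProj p o).comp (sobolevZero p Ω).subtypeL)

theorem W0.coeFn_toL1 (hΩ : Bornology.IsBounded (Ω : Set (Eucl N))) (o : Option (Fin N))
    (y : W0 p Ω) : W0.toL1 hΩ o y =ᵐ[volume] (y : Jet N p) o := by
  let q := ENNReal.conjExponent p
  have hχ : MemLp ((Ω : Set (Eucl N)).indicator fun _ => (1 : ℝ)) q volume :=
    memLp_indicator_const q Ω.isOpen.measurableSet 1 (Or.inr hΩ.measure_lt_top.ne)
  have hmul : W0.toL1 hΩ o y =ᵐ[volume] _ :=
    (ContinuousLinearMap.mul ℝ ℝ).coeFn_holder (hχ.toLp _) ((y : Jet N p) o)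
  filter_upwards [hmul, hχ.coeFn_toLp, jet_ae_eq_zero y o] with x hmul hχ hzero
  rw [hmul, hχ]
  by_cases hx : x ∈ (Ω : Set (Eucl N))
  · simp [hx]
  · simp [hzero hx]

/-- The functional `y ↦ ∫ ψ ∂_o y` on `W₀^{1,p}(Ω)`, for `ψ ∈ L^q`. -/
noncomputable def W0.integralMul {q : ℝ≥0∞} [Fact (1 ≤ q)] [q.HolderConjugate p]
    {ψ : Eucl N → ℝ} (hψ : MemLp ψ q volume) (o : Option (Fin N)) : StrongDual ℝ (W0 p Ω) :=
  (lpToDual volume q p (hψ.toLp ψ)).comp ((jetProj p o).comp (sobolevZero p Ω).subtypeL)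

theorem W0.integralMul_apply {q : ℝ≥0∞} [Fact (1 ≤ q)] [q.HolderConjugate p]
    {ψ : Eucl N → ℝ} (hψ : MemLp ψ q volume) (o : Option (Fin N)) (y : W0 p Ω) :
    W0.integralMul hψ o y = ∫ x, ψ x * (y : Jet N p) o x :=
  lpToDual_toLp_apply hψ ((y : Jet N p) o)

theorem norm_le_sum_norm_apply_single (L : Eucl N →L[ℝ] ℝ) :
    ‖L‖ ≤ ∑ i, ‖L (EuclideanSpace.single i 1)‖ := by
  refine L.opNorm_le_bound (Finset.sum_nonneg fun i _ => norm_nonneg _) fun v => ?_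
  rw [← (EuclideanSpace.basisFun (Fin N) ℝ).sum_repr v, map_sum, Finset.sum_mul]
  refine (norm_sum_le _ _).trans (Finset.sum_le_sum fun i _ => ?_)
  rw [map_smul, norm_smul, mul_comm, EuclideanSpace.basisFun_apply,
    OrthonormalBasis.sum_repr]
  exact mul_le_mul_of_nonneg_left (PiLp.norm_apply_le v i) (norm_nonneg _)

theorem lintegral_enorm_fderiv_le (hΩ : Bornology.IsBounded (Ω : Set (Eucl N))) {y : W0 p Ω}
    {φ : Eucl N → ℝ} (hφ : ContDiff ℝ 1 φ) (hgrad : ∀ i : Fin N, W0.grad y i =ᵐ[volume]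
      fun x => fderiv ℝ φ x (EuclideanSpace.single i 1)) :
    ∫⁻ x, ‖fderiv ℝ φ x‖ₑ ≤ ENNReal.ofReal (∑ i, ‖W0.toL1 hΩ (some i) y‖) := by
  calc ∫⁻ x, ‖fderiv ℝ φ x‖ₑ
      ≤ ∫⁻ x, ∑ i, ‖fderiv ℝ φ x (EuclideanSpace.single i 1)‖ₑ := by
        refine lintegral_mono fun x => ?_
        simp only [← ofReal_norm]
        rw [← ENNReal.ofReal_sum_of_nonneg fun i _ => norm_nonneg _]
        exact ENNReal.ofReal_le_ofReal (norm_le_sum_norm_apply_single _)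
    _ = ∑ i, ∫⁻ x, ‖fderiv ℝ φ x (EuclideanSpace.single i 1)‖ₑ :=
        lintegral_finsetSum _ fun i _ =>
          ((hφ.continuous_fderiv one_ne_zero).clm_apply continuous_const).enorm.measurable
    _ = ∑ i, ENNReal.ofReal ‖W0.toL1 hΩ (some i) y‖ := by
        refine Finset.sum_congr rfl fun i _ => ?_
        rw [L1.ofReal_norm_eq_lintegral]
        exact lintegral_congr_ae
          (((W0.coeFn_toL1 hΩ (some i) y).trans (hgrad i)).symm.fun_comp (‖·‖ₑ))
    _ = ENNReal.ofReal (∑ i, ‖W0.toL1 hΩ (some i) y‖) :=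
        (ENNReal.ofReal_sum_of_nonneg fun i _ => norm_nonneg _).symm

variable {ρ : Eucl N → ℝ}

theorem continuous_convolution_fn (hρ : Continuous ρ) (hρc : HasCompactSupport ρ) (y : W0 p Ω) :
    Continuous (ρ ⋆[ContinuousLinearMap.mul ℝ ℝ] W0.fn y) :=
  hρc.continuous_convolution_left (ContinuousLinearMap.mul ℝ ℝ) hρ
    ((Lp.memLp _).locallyIntegrable Fact.out)

theorem abs_convolution_fn_le (hΩ : Bornology.IsBounded (Ω : Set (Eucl N))) {K : ℝ}
    (hK : ∀ x, |ρ x| ≤ K) (y : W0 p Ω) (x : Eucl N) :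
    |(ρ ⋆[ContinuousLinearMap.mul ℝ ℝ] W0.fn y) x| ≤ K * ‖W0.toL1 hΩ none y‖ := by
  have hfn := W0.coeFn_toL1 hΩ none y
  rw [← Real.norm_eq_abs, convolution_mul_swap, L1.norm_eq_integral_norm, ← integral_const_mul]
  refine norm_integral_le_of_norm_le ((L1.integrable_coeFn (W0.toL1 hΩ none y)).norm.const_mul K) ?_
  filter_upwards [hfn] with t ht
  rw [norm_mul, ht]
  exact mul_le_mul_of_nonneg_right (hK _) (norm_nonneg _)

theorem tendsto_convolution_fn {y : ℕ → W0 p Ω} {y₀ : W0 p Ω} (h : TendstoWeak y y₀)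
    (hρ : Continuous ρ) (hρc : HasCompactSupport ρ) (x : Eucl N) :
    Tendsto (fun k => (ρ ⋆[ContinuousLinearMap.mul ℝ ℝ] W0.fn (y k)) x) atTop
      (𝓝 ((ρ ⋆[ContinuousLinearMap.mul ℝ ℝ] W0.fn y₀) x)) := by
  let q := ENNReal.conjExponent p
  have hq : Fact (1 ≤ q) := ⟨ENNReal.HolderConjugate.one_le q p⟩
  have hmem : MemLp (fun t => ρ (x - t)) q volume :=
    Continuous.memLp_of_hasCompactSupport (by fun_prop)
      (hρc.comp_homeomorph (Homeomorph.subLeft x))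
  have hconv : ∀ u : W0 p Ω, (ρ ⋆[ContinuousLinearMap.mul ℝ ℝ] W0.fn u) x =
      W0.integralMul hmem none u := fun u => by
    rw [W0.integralMul_apply, convolution_mul_swap]
    rfl
  simpa only [hconv] using h (W0.integralMul hmem none)

theorem tendsto_setIntegral_abs_convolution_fn (hΩ : Bornology.IsBounded (Ω : Set (Eucl N)))
    {y : ℕ → W0 p Ω} {y₀ : W0 p Ω} (h : TendstoWeak y y₀)
    (hρ : Continuous ρ) (hρc : HasCompactSupport ρ) :
    Tendsto (fun k => ∫ x in (Ω : Set (Eucl N)),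
        |(ρ ⋆[ContinuousLinearMap.mul ℝ ℝ] W0.fn (y k)) x|) atTop
      (𝓝 (∫ x in (Ω : Set (Eucl N)), |(ρ ⋆[ContinuousLinearMap.mul ℝ ℝ] W0.fn y₀) x|)) := by
  have : IsFiniteMeasure (volume.restrict (Ω : Set (Eucl N))) := ⟨by simpa using hΩ.measure_lt_top⟩
  obtain ⟨K, hK⟩ := hρ.bounded_above_of_compact_support hρc
  have hK_nonneg : 0 ≤ K := (norm_nonneg _).trans (hK 0)
  obtain ⟨M, hM⟩ := (h.map (W0.toL1 hΩ none)).exists_norm_le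
  refine tendsto_integral_of_dominated_convergence (fun _ => K * M)
    (fun k => (continuous_convolution_fn hρ hρc (y k)).abs.aestronglyMeasurable)
    (integrable_const _) (fun k => ae_of_all _ fun x => ?_)
    (ae_of_all _ fun x => (tendsto_convolution_fn h hρ hρc x).abs)
  rw [Real.norm_eq_abs, abs_abs]
  exact (abs_convolution_fn_le hΩ hK (y k) x).trans (mul_le_mul_of_nonneg_left (hM k) hK_nonneg)

theorem setIntegral_abs_sub_convolution_fn_le_of_mem_testJets
    (hΩ : Bornology.IsBounded (Ω : Set (Eucl N))) (hρ : Continuous ρ) (hρc : HasCompactSupport ρ)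
    (hρ_nonneg : ∀ x, 0 ≤ ρ x) (hρ_one : ∫ x, ρ x = 1) {ε : ℝ} (hε : 0 ≤ ε)
    (hρε : ∀ x, ρ x ≠ 0 → ‖x‖ ≤ ε) {y : W0 p Ω} (hy : (y : Jet N p) ∈ testJets p Ω) :
    ∫ x in (Ω : Set (Eucl N)), |W0.fn y x - (ρ ⋆[ContinuousLinearMap.mul ℝ ℝ] W0.fn y) x| ≤
      ε * ∑ i, ‖W0.toL1 hΩ (some i) y‖ := by
  obtain ⟨φ, hfn, hgrad⟩ := hy
  have hφ : ContDiff ℝ 1 (φ : Eucl N → ℝ) := φ.contDiff.of_le (by simp)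
  have hconv : ρ ⋆[ContinuousLinearMap.mul ℝ ℝ] W0.fn y =
      ρ ⋆[ContinuousLinearMap.mul ℝ ℝ] (φ : Eucl N → ℝ) :=
    convolution_congr _ (EventuallyEq.refl _ ρ) hfn
  have hbound := (lintegral_sub_convolution_le hρ hρc hρ_nonneg hρ_one hρε hφ).trans
    (mul_le_mul_right (lintegral_enorm_fderiv_le hΩ hφ hgrad) _)
  rw [← ENNReal.ofReal_mul hε, ← hconv] at hbound
  have hmeas : Continuous fun x => φ x - (ρ ⋆[ContinuousLinearMap.mul ℝ ℝ] W0.fn y) x :=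
    φ.contDiff.continuous.sub (continuous_convolution_fn hρ hρc y)
  calc ∫ x in (Ω : Set (Eucl N)), |W0.fn y x - (ρ ⋆[ContinuousLinearMap.mul ℝ ℝ] W0.fn y) x|
      = ∫ x in (Ω : Set (Eucl N)), ‖φ x - (ρ ⋆[ContinuousLinearMap.mul ℝ ℝ] W0.fn y) x‖ := by
        refine integral_congr_ae (ae_restrict_of_ae ?_)
        filter_upwards [hfn] with x hx
        rw [W0.fn, hx, Real.norm_eq_abs]
    _ ≤ ε * ∑ i, ‖W0.toL1 hΩ (some i) y‖ := by
        rw [integral_norm_eq_lintegral_enorm hmeas.aestronglyMeasurable]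
        exact ENNReal.toReal_le_of_le_ofReal
          (mul_nonneg hε (Finset.sum_nonneg fun i _ => norm_nonneg _))
          ((setLIntegral_le_lintegral _ _).trans hbound)

theorem norm_toL1_le_setIntegral_abs_sub_convolution_fn
    (hΩ : Bornology.IsBounded (Ω : Set (Eucl N))) (hρ : Continuous ρ) (hρc : HasCompactSupport ρ)
    (y : W0 p Ω) :
    ‖W0.toL1 hΩ none y‖ ≤
      (∫ x in (Ω : Set (Eucl N)), |W0.fn y x - (ρ ⋆[ContinuousLinearMap.mul ℝ ℝ] W0.fn y) x|) +
        ∫ x in (Ω : Set (Eucl N)), |(ρ ⋆[ContinuousLinearMap.mul ℝ ℝ] W0.fn y) x| := by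
  have hfn : W0.toL1 hΩ none y =ᵐ[volume] W0.fn y := W0.coeFn_toL1 hΩ none y
  have hint : IntegrableOn (W0.fn y) Ω :=
    ((L1.integrable_coeFn (W0.toL1 hΩ none y)).congr hfn).integrableOn
  have hconv : IntegrableOn (ρ ⋆[ContinuousLinearMap.mul ℝ ℝ] W0.fn y) Ω :=
    ((continuous_convolution_fn hρ hρc y).continuousOn.integrableOn_compact
      hΩ.isCompact_closure).mono_set subset_closure
  calc ‖W0.toL1 hΩ none y‖ = ∫ x, |W0.fn y x| := by
        rw [L1.norm_eq_integral_norm]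
        exact integral_congr_ae (hfn.fun_comp (‖·‖))
    _ = ∫ x in (Ω : Set (Eucl N)), |W0.fn y x| :=
        (setIntegral_eq_integral_of_jet (y := y) none fun x hx => abs_eq_zero.2 hx).symm
    _ ≤ ∫ x in (Ω : Set (Eucl N)), (|W0.fn y x - (ρ ⋆[ContinuousLinearMap.mul ℝ ℝ] W0.fn y) x| +
          |(ρ ⋆[ContinuousLinearMap.mul ℝ ℝ] W0.fn y) x|) :=
        integral_mono hint.abs ((hint.sub hconv).abs.add hconv.abs) fun x => by
          simpa using abs_add_le (W0.fn y x - (ρ ⋆[ContinuousLinearMap.mul ℝ ℝ] W0.fn y) x)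
            ((ρ ⋆[ContinuousLinearMap.mul ℝ ℝ] W0.fn y) x)
    _ = _ := integral_add (hint.sub hconv).abs hconv.abs

theorem norm_toL1_le_add_setIntegral_abs_convolution_fn
    (hΩ : Bornology.IsBounded (Ω : Set (Eucl N))) (hρ : Continuous ρ) (hρc : HasCompactSupport ρ)
    (hρ_nonneg : ∀ x, 0 ≤ ρ x) (hρ_one : ∫ x, ρ x = 1) {ε : ℝ} (hε : 0 ≤ ε)
    (hρε : ∀ x, ρ x ≠ 0 → ‖x‖ ≤ ε) (y : W0 p Ω) :
    ‖W0.toL1 hΩ none y‖ ≤ ε * (∑ i, ‖W0.toL1 hΩ (some i) y‖) +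
      ∫ x in (Ω : Set (Eucl N)), |(ρ ⋆[ContinuousLinearMap.mul ℝ ℝ] W0.fn y) x| := by
  obtain ⟨w, hw, hwy⟩ := mem_closure_iff_seq_limit.1 y.2
  let u : ℕ → W0 p Ω := fun n => ⟨w n, subset_closure (hw n)⟩
  have hu : Tendsto u atTop (𝓝 y) := tendsto_subtype_rng.2 hwy
  have hnorm : ∀ o, Tendsto (fun n => ‖W0.toL1 hΩ o (u n)‖) atTop (𝓝 ‖W0.toL1 hΩ o y‖) :=
    fun o => (((W0.toL1 hΩ o).continuous.tendsto y).comp hu).norm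
  have hweak : TendstoWeak u y := fun ℓ => (ℓ.continuous.tendsto y).comp hu
  refine le_of_tendsto_of_tendsto' (hnorm none)
    (((tendsto_finsetSum _ fun i _ => hnorm (some i)).const_mul ε).add
      (tendsto_setIntegral_abs_convolution_fn hΩ hweak hρ hρc)) fun n => ?_
  exact (norm_toL1_le_setIntegral_abs_sub_convolution_fn hΩ hρ hρc (u n)).trans
    (add_le_add_left (setIntegral_abs_sub_convolution_fn_le_of_mem_testJets hΩ hρ hρc hρ_nonneg
      hρ_one hε hρε (hw n)) _)

/- Rellich's theorem. For a weakly null sequence `u k`, the mollifications `ρ ⋆ u k` tend to `0`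
pointwise and boundedly, while `ρ ⋆ u k - u k` is small in `L¹` uniformly in `k` when the support
of `ρ` is small, since the gradients are bounded in `L¹`. -/
theorem TendstoWeak.tendsto_toL1 (hΩ : Bornology.IsBounded (Ω : Set (Eucl N)))
    {y : ℕ → W0 p Ω} {y₀ : W0 p Ω} (h : TendstoWeak y y₀) :
    Tendsto (fun k => W0.toL1 hΩ none (y k)) atTop (𝓝 (W0.toL1 hΩ none y₀)) := by
  let u : ℕ → W0 p Ω := fun k => y k - y₀
  have hu : TendstoWeak u 0 := fun ℓ => by
    simpa only [u, map_sub, map_zero, sub_self] using (h ℓ).sub_const (ℓ y₀)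
  choose M hM using fun i : Fin N => (hu.map (W0.toL1 hΩ (some i))).exists_norm_le
  have hM_nonneg : ∀ i, 0 ≤ M i := fun i => (norm_nonneg _).trans (hM i 0)
  have hA : 0 < ∑ i, M i + 1 := add_pos_of_nonneg_of_pos (Finset.sum_nonneg fun i _ => hM_nonneg i)
    one_pos
  rw [tendsto_iff_norm_sub_tendsto_zero]
  simp only [← map_sub]
  refine (Metric.tendsto_atTop.2 fun δ hδ => ?_ :
    Tendsto (fun k => ‖W0.toL1 hΩ none (u k)‖) atTop (𝓝 0))
  let ε := δ / 2 / (∑ i, M i + 1)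
  have hε : 0 < ε := by positivity
  obtain ⟨ρ, hρ, hρc, hρ_nonneg, hρ_one, hρε⟩ := exists_mollifier (Eucl N) hε
  have hconv := tendsto_setIntegral_abs_convolution_fn hΩ hu hρ hρc
  have hfn_zero : W0.fn (0 : W0 p Ω) =ᵐ[volume] 0 := Lp.coeFn_zero ℝ p volume
  simp only [convolution_congr _ (EventuallyEq.refl _ _) hfn_zero, convolution_zero, Pi.zero_apply,
    abs_zero, integral_zero] at hconv
  obtain ⟨n, hn⟩ := eventually_atTop.1 (hconv.eventually_lt_const (half_pos hδ))
  refine ⟨n, fun k hk => ?_⟩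
  have hsum : ε * ∑ i, ‖W0.toL1 hΩ (some i) (u k)‖ ≤ δ / 2 :=
    calc ε * ∑ i, ‖W0.toL1 hΩ (some i) (u k)‖ ≤ ε * (∑ i, M i + 1) :=
          mul_le_mul_of_nonneg_left
            ((Finset.sum_le_sum fun i _ => hM i k).trans (le_add_of_nonneg_right zero_le_one)) hε.le
      _ = δ / 2 := div_mul_cancel₀ _ hA.ne'
  rw [dist_zero_right, norm_norm]
  linarith [norm_toL1_le_add_setIntegral_abs_convolution_fn hΩ hρ hρc hρ_nonneg hρ_one hε.le hρε
    (u k), hn k hk]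

end Rellich

/-! ### The div-curl lemma and closedness of the set of controls -/

section BoundedFunctionals

variable {E : Type*} [NormedAddCommGroup E] [NormedSpace ℝ E] {ℓ : ℕ → StrongDual ℝ E}
  {ℓ₀ : StrongDual ℝ E} {M : ℝ}

theorem tendsto_apply_of_dense {S : Set E} (hS : Dense S) (hM : ∀ k, ‖ℓ k‖ ≤ M)
    (h : ∀ v ∈ S, Tendsto (fun k => ℓ k v) atTop (𝓝 (ℓ₀ v))) (v : E) :
    Tendsto (fun k => ℓ k v) atTop (𝓝 (ℓ₀ v)) := by
  have hequi : Equicontinuous ((↑) ∘ ℓ : ℕ → E → ℝ) :=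
    ((NormedSpace.equicontinuous_TFAE ℓ).out 5 1).1 (Exists.intro M hM)
  have hclosed : IsClosed {v | Tendsto (fun k => ℓ k v) atTop (𝓝 (ℓ₀ v))} :=
    hequi.isClosed_setOfPred_tendsto ℓ₀.continuous
  exact closure_minimal h hclosed (hS v)

theorem tendsto_apply_of_tendsto_of_bounded (hℓ : Tendsto ℓ atTop (𝓝 ℓ₀)) {x : ℕ → E} {x₀ : E}
    (hM : ∀ k, ‖x k‖ ≤ M) (hx : Tendsto (fun k => ℓ₀ (x k)) atTop (𝓝 (ℓ₀ x₀))) :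
    Tendsto (fun k => ℓ k (x k)) atTop (𝓝 (ℓ₀ x₀)) := by
  have hbound : Tendsto (fun k => ‖ℓ k - ℓ₀‖ * M) atTop (𝓝 0) := by
    simpa using (tendsto_iff_norm_sub_tendsto_zero.1 hℓ).mul_const M
  have hdiff : Tendsto (fun k => (ℓ k - ℓ₀) (x k)) atTop (𝓝 0) :=
    squeeze_zero_norm (fun k => (ℓ k - ℓ₀).le_opNorm_of_le (hM k)) hbound
  simpa using hdiff.add hx

end BoundedFunctionals

section WeakStar

variable {α : Type*} [MeasurableSpace α] {μ : Measure α} [IsFiniteMeasure μ]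

theorem TendstoWeakStar.exists_norm_le {a : ℕ → Lp ℝ ∞ μ} {a₀ : Lp ℝ ∞ μ}
    (h : TendstoWeakStar a a₀) : ∃ M, ∀ k, ‖a k‖ ≤ M := by
  obtain ⟨M, hM⟩ := banach_steinhaus (g := fun k => lpToDual μ ∞ 1 (a k)) fun v => by
    obtain ⟨C, hC⟩ := (h v).norm.bddAbove_range
    exact ⟨C, fun k => by simpa only [lpToDual_apply] using hC (mem_range_self k)⟩
  exact ⟨M, fun k => (norm_lpToDual ENNReal.one_ne_top (a k)).symm.trans_le (hM k)⟩

theorem TendstoWeakStar.unique {a : ℕ → Lp ℝ ∞ μ} {a₀ b₀ : Lp ℝ ∞ μ}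
    (ha : TendstoWeakStar a a₀) (hb : TendstoWeakStar a b₀) : a₀ = b₀ := by
  have hdual : lpToDual μ ∞ 1 (a₀ - b₀) = 0 := by
    ext v
    rw [map_sub, sub_apply, lpToDual_apply, lpToDual_apply,
      tendsto_nhds_unique (ha v) (hb v), sub_self, zero_apply]
  rw [← sub_eq_zero, ← norm_eq_zero, ← norm_lpToDual ENNReal.one_ne_top, hdual, norm_zero]

theorem TendstoWeakStar.tendsto_integral_mul_L1 {a : ℕ → Lp ℝ ∞ μ} {a₀ : Lp ℝ ∞ μ}
    (h : TendstoWeakStar a a₀) {v : ℕ → Lp ℝ 1 μ} {v₀ : Lp ℝ 1 μ} (hv : Tendsto v atTop (𝓝 v₀)) :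
    Tendsto (fun k => ∫ x, a k x * v k x ∂μ) atTop (𝓝 (∫ x, a₀ x * v₀ x ∂μ)) := by
  obtain ⟨M, hM⟩ := h.exists_norm_le
  have happly : ∀ (b : Lp ℝ ∞ μ) (w : Lp ℝ 1 μ), lpToDual μ 1 ∞ w b = ∫ x, b x * w x ∂μ :=
    fun b w => by simp only [lpToDual_apply, mul_comm]
  simpa only [happly, Function.comp_apply] using tendsto_apply_of_tendsto_of_bounded
    (((lpToDual μ 1 ∞).continuous.tendsto v₀).comp hv) hM (by simpa only [happly] using h v₀)

theorem TendstoWeakStar.ae_le_sum_mul {ι : Type*} [Fintype ι] {a : ℕ → ι → Lp ℝ ∞ μ}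
    {a₀ : ι → Lp ℝ ∞ μ} (h : ∀ i, TendstoWeakStar (fun k => a k i) (a₀ i)) (c : ι → ℝ)
    {b : α → ℝ} (hb : Integrable b μ) (hle : ∀ k, ∀ᵐ x ∂μ, b x ≤ ∑ i, a k i x * c i) :
    ∀ᵐ x ∂μ, b x ≤ ∑ i, a₀ i x * c i := by
  have hint : ∀ u : ι → Lp ℝ ∞ μ, Integrable (fun x => ∑ i, u i x * c i) μ := fun u =>
    integrable_finsetSum _ fun i _ => ((Lp.memLp (u i)).integrable le_top).mul_const (c i)
  refine ae_le_of_forall_setIntegral_le hb (hint a₀) fun s hs _ => ?_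
  have hset : ∀ u : ι → Lp ℝ ∞ μ, ∫ x in s, ∑ i, u i x * c i ∂μ =
      ∑ i, ∫ x, u i x * s.indicator (fun _ => c i) x ∂μ := fun u => by
    rw [integral_finsetSum _ fun i _ =>
      (((Lp.memLp (u i)).integrable le_top).mul_const (c i)).integrableOn]
    refine Finset.sum_congr rfl fun i _ => ?_
    rw [← integral_indicator hs]
    simp only [indicator_mul_right]
  have hlim : Tendsto (fun k => ∫ x in s, ∑ i, a k i x * c i ∂μ) atTop
      (𝓝 (∫ x in s, ∑ i, a₀ i x * c i ∂μ)) := by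
    simp only [hset]
    exact tendsto_finsetSum _ fun i _ =>
      (h i).tendsto_integral_mul ((integrable_const (c i)).indicator hs)
  exact ge_of_tendsto' hlim fun k =>
    setIntegral_mono_ae hb.integrableOn (hint (a k)).integrableOn (hle k)

theorem TendstoWeakStar.ae_le_mul {a : ℕ → Lp ℝ ∞ μ} {a₀ : Lp ℝ ∞ μ} (h : TendstoWeakStar a a₀)
    (c : ℝ) {b : α → ℝ} (hb : Integrable b μ) (hle : ∀ k, ∀ᵐ x ∂μ, b x ≤ a k x * c) :
    ∀ᵐ x ∂μ, b x ≤ a₀ x * c := by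
  simpa using TendstoWeakStar.ae_le_sum_mul (ι := Unit) (fun _ => h) (fun _ => c) hb
    (by simpa using hle)

end WeakStar

section DivCurl

open scoped ContDiff

variable {N : ℕ} {p : ℝ≥0∞} [Fact (1 ≤ p)] {D : Opens (Eucl N)}

/-- The component with index `o` of `(v, ∂₁v, …, ∂_N v)`, as a function on `D`. -/
noncomputable def W0.component (o : Option (Fin N)) : W0 p D →L[ℝ] LSp p D :=
  (LpToLpRestrictCLM (Eucl N) ℝ ℝ volume p D).comp
    ((jetProj p o).comp (sobolevZero p D).subtypeL)

theorem W0.coeFn_component (o : Option (Fin N)) (v : W0 p D) :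
    W0.component o v =ᵐ[volume.restrict (D : Set (Eucl N))] (v : Jet N p) o :=
  LpToLpRestrictCLM_coeFn ℝ (D : Set (Eucl N)) ((v : Jet N p) o)

theorem integrable_jet (hD : Bornology.IsBounded (D : Set (Eucl N))) (v : W0 p D)
    (o : Option (Fin N)) : Integrable ((v : Jet N p) o) volume :=
  (L1.integrable_coeFn (W0.toL1 hD o v)).congr (W0.coeFn_toL1 hD o v)

theorem isDivergence_iff (hD : Bornology.IsBounded (D : Set (Eucl N))) {u : Fin N → LSp ∞ D}
    {ℓ : WNeg p D} : IsDivergence u ℓ ↔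
      ∀ φ : W0 p D, ℓ φ = -∑ j, ∫ x in (D : Set (Eucl N)), u j x * W0.grad φ j x := by
  refine forall_congr' fun φ => ?_
  have hint : ∀ j, Integrable (fun x => u j x * W0.grad φ j x)
      (volume.restrict (D : Set (Eucl N))) := fun j => memLp_one_iff_integrable.1 <|
    (memLp_one_iff_integrable.2 (integrable_jet hD φ (some j)).restrict).mul' (Lp.memLp (u j))
  rw [integral_finsetSum _ fun j _ => hint j]

variable {a : ℕ → Fin N → LSp ∞ D} {a₀ : Fin N → LSp ∞ D} {ℓ : ℕ → WNeg p D} {ℓ₀ : WNeg p D}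

theorem IsDivergence.of_tendsto (hD : Bornology.IsBounded (D : Set (Eucl N)))
    (ha : ∀ j, TendstoWeakStar (fun k => a k j) (a₀ j)) (hℓ : Tendsto ℓ atTop (𝓝 ℓ₀))
    (hdiv : ∀ k, IsDivergence (a k) (ℓ k)) : IsDivergence a₀ ℓ₀ := by
  rw [isDivergence_iff hD]
  intro φ
  have hlim := ((ContinuousLinearMap.apply ℝ ℝ φ).continuous.tendsto ℓ₀).comp hℓ
  refine tendsto_nhds_unique hlim (Tendsto.congr
    (fun k => ((isDivergence_iff hD).1 (hdiv k) φ).symm) ?_)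
  exact (tendsto_finsetSum _ fun j _ =>
    (ha j).tendsto_integral_mul (integrable_jet hD φ (some j)).restrict).neg

variable {q : ℝ≥0∞} [hpq : p.HolderConjugate q]

theorem integrable_mul_jet_mul (b : LSp ∞ D) (v : W0 p D) (o : Option (Fin N))
    {ψ : Eucl N → ℝ} (hψ : MemLp ψ q (volume.restrict (D : Set (Eucl N)))) :
    Integrable (fun x => b x * (v : Jet N p) o x * ψ x) (volume.restrict (D : Set (Eucl N))) :=
  have : q.HolderConjugate p := hpq.symm
  integrable_mul_mul_of_memLp (Lp.memLp b) ((Lp.memLp _).restrict _) hψ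

variable {ψ : Eucl N → ℝ}

theorem IsDivergence.sum_integral_mul_grad_mul (hD : Bornology.IsBounded (D : Set (Eucl N)))
    {b : Fin N → LSp ∞ D} {m : WNeg p D} (hb : IsDivergence b m) (hψ : ContDiff ℝ ∞ ψ)
    (hψc : HasCompactSupport ψ) (v : W0 p D) :
    ∑ j, ∫ x in (D : Set (Eucl N)), b j x * W0.grad v j x * ψ x =
      -m (W0.mulTest D hψ hψc v) - ∑ j, ∫ x in (D : Set (Eucl N)),
        b j x * (fderiv ℝ ψ x (EuclideanSpace.single j 1) * W0.fn v x) := by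
  let q := ENNReal.conjExponent p
  rw [(isDivergence_iff hD).1 hb, neg_neg, ← Finset.sum_sub_distrib]
  refine Finset.sum_congr rfl fun j _ => ?_
  have hψq : MemLp ψ q (volume.restrict (D : Set (Eucl N))) :=
    (hψ.continuous.memLp_of_hasCompactSupport hψc).restrict _
  have hψ' := (memLp_fderiv_apply hψ hψc (EuclideanSpace.single j 1) q).restrict
    (D : Set (Eucl N))
  have hfn : Integrable (fun x => b j x * (fderiv ℝ ψ x (EuclideanSpace.single j 1) * W0.fn v x))
      (volume.restrict (D : Set (Eucl N))) :=
    (integrable_mul_jet_mul (b j) v none hψ').congr (ae_of_all _ fun x => by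
      simp only [W0.fn]
      ring)
  have hgrad : Integrable (fun x => b j x * W0.grad v j x * ψ x)
      (volume.restrict (D : Set (Eucl N))) := integrable_mul_jet_mul (b j) v (some j) hψq
  rw [eq_sub_iff_add_eq, ← integral_add hgrad hfn]
  refine integral_congr_ae ?_
  filter_upwards [ae_restrict_of_ae (W0.grad_mulTest hψ hψc v j)] with x hx
  rw [hx, W0.grad]
  ring

theorem tendsto_integral_mul_fderiv_mul_fn (hD : Bornology.IsBounded (D : Set (Eucl N)))
    {b : ℕ → LSp ∞ D} {b₀ : LSp ∞ D} (hb : TendstoWeakStar b b₀) {y : ℕ → W0 p D} {y₀ : W0 p D}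
    (hy : TendstoWeak y y₀) (hψ : ContDiff ℝ ∞ ψ) (hψc : HasCompactSupport ψ) (e : Eucl N) :
    Tendsto (fun k => ∫ x in (D : Set (Eucl N)), b k x * (fderiv ℝ ψ x e * W0.fn (y k) x)) atTop
      (𝓝 (∫ x in (D : Set (Eucl N)), b₀ x * (fderiv ℝ ψ x e * W0.fn y₀ x))) := by
  have : IsFiniteMeasure (volume.restrict (D : Set (Eucl N))) :=
    ⟨by simpa using hD.measure_lt_top⟩
  have hψ' := memLp_fderiv_apply hψ hψc e ∞
  let T : Lp ℝ 1 (volume : Measure (Eucl N)) →L[ℝ] LSp 1 D :=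
    (LpToLpRestrictCLM (Eucl N) ℝ ℝ volume 1 D).comp (lpMul (hψ'.toLp _))
  have hT : ∀ v : W0 p D, T (W0.toL1 hD none v) =ᵐ[volume.restrict (D : Set (Eucl N))]
      fun x => fderiv ℝ ψ x e * W0.fn v x := fun v => by
    refine (LpToLpRestrictCLM_coeFn ℝ (D : Set (Eucl N)) _).trans (ae_restrict_of_ae ?_)
    filter_upwards [coeFn_lpMul_toLp hψ' (W0.toL1 hD none v), W0.coeFn_toL1 hD none v]
      with x hmul hfn
    exact hmul.trans (by rw [hfn, W0.fn])
  have hcongr : ∀ (c : LSp ∞ D) (v : W0 p D),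
      ∫ x in (D : Set (Eucl N)), c x * T (W0.toL1 hD none v) x =
        ∫ x in (D : Set (Eucl N)), c x * (fderiv ℝ ψ x e * W0.fn v x) := fun c v =>
    integral_congr_ae ((EventuallyEq.refl _ c).mul (hT v))
  simpa only [hcongr, Function.comp_apply] using
    hb.tendsto_integral_mul_L1 ((T.continuous.tendsto _).comp (hy.tendsto_toL1 hD))

theorem tendsto_sum_integral_mul_grad_mul_test (hD : Bornology.IsBounded (D : Set (Eucl N)))
    (ha : ∀ j, TendstoWeakStar (fun k => a k j) (a₀ j)) (hℓ : Tendsto ℓ atTop (𝓝 ℓ₀))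
    (hdiv : ∀ k, IsDivergence (a k) (ℓ k)) {y : ℕ → W0 p D} {y₀ : W0 p D} (hy : TendstoWeak y y₀)
    (hψ : ContDiff ℝ ∞ ψ) (hψc : HasCompactSupport ψ) :
    Tendsto (fun k => ∑ j, ∫ x in (D : Set (Eucl N)), a k j x * W0.grad (y k) j x * ψ x) atTop
      (𝓝 (∑ j, ∫ x in (D : Set (Eucl N)), a₀ j x * W0.grad y₀ j x * ψ x)) := by
  have hmul := hy.map (W0.mulTest D hψ hψc)
  obtain ⟨M, hM⟩ := hmul.exists_norm_le
  rw [(IsDivergence.of_tendsto hD ha hℓ hdiv).sum_integral_mul_grad_mul hD hψ hψc]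
  simp only [fun k => (hdiv k).sum_integral_mul_grad_mul hD hψ hψc (y k)]
  exact (tendsto_apply_of_tendsto_of_bounded hℓ hM (hmul ℓ₀)).neg.sub
    (tendsto_finsetSum _ fun j _ => tendsto_integral_mul_fderiv_mul_fn hD (ha j) hy hψ hψc _)

variable [Fact (1 ≤ q)]

variable (q) in
/-- The functional `ψ ↦ ∫_D (b, ∇v) ψ dx` on `L^q(D)`. -/
noncomputable def fieldPairing (b : Fin N → LSp ∞ D) (v : W0 p D) : StrongDual ℝ (LSp q D) :=
  ∑ j, lpToDual _ p q (lpMul (b j) (W0.component (some j) v))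

theorem fieldPairing_apply (b : Fin N → LSp ∞ D) (v : W0 p D) {r : LSp q D}
    (hr : r =ᵐ[volume.restrict (D : Set (Eucl N))] ψ) :
    fieldPairing q b v r = ∑ j, ∫ x in (D : Set (Eucl N)), b j x * W0.grad v j x * ψ x := by
  rw [fieldPairing, sum_apply]
  refine Finset.sum_congr rfl fun j _ => ?_
  rw [lpToDual_apply]
  refine integral_congr_ae (EventuallyEq.mul ?_ hr)
  exact (coeFn_lpMul _ _).trans ((EventuallyEq.refl _ (b j)).mul (W0.coeFn_component _ v))

theorem norm_fieldPairing_le (b : Fin N → LSp ∞ D) (v : W0 p D) :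
    ‖fieldPairing q b v‖ ≤ ∑ j, ‖b j‖ * ‖W0.component (some j) v‖ :=
  (norm_sum_le _ _).trans (Finset.sum_le_sum fun _ _ =>
    (norm_lpToDual_le _).trans (norm_lpMul_apply_le _ _))

/- The div-curl lemma. For a test function `ψ` the integral `∫ (a, ∇y) ψ` equals
`-⟨div a, ψ y⟩ - ∫ (a, ∇ψ) y`, where the divergences converge strongly in `W^{-1,q}(D)` and the
functions `y` converge strongly in `L¹(D)`. -/
theorem tendsto_sum_integral_mul_grad_mul (hq : q ≠ ⊤)
    (hD : Bornology.IsBounded (D : Set (Eucl N)))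
    (ha : ∀ j, TendstoWeakStar (fun k => a k j) (a₀ j)) (hℓ : Tendsto ℓ atTop (𝓝 ℓ₀))
    (hdiv : ∀ k, IsDivergence (a k) (ℓ k)) {y : ℕ → W0 p D} {y₀ : W0 p D} (hy : TendstoWeak y y₀)
    (hψ : MemLp ψ q (volume.restrict (D : Set (Eucl N)))) :
    Tendsto (fun k => ∑ j, ∫ x in (D : Set (Eucl N)), a k j x * W0.grad (y k) j x * ψ x) atTop
      (𝓝 (∑ j, ∫ x in (D : Set (Eucl N)), a₀ j x * W0.grad y₀ j x * ψ x)) := by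
  have : IsFiniteMeasure (volume.restrict (D : Set (Eucl N))) :=
    ⟨by simpa using hD.measure_lt_top⟩
  choose A hA using fun j => (ha j).exists_norm_le
  choose L hL using fun j : Fin N => (hy.map (W0.component (some j))).exists_norm_le
  have hbound : ∀ k, ‖fieldPairing q (a k) (y k)‖ ≤ ∑ j, A j * L j := fun k =>
    (norm_fieldPairing_le _ _).trans (Finset.sum_le_sum fun j _ =>
      mul_le_mul (hA j k) (hL j k) (norm_nonneg _) ((norm_nonneg _).trans (hA j k)))
  have hdense := Lp.dense_hasCompactSupport_contDiff (F := ℝ)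
    (μ := volume.restrict (D : Set (Eucl N))) hq
  have hlim := tendsto_apply_of_dense (ℓ := fun k => fieldPairing q (a k) (y k))
    (ℓ₀ := fieldPairing q a₀ y₀) hdense hbound ?_ (hψ.toLp ψ)
  · exact (hlim.congr fun k => fieldPairing_apply (a k) (y k) hψ.coeFn_toLp).trans_eq
      (congrArg 𝓝 (fieldPairing_apply a₀ y₀ hψ.coeFn_toLp))
  · rintro r ⟨g, hrg, hgc, hg⟩
    rw [fieldPairing_apply a₀ y₀ hrg]
    exact (tendsto_sum_integral_mul_grad_mul_test hD ha hℓ hdiv hy hg hgc).congr fun k =>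
      (fieldPairing_apply (a k) (y k) hrg).symm

end DivCurl

section Flux

variable {N : ℕ} {p : ℝ≥0∞}

theorem flux_eq_sum_prod (A : Fin N → Fin N → ℝ) (ζ η : Fin N → ℝ) :
    flux p A ζ η = ∑ e : Fin N × Fin N, A e.1 e.2 * (powMap p (ζ e.2) * η e.1) := by
  simp only [flux, Fintype.sum_prod_type, mul_assoc]

theorem flux_sub_flux_eq_sum_prod (A : Fin N → Fin N → ℝ) (ζ ζ' η : Fin N → ℝ) :
    flux p A ζ η - flux p A ζ' η =
      ∑ e : Fin N × Fin N, A e.1 e.2 * ((powMap p (ζ e.2) - powMap p (ζ' e.2)) * η e.1) := by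
  simp only [flux_eq_sum_prod, ← Finset.sum_sub_distrib, sub_mul, mul_sub]

theorem continuous_flux (hp : 1 < p.toReal) (A : Fin N → Fin N → ℝ) {X : Type*}
    [TopologicalSpace X] {f g : X → Fin N → ℝ} (hf : Continuous f) (hg : Continuous g) :
    Continuous fun x => flux p A (f x) (g x) := by
  have := continuous_powMap hp
  unfold flux
  fun_prop

theorem isClosed_setOf_flux_monotone (hp : 1 < p.toReal) (A : Fin N → Fin N → ℝ) :
    IsClosed {w : (Fin N → ℝ) × (Fin N → ℝ) |
      0 ≤ flux p A w.1 (w.1 - w.2) - flux p A w.2 (w.1 - w.2)} :=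
  isClosed_le continuous_const
    ((continuous_flux hp A continuous_fst (continuous_fst.sub continuous_snd)).sub
      (continuous_flux hp A continuous_snd (continuous_fst.sub continuous_snd)))

theorem isClosed_setOf_flux_coercive (hp : 1 < p.toReal) (A : Fin N → Fin N → ℝ) (α : ℝ) :
    IsClosed {ζ : Fin N → ℝ | α * ∑ k, |ζ k| ^ p.toReal ≤ flux p A ζ ζ} :=
  isClosed_le
    (continuous_const.mul (continuous_finsetSum _ fun i _ =>
      (continuous_apply i).abs.rpow_const fun _ => Or.inr (by linarith)))
    (continuous_flux hp A continuous_id continuous_id)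

end Flux

section ControlsClosed

variable {N : ℕ} {p : ℝ≥0∞} {D : Opens (Eucl N)}
  [IsFiniteMeasure (volume.restrict (D : Set (Eucl N)))] {U : ℕ → Control D} {U₀ : Control D}

theorem ae_abs_le_of_tendstoWeakStar {a : ℕ → LSp ∞ D} {a₀ : LSp ∞ D} (h : TendstoWeakStar a a₀)
    {β : ℝ} (hβ : ∀ k, ∀ᵐ x ∂(volume.restrict (D : Set (Eucl N))), |a k x| ≤ β) :
    ∀ᵐ x ∂(volume.restrict (D : Set (Eucl N))), |a₀ x| ≤ β := by
  have hlower := h.ae_le_mul 1 (integrable_const (-β)) fun k => (hβ k).mono fun x hx => by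
    linarith [(abs_le.1 hx).1]
  have hupper := h.ae_le_mul (-1) (integrable_const (-β)) fun k => (hβ k).mono fun x hx => by
    linarith [(abs_le.1 hx).2]
  filter_upwards [hlower, hupper] with x hx hx'
  exact abs_le.2 ⟨by linarith, by linarith⟩

/- For fixed vectors the inequality is linear in the matrix, so it passes to the weak-* limit
almost everywhere; the exceptional set is uniform over a countable dense set of vectors. -/
theorem ae_flux_monotone_of_tendstoWeakStar (hp : 1 < p.toReal)
    (hU : ∀ i j, TendstoWeakStar (fun k => U k i j) (U₀ i j))
    (hmono : ∀ k, ∀ᵐ x ∂(volume.restrict (D : Set (Eucl N))), ∀ ζ η : Fin N → ℝ,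
      0 ≤ flux p (fun i j => U k i j x) ζ (ζ - η) - flux p (fun i j => U k i j x) η (ζ - η)) :
    ∀ᵐ x ∂(volume.restrict (D : Set (Eucl N))), ∀ ζ η : Fin N → ℝ,
      0 ≤ flux p (fun i j => U₀ i j x) ζ (ζ - η) - flux p (fun i j => U₀ i j x) η (ζ - η) := by
  have hfixed : ∀ w : (Fin N → ℝ) × (Fin N → ℝ), ∀ᵐ x ∂(volume.restrict (D : Set (Eucl N))),
      0 ≤ flux p (fun i j => U₀ i j x) w.1 (w.1 - w.2) -
        flux p (fun i j => U₀ i j x) w.2 (w.1 - w.2) := fun w => by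
    simp only [flux_sub_flux_eq_sum_prod] at hmono ⊢
    exact TendstoWeakStar.ae_le_sum_mul (a := fun k (e : Fin N × Fin N) => U k e.1 e.2)
      (fun e => hU e.1 e.2) _ (integrable_const 0) fun k => (hmono k).mono fun x hx => hx w.1 w.2
  filter_upwards [ae_all_iff.2 fun n => hfixed (denseSeq _ n)] with x hx ζ η
  exact isClosed_property (denseRange_denseSeq _)
    (isClosed_setOf_flux_monotone hp fun i j => U₀ i j x) hx (ζ, η)

theorem ae_flux_coercive_of_tendstoWeakStar (hp : 1 < p.toReal) {α : ℝ}
    (hU : ∀ i j, TendstoWeakStar (fun k => U k i j) (U₀ i j))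
    (hcoer : ∀ k, ∀ᵐ x ∂(volume.restrict (D : Set (Eucl N))), ∀ ζ : Fin N → ℝ,
      α * ∑ k, |ζ k| ^ p.toReal ≤ flux p (fun i j => U k i j x) ζ ζ) :
    ∀ᵐ x ∂(volume.restrict (D : Set (Eucl N))), ∀ ζ : Fin N → ℝ,
      α * ∑ k, |ζ k| ^ p.toReal ≤ flux p (fun i j => U₀ i j x) ζ ζ := by
  have hfixed : ∀ ζ : Fin N → ℝ, ∀ᵐ x ∂(volume.restrict (D : Set (Eucl N))),
      α * ∑ k, |ζ k| ^ p.toReal ≤ flux p (fun i j => U₀ i j x) ζ ζ := fun ζ => by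
    simp only [flux_eq_sum_prod] at hcoer ⊢
    exact TendstoWeakStar.ae_le_sum_mul (a := fun k (e : Fin N × Fin N) => U k e.1 e.2)
      (fun e => hU e.1 e.2) _ (integrable_const _) fun k => (hcoer k).mono fun x hx => hx ζ
  filter_upwards [ae_all_iff.2 fun n => hfixed (denseSeq _ n)] with x hx ζ
  exact isClosed_property (denseRange_denseSeq _)
    (isClosed_setOf_flux_coercive hp (fun i j => U₀ i j x) α) hx ζ

theorem IsMClass.of_tendsto (hp : 1 < p.toReal) {α β : ℝ}
    (hU : ∀ i j, TendstoWeakStar (fun k => U k i j) (U₀ i j))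
    (hM : ∀ k, IsMClass p α β (U k)) : IsMClass p α β U₀ where
  symm i j := (hU i j).unique (by simpa only [fun k => (hM k).symm i j] using hU j i)
  growth i j := ae_abs_le_of_tendstoWeakStar (hU i j) fun k => (hM k).growth i j
  monotone := ae_flux_monotone_of_tendstoWeakStar hp hU fun k => (hM k).monotone
  coercive := ae_flux_coercive_of_tendstoWeakStar hp hU fun k => (hM k).coercive

theorem mem_boundedControls_of_tendsto (hp : 1 < p.toReal) {α β : ℝ} {ξ₁ ξ₂ : LSp ∞ D}
    (hU : ∀ i j, TendstoWeakStar (fun k => U k i j) (U₀ i j))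
    (hadm : ∀ k, U k ∈ boundedControls p α β ξ₁ ξ₂) : U₀ ∈ boundedControls p α β ξ₁ ξ₂ := by
  refine ⟨IsMClass.of_tendsto hp hU fun k => (hadm k).1, fun i j => ?_⟩
  have hint : ∀ ξ : LSp ∞ D, Integrable ξ (volume.restrict (D : Set (Eucl N))) := fun ξ =>
    (Lp.memLp ξ).integrable le_top
  have hlower := (hU i j).ae_le_mul 1 (hint ξ₁) fun k => ((hadm k).2 i j).mono fun x hx => by
    linarith [hx.1]
  have hupper := (hU i j).ae_le_mul (-1) (hint ξ₂).neg fun k =>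
    ((hadm k).2 i j).mono fun x hx => by linarith [hx.2, Pi.neg_apply (⇑ξ₂) x]
  filter_upwards [hlower, hupper] with x hx hx'
  exact ⟨by linarith, by linarith [Pi.neg_apply (⇑ξ₂) x]⟩

end ControlsClosed

section Solenoidal

variable {N : ℕ} {p : ℝ≥0∞} [Fact (1 ≤ p)] {D : Opens (Eucl N)} {α β : ℝ}
  {Q : Fin N → Set (WNeg p D)} {U : ℕ → Control D}

theorem exists_subseq_tendsto_of_isCompact {ι E : Type*} [Finite ι] [NormedAddCommGroup E]
    {K : ι → Set E} (hK : ∀ i, IsCompact (K i)) {x : ℕ → ι → E} (hx : ∀ k i, x k i ∈ K i) :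
    ∃ (φ : ℕ → ℕ) (x₀ : ι → E), StrictMono φ ∧ (∀ i, x₀ i ∈ K i) ∧
      ∀ i, Tendsto (fun k => x (φ k) i) atTop (𝓝 (x₀ i)) := by
  have := Fintype.ofFinite ι
  obtain ⟨x₀, hx₀, φ, hφ, hlim⟩ :=
    (isCompact_univ_pi hK).tendsto_subseq (x := x) fun k i _ => hx k i
  exact ⟨φ, x₀, hφ, fun i => hx₀ i (mem_univ i), tendsto_pi_nhds.1 hlim⟩

theorem exists_subseq_tendsto_divergence (hQ : ∀ i, IsCompact (Q i))
    (hU : ∀ k, U k ∈ solenoidalControls p α β Q) :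
    ∃ (φ : ℕ → ℕ) (ℓ : ℕ → Fin N → WNeg p D) (ℓ₀ : Fin N → WNeg p D), StrictMono φ ∧
      (∀ i, ℓ₀ i ∈ Q i) ∧ (∀ i, Tendsto (fun k => ℓ k i) atTop (𝓝 (ℓ₀ i))) ∧
      ∀ k i, IsDivergence (fun j => U (φ k) j i) (ℓ k i) := by
  choose m hm hdiv using fun k => (hU k).2
  obtain ⟨φ, ℓ₀, hφ, hℓ₀, hlim⟩ := exists_subseq_tendsto_of_isCompact hQ hm
  exact ⟨φ, m ∘ φ, ℓ₀, hφ, hℓ₀, hlim, fun k => hdiv (φ k)⟩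

theorem mem_admissibleControls_of_tendsto (hp : 1 < p.toReal)
    (hD : Bornology.IsBounded (D : Set (Eucl N))) {ξ₁ ξ₂ : LSp ∞ D}
    (hQ : ∀ i, IsCompact (Q i)) {U₀ : Control D}
    (hU : ∀ i j, TendstoWeakStar (fun k => U k i j) (U₀ i j))
    (hadm : ∀ k, U k ∈ admissibleControls p α β ξ₁ ξ₂ Q) :
    U₀ ∈ admissibleControls p α β ξ₁ ξ₂ Q := by
  have : IsFiniteMeasure (volume.restrict (D : Set (Eucl N))) :=
    ⟨by simpa using hD.measure_lt_top⟩
  have hbdd := mem_boundedControls_of_tendsto hp hU fun k => (hadm k).1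
  obtain ⟨φ, ℓ, ℓ₀, hφ, hℓ₀, hlim, hdiv⟩ :=
    exists_subseq_tendsto_divergence hQ fun k => (hadm k).2
  exact ⟨hbdd, hbdd.1, fun i => ⟨ℓ₀ i, hℓ₀ i, IsDivergence.of_tendsto hD
    (fun j => (hU j i).comp hφ.tendsto_atTop) (hlim i) fun k => hdiv k i⟩⟩

end Solenoidal

/-! ### The state equation -/

section Minty

/- Dividing the inequality at `x + t w` by `t` and letting `t → 0⁺` gives `0 ≤ (A x - b) w`. -/
theorem eq_of_minty {E : Type*} [NormedAddCommGroup E] [NormedSpace ℝ E] {A : E → StrongDual ℝ E}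
    {b : StrongDual ℝ E} {x : E} {ω : E → ℝ → ℝ}
    (hω : ∀ w, Tendsto (fun t => ω w t / t) (𝓝[>] 0) (𝓝 0))
    (hA : ∀ w, Tendsto (fun t : ℝ => A (x + t • w) w) (𝓝[>] 0) (𝓝 (A x w)))
    (hminty : ∀ w, ∀ᶠ t in 𝓝[>] (0 : ℝ), -ω w t ≤ A (x + t • w) (t • w) - b (t • w)) :
    A x = b := by
  have hle : ∀ w, b w ≤ A x w := fun w => by
    have hlim := ((hω w).add (hA w)).sub_const (b w)
    rw [zero_add] at hlim
    refine sub_nonneg.1 (ge_of_tendsto hlim ?_)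
    filter_upwards [self_mem_nhdsWithin, hminty w] with t (ht : 0 < t) h
    rw [map_smul, map_smul, smul_eq_mul, smul_eq_mul] at h
    rw [div_add' _ _ _ ht.ne', div_sub' ht.ne']
    exact div_nonneg (by linarith) ht.le
  refine ContinuousLinearMap.ext fun w => le_antisymm ?_ (hle w)
  simpa only [map_neg, neg_le_neg_iff] using hle (-w)

end Minty

section PowDual

variable {α : Type*} [MeasurableSpace α] {μ : Measure α} {p : ℝ≥0∞} [Fact (1 ≤ p)]

/-- The duality map `u ↦ |u|^{p-2} u` of `L^p`, with values in the dual space. -/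
noncomputable def powDual (hp : 1 < p.toReal) (u : Lp ℝ p μ) : StrongDual ℝ (Lp ℝ p μ) :=
  haveI : Fact (1 ≤ p.conjExponent) := ⟨ENNReal.HolderConjugate.one_le p.conjExponent p⟩
  lpToDual μ p.conjExponent p ((memLp_powMap hp (Lp.memLp u)).toLp fun x => powMap p (u x))

theorem powDual_apply (hp : 1 < p.toReal) (u v : Lp ℝ p μ) :
    powDual hp u v = ∫ x, powMap p (u x) * v x ∂μ :=
  haveI : Fact (1 ≤ p.conjExponent) := ⟨ENNReal.HolderConjugate.one_le p.conjExponent p⟩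
  lpToDual_toLp_apply _ v

theorem powDual_apply_eq_integral (hp : 1 < p.toReal) {u v : Lp ℝ p μ} {u' v' : α → ℝ}
    (hu : u =ᵐ[μ] u') (hv : v =ᵐ[μ] v') :
    powDual hp u v = ∫ x, powMap p (u' x) * v' x ∂μ := by
  rw [powDual_apply]
  exact integral_congr_ae ((hu.fun_comp (powMap p)).mul hv)

theorem tendsto_powDual_add_smul (hp : 1 < p.toReal) (u w v : Lp ℝ p μ) :
    Tendsto (fun t : ℝ => powDual hp (u + t • w) v) (𝓝 0) (𝓝 (powDual hp u v)) := by
  rw [powDual_apply]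
  refine (tendsto_integral_powMap_add_smul (q := p.conjExponent) hp (Lp.memLp u) (Lp.memLp w)
    (Lp.memLp v)).congr fun t => ?_
  refine (powDual_apply_eq_integral hp ?_ (EventuallyEq.refl _ _)).symm
  filter_upwards [Lp.coeFn_add u (t • w), Lp.coeFn_smul t w] with x hadd hsmul
  rw [hadd, Pi.add_apply, hsmul, Pi.smul_apply, smul_eq_mul]

end PowDual

section StateOperator

variable {N : ℕ} {p : ℝ≥0∞} [Fact (1 ≤ p)] {Ω D : Opens (Eucl N)}

theorem coeFn_restrictL {r : ℝ≥0∞} (h : Ω ≤ D) (a : LSp r D) :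
    restrictL h a =ᵐ[volume.restrict (Ω : Set (Eucl N))] a :=
  MemLp.coeFn_toLp _

theorem norm_extendZero (h : Ω ≤ D) (y : W0 p Ω) : ‖extendZero h y‖ = ‖y‖ := rfl

/-- Extension by zero as a continuous linear map. -/
noncomputable def extendZeroL (h : Ω ≤ D) : W0 p Ω →L[ℝ] W0 p D :=
  (extendZero h).mkContinuous 1 fun y => by rw [norm_extendZero, one_mul]

/-- The operator `y ↦ -div (U [(∇y)^{p-2}] ∇y) + |y|^{p-2} y` from `W₀^{1,p}(Ω)` to its dual. -/
noncomputable def stateOperator (h : Ω ≤ D) (hp : 1 < p.toReal) (U : Control D) (y : W0 p Ω) :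
    StrongDual ℝ (W0 p Ω) :=
  (∑ j, ∑ i, (powDual hp (W0.component (some j) y)).comp
    ((lpMul (restrictL h (U i j))).comp (W0.component (some i)))) +
  (powDual hp (W0.component none y)).comp (W0.component none)

theorem stateOperator_apply_eq_sum (h : Ω ≤ D) (hp : 1 < p.toReal) (U : Control D)
    (y v : W0 p Ω) : stateOperator h hp U y v =
      (∑ j, ∑ i, ∫ x in (Ω : Set (Eucl N)),
        U i j x * W0.grad v i x * powMap p (W0.grad y j x)) +
      ∫ x in (Ω : Set (Eucl N)), powMap p (W0.fn y x) * W0.fn v x := by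
  have hmul : ∀ i j, lpMul (restrictL h (U i j)) (W0.component (some i) v)
      =ᵐ[volume.restrict (Ω : Set (Eucl N))] fun x => U i j x * W0.grad v i x := fun i j =>
    (coeFn_lpMul _ _).trans ((coeFn_restrictL h (U i j)).mul (W0.coeFn_component (some i) v))
  simp only [stateOperator, add_apply, sum_apply, ContinuousLinearMap.comp_apply,
    powDual_apply_eq_integral hp (W0.coeFn_component _ y) (hmul _ _),
    powDual_apply_eq_integral hp (W0.coeFn_component _ y) (W0.coeFn_component _ v)]
  congr 1
  simp only [mul_comm (powMap p _)]
  rfl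

theorem integrable_flux_term (h : Ω ≤ D) (hp : 1 < p.toReal) (a : LSp ∞ D) (y v : W0 p Ω)
    (i j : Fin N) : Integrable (fun x => a x * powMap p (W0.grad y j x) * W0.grad v i x)
      (volume.restrict (Ω : Set (Eucl N))) :=
  integrable_mul_mul_of_memLp (q := p.conjExponent)
    ((Lp.memLp a).mono_measure (Measure.restrict_mono_set volume h))
    (memLp_powMap hp ((Lp.memLp _).restrict _)) ((Lp.memLp _).restrict _)

theorem integrable_flux (h : Ω ≤ D) (hp : 1 < p.toReal) (U : Control D) (y v : W0 p Ω) :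
    Integrable (fun x => flux p (fun i j => U i j x) (fun j => W0.grad y j x)
      (fun i => W0.grad v i x)) (volume.restrict (Ω : Set (Eucl N))) :=
  integrable_finsetSum _ fun i _ => integrable_finsetSum _ fun j _ =>
    integrable_flux_term h hp (U i j) y v i j

theorem integrable_powMap_mul (hp : 1 < p.toReal) (y v : W0 p Ω) :
    Integrable (fun x => powMap p (W0.fn y x) * W0.fn v x)
      (volume.restrict (Ω : Set (Eucl N))) :=
  integrable_mul_of_memLp (q := p.conjExponent) (memLp_powMap hp ((Lp.memLp _).restrict _))
    ((Lp.memLp _).restrict _)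

theorem stateOperator_apply (h : Ω ≤ D) (hp : 1 < p.toReal) (U : Control D) (y v : W0 p Ω) :
    stateOperator h hp U y v =
      (∫ x in (Ω : Set (Eucl N)), flux p (fun i j => U i j x) (fun j => W0.grad y j x)
        (fun i => W0.grad v i x)) +
      ∫ x in (Ω : Set (Eucl N)), powMap p (W0.fn y x) * W0.fn v x := by
  have hterm := integrable_flux_term (N := N) h hp
  rw [stateOperator_apply_eq_sum, Finset.sum_comm]
  simp only [flux, mul_right_comm _ (W0.grad v _ _)]
  rw [integral_finsetSum _ fun i _ => integrable_finsetSum _ fun j _ => hterm (U i j) y v i j]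
  congr 1
  exact Finset.sum_congr rfl fun i _ =>
    (integral_finsetSum _ fun j _ => hterm (U i j) y v i j).symm

theorem isWeakSolution_iff {h : Ω ≤ D} (hp : 1 < p.toReal) {f : WNeg p D} {U : Control D}
    {y : W0 p Ω} :
    IsWeakSolution h f U y ↔ stateOperator h hp U y = f.comp (extendZeroL h) := by
  rw [ContinuousLinearMap.ext_iff]
  exact forall_congr' fun v => by rw [stateOperator_apply]; rfl

theorem tendsto_stateOperator_add_smul (h : Ω ≤ D) (hp : 1 < p.toReal) (U : Control D)
    (y w v : W0 p Ω) :
    Tendsto (fun t : ℝ => stateOperator h hp U (y + t • w) v) (𝓝 0)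
      (𝓝 (stateOperator h hp U y v)) := by
  simp only [stateOperator, add_apply, sum_apply, ContinuousLinearMap.comp_apply, map_add, map_smul]
  exact (tendsto_finsetSum _ fun j _ => tendsto_finsetSum _ fun i _ =>
    tendsto_powDual_add_smul hp _ _ _).add (tendsto_powDual_add_smul hp _ _ _)

variable {h : Ω ≤ D} {α β : ℝ} {U : Control D}

theorem integral_powMap_sub_le_stateOperator_sub (hp : 1 < p.toReal) (hU : IsMClass p α β U)
    (y v : W0 p Ω) :
    ∫ x in (Ω : Set (Eucl N)), (powMap p (W0.fn y x) - powMap p (W0.fn v x)) *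
        (W0.fn y x - W0.fn v x) ≤
      stateOperator h hp U y (y - v) - stateOperator h hp U v (y - v) := by
  have hjet : ∀ o, ((y - v : W0 p Ω) : Jet N p) o =ᵐ[volume.restrict (Ω : Set (Eucl N))]
      fun x => (y : Jet N p) o x - (v : Jet N p) o x := fun o =>
    ae_restrict_of_ae (Lp.coeFn_sub ((y : Jet N p) o) ((v : Jet N p) o))
  have hflux : 0 ≤ ∫ x in (Ω : Set (Eucl N)),
      (flux p (fun i j => U i j x) (fun j => W0.grad y j x) (fun i => W0.grad (y - v) i x) -
        flux p (fun i j => U i j x) (fun j => W0.grad v j x) (fun i => W0.grad (y - v) i x)) := by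
    refine integral_nonneg_of_ae ?_
    filter_upwards [ae_all_iff.2 fun i : Fin N => hjet (some i),
      ae_restrict_of_ae_restrict_of_subset h hU.monotone] with x hx hmono
    rw [show (fun i => W0.grad (y - v) i x) = (fun i => W0.grad y i x) - fun i => W0.grad v i x
      from funext hx]
    exact hmono _ _
  have hzero : ∫ x in (Ω : Set (Eucl N)), (powMap p (W0.fn y x) - powMap p (W0.fn v x)) *
        (W0.fn y x - W0.fn v x) =
      ∫ x in (Ω : Set (Eucl N)), (powMap p (W0.fn y x) * W0.fn (y - v) x -
        powMap p (W0.fn v x) * W0.fn (y - v) x) := by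
    refine integral_congr_ae ((hjet none).mono fun x hx => ?_)
    change _ = _ * ((y - v : W0 p Ω) : Jet N p) none x - _ * ((y - v : W0 p Ω) : Jet N p) none x
    rw [hx, ← sub_mul]
    rfl
  rw [integral_sub (integrable_flux h hp U y _) (integrable_flux h hp U v _)] at hflux
  rw [hzero, integral_sub (integrable_powMap_mul hp y _) (integrable_powMap_mul hp v _),
    stateOperator_apply, stateOperator_apply]
  linarith

theorem stateOperator_monotone (hp : 1 < p.toReal) (hU : IsMClass p α β U) (y v : W0 p Ω) :
    stateOperator h hp U v (y - v) ≤ stateOperator h hp U y (y - v) :=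
  sub_nonneg.1 ((integral_nonneg fun _ => powMap_sub_mul_sub_nonneg hp _ _).trans
    (integral_powMap_sub_le_stateOperator_sub hp hU y v))

theorem stateOperator_injective (hp : 1 < p.toReal) (hU : IsMClass p α β U) :
    Function.Injective (stateOperator h hp U) := fun y v heq => by
  have hle := integral_powMap_sub_le_stateOperator_sub (h := h) hp hU y v
  rw [heq, sub_self] at hle
  have hint : Integrable (fun x => (powMap p (W0.fn y x) - powMap p (W0.fn v x)) *
      (W0.fn y x - W0.fn v x)) (volume.restrict (Ω : Set (Eucl N))) :=
    integrable_mul_of_memLp (p := p) (q := p.conjExponent)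
      ((memLp_powMap hp ((Lp.memLp _).restrict _)).sub (memLp_powMap hp ((Lp.memLp _).restrict _)))
      (((Lp.memLp _).restrict _).sub ((Lp.memLp _).restrict _))
  have hnonneg := fun x => powMap_sub_mul_sub_nonneg hp (W0.fn y x) (W0.fn v x)
  have hzero := (integral_eq_zero_iff_of_nonneg hnonneg hint).1
    (hle.antisymm (integral_nonneg hnonneg))
  rw [EventuallyEq, ae_restrict_iff' Ω.isOpen.measurableSet] at hzero
  refine sub_eq_zero.1 (eq_zero_of_fn_ae_eq_zero ?_)
  filter_upwards [hzero, jet_ae_eq_zero (y - v) none,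
    Lp.coeFn_sub ((y : Jet N p) none) ((v : Jet N p) none)] with x hx hout hsub
  by_cases hxΩ : x ∈ (Ω : Set (Eucl N))
  · refine hsub.trans (sub_eq_zero.2 ?_)
    by_contra hne
    exact (powMap_sub_mul_sub_pos hp hne).ne' (hx hxΩ)
  · exact hout hxΩ

theorem IsWeakSolution.unique (hp : 1 < p.toReal) (hU : IsMClass p α β U) {f : WNeg p D}
    {y v : W0 p Ω} (hy : IsWeakSolution h f U y) (hv : IsWeakSolution h f U v) : y = v :=
  stateOperator_injective hp hU
    (((isWeakSolution_iff hp).1 hy).trans ((isWeakSolution_iff hp).1 hv).symm)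

theorem stateOperator_coercive (hp : 1 < p.toReal) (hU : IsMClass p α β U) (y : W0 p Ω) :
    min α 1 * ‖y‖ ^ p.toReal ≤ stateOperator h hp U y y := by
  have hp' := ne_top_of_one_lt_toReal hp
  have hnonneg : ∀ u : Eucl N → ℝ, 0 ≤ ∫ x in (Ω : Set (Eucl N)), |u x| ^ p.toReal := fun u =>
    integral_nonneg fun x => Real.rpow_nonneg (abs_nonneg _) _
  have hint : ∀ i, Integrable (fun x => |W0.grad y i x| ^ p.toReal)
      (volume.restrict (Ω : Set (Eucl N))) := fun i => integrable_abs_rpow hp'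
    ((Lp.memLp _).restrict _)
  have hflux : α * ∑ i, ∫ x in (Ω : Set (Eucl N)), |W0.grad y i x| ^ p.toReal ≤
      ∫ x in (Ω : Set (Eucl N)), flux p (fun i j => U i j x) (fun j => W0.grad y j x)
        (fun i => W0.grad y i x) := by
    rw [← integral_finsetSum _ fun i _ => hint i, ← integral_const_mul]
    refine integral_mono_ae ((integrable_finsetSum _ fun i _ => hint i).const_mul α)
      (integrable_flux h hp U y y) ?_
    filter_upwards [ae_restrict_of_ae_restrict_of_subset h hU.coercive] with x hx
    exact hx _
  have hfn := mul_le_mul_of_nonneg_right (min_le_right α 1) (hnonneg (W0.fn y))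
  have hgrad := mul_le_mul_of_nonneg_right (min_le_left α 1)
    (Finset.sum_nonneg (s := Finset.univ) fun i _ => hnonneg (W0.grad y i))
  rw [stateOperator_apply, W0_norm_rpow hp']
  simp only [powMap_mul_self hp]
  linarith

theorem IsWeakSolution.norm_le (hp : 1 < p.toReal) (hα : 0 < α) (hU : IsMClass p α β U)
    {f : WNeg p D} {y : W0 p Ω} (hy : IsWeakSolution h f U y) :
    ‖y‖ ≤ (‖f‖ / min α 1) ^ (p.toReal - 1)⁻¹ := by
  have hmin : 0 < min α 1 := lt_min hα one_pos
  have henergy : min α 1 * ‖y‖ ^ p.toReal ≤ ‖f‖ * ‖y‖ :=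
    ((stateOperator_coercive hp hU y).trans_eq
      (DFunLike.congr_fun ((isWeakSolution_iff hp).1 hy) y)).trans
      ((le_abs_self _).trans (f.le_opNorm (extendZeroL h y)))
  have hpow : ‖y‖ ^ (p.toReal - 1) ≤ ‖f‖ / min α 1 := by
    rcases (norm_nonneg y).eq_or_lt' with hy₀ | hy₀
    · rw [hy₀, Real.zero_rpow (sub_pos.2 hp).ne']
      positivity
    · rw [le_div_iff₀' hmin, Real.rpow_sub_one hy₀.ne', ← mul_div_assoc]
      exact (div_le_iff₀ hy₀).2 henergy
  exact (Real.le_rpow_inv_iff_of_pos (norm_nonneg y) (by positivity) (sub_pos.2 hp)).2 hpow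

end StateOperator

section StateLimit

variable {N : ℕ} {p : ℝ≥0∞} [Fact (1 ≤ p)] {Ω D : Opens (Eucl N)} {U : ℕ → Control D}
  {U₀ : Control D} {y : ℕ → W0 p Ω} {y₀ : W0 p Ω}

theorem setIntegral_mul_grad_mul_eq (h : Ω ≤ D) (a : LSp ∞ D) (u : W0 p Ω) (i : Fin N)
    (ψ : Eucl N → ℝ) : ∫ x in (Ω : Set (Eucl N)), a x * W0.grad u i x * ψ x =
      ∫ x in (D : Set (Eucl N)), a x * W0.grad (extendZero h u) i x * ψ x := by
  rw [← setIntegral_eq_of_subset_of_ae_sdiff_eq_zero D.isOpen.measurableSet.nullMeasurableSet h]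
  · rfl
  · filter_upwards [jet_ae_eq_zero u (some i)] with x hx hxD
    have hgrad : W0.grad u i x = 0 := hx hxD.2
    rw [hgrad, mul_zero, zero_mul]

theorem tendsto_stateOperator_apply (h : Ω ≤ D) (hp : 1 < p.toReal)
    (hD : Bornology.IsBounded (D : Set (Eucl N)))
    (hU : ∀ i j, TendstoWeakStar (fun k => U k i j) (U₀ i j))
    {ℓ : ℕ → Fin N → WNeg p D} {ℓ₀ : Fin N → WNeg p D}
    (hℓ : ∀ i, Tendsto (fun k => ℓ k i) atTop (𝓝 (ℓ₀ i)))
    (hdiv : ∀ k i, IsDivergence (fun j => U k j i) (ℓ k i)) (hy : TendstoWeak y y₀)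
    (v : W0 p Ω) :
    Tendsto (fun k => stateOperator h hp (U k) v (y k)) atTop
      (𝓝 (stateOperator h hp U₀ v y₀)) := by
  have : Fact (1 ≤ p.conjExponent) := ⟨ENNReal.HolderConjugate.one_le p.conjExponent p⟩
  have hq : p.conjExponent ≠ ⊤ := ((ENNReal.HolderConjugate.lt_top_iff_one_lt
    p.conjExponent p).2 (one_lt_of_one_lt_toReal hp)).ne
  simp only [stateOperator_apply_eq_sum, setIntegral_mul_grad_mul_eq h]
  refine Tendsto.add (tendsto_finsetSum _ fun j _ => ?_) ?_
  · exact tendsto_sum_integral_mul_grad_mul (q := p.conjExponent) hq hD (fun i => hU i j) (hℓ j)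
      (fun k => hdiv k j) (hy.map (extendZeroL h)) (memLp_powMap hp ((Lp.memLp _).restrict _))
  · have hfn : ∀ u : W0 p Ω, ((powDual hp (W0.component none v)).comp (W0.component none)) u =
        ∫ x in (Ω : Set (Eucl N)), powMap p (W0.fn v x) * W0.fn u x := fun u =>
      powDual_apply_eq_integral hp (W0.coeFn_component none v) (W0.coeFn_component none u)
    simpa only [hfn] using hy ((powDual hp (W0.component none v)).comp (W0.component none))

/- Minty's argument: monotonicity gives `A(Uₖ) v (yₖ - v) ≤ f(yₖ - v)`, which only involves the
control tested against the fixed gradient of `v`, so the div-curl lemma passes to the limit. -/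
theorem IsWeakSolution.of_tendsto {h : Ω ≤ D} (hp : 1 < p.toReal)
    (hD : Bornology.IsBounded (D : Set (Eucl N))) {α β : ℝ} {Q : Fin N → Set (WNeg p D)}
    (hQ : ∀ i, IsCompact (Q i)) (hmem : ∀ k, U k ∈ solenoidalControls p α β Q)
    (hU : ∀ i j, TendstoWeakStar (fun k => U k i j) (U₀ i j)) {f : WNeg p D}
    (hsol : ∀ k, IsWeakSolution h f (U k) (y k)) (hy : TendstoWeak y y₀) :
    IsWeakSolution h f U₀ y₀ := by
  obtain ⟨φ, ℓ, ℓ₀, hφ, -, hℓ, hdiv⟩ := exists_subseq_tendsto_divergence hQ hmem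
  have hlim : ∀ v, stateOperator h hp U₀ v (y₀ - v) ≤ f (extendZeroL h (y₀ - v)) := fun v => by
    have hsub : TendstoWeak (fun k => y (φ k) - v) (y₀ - v) := fun m => by
      simpa only [map_sub, Function.comp_apply] using
        (hy.comp hφ.tendsto_atTop m).sub_const (m v)
    refine le_of_tendsto_of_tendsto' (tendsto_stateOperator_apply h hp hD
      (fun i j => (hU i j).comp hφ.tendsto_atTop) hℓ hdiv hsub v)
      (hsub (f.comp (extendZeroL h))) fun k => ?_
    exact (stateOperator_monotone hp (hmem (φ k)).1 (y (φ k)) v).trans_eq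
      (DFunLike.congr_fun ((isWeakSolution_iff hp).1 (hsol (φ k))) _)
  refine (isWeakSolution_iff hp).2 (eq_of_minty (ω := 0) (fun w => by simp) (fun w =>
    (tendsto_stateOperator_add_smul h hp U₀ y₀ w w).mono_left nhdsWithin_le_nhds) fun w =>
      Eventually.of_forall fun t => ?_)
  have hminty := hlim (y₀ + t • w)
  rw [sub_add_cancel_left, map_neg, map_neg, map_neg] at hminty
  simpa using hminty

end StateLimit

/-! ### The Hammerstein equation -/

section CompactSeminorm

variable {Z : Type*} [NormedAddCommGroup Z] [NormedSpace ℝ Z] {S : Seminorm ℝ Z}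

theorem exists_strongDual_apply_eq_seminorm (hS : Continuous S) (c : Z) :
    ∃ ℓ : StrongDual ℝ Z, ℓ c = S c ∧ ∀ z, |ℓ z| ≤ S z := by
  rcases eq_or_ne (S c) 0 with h | h
  · exact ⟨0, by simp [h], fun z => by simp⟩
  have hc : c ≠ 0 := fun hc => h (by rw [hc, map_zero])
  let e := LinearEquiv.toSpanNonzeroSingleton ℝ Z c hc
  obtain ⟨ℓ, hℓ, hle⟩ := Module.Dual.exists_continuous_extension_of_le_seminorm
    (Submodule.span ℝ {c}) (S c • (e.symm : Submodule.span ℝ {c} →ₗ[ℝ] ℝ)) hS fun x => by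
      obtain ⟨t, rfl⟩ := e.surjective x
      have hval : (e t : Z) = t • c := rfl
      simp [hval, map_smul_eq_mul, mul_comm, abs_of_nonneg (apply_nonneg S c)]
  refine ⟨ℓ, ?_, hle⟩
  have hone : (e 1 : Z) = c := one_smul ℝ c
  simpa [hone] using hℓ (e 1)

theorem IsCompactSeminorm.continuous (hS : IsCompactSeminorm S) : Continuous S := by
  obtain ⟨T, hT, hcover⟩ := hS 1 one_pos
  obtain ⟨m, hm⟩ := (hT.image S).bddAbove
  refine Seminorm.continuous' (r := 1 + m)
    (mem_of_superset (Metric.closedBall_mem_nhds 0 one_pos) fun z hz => ?_)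
  obtain ⟨c, hc, hzc⟩ := hcover z (mem_closedBall_zero_iff.1 hz)
  rw [Seminorm.mem_closedBall_zero, ← sub_add_cancel z c]
  exact (map_add_le_add S _ _).trans (add_le_add hzc.le (hm (mem_image_of_mem S hc)))

theorem IsCompactSeminorm.exists_finite_cover (hS : IsCompactSeminorm S) (M : ℝ) {ε : ℝ}
    (hε : 0 < ε) : ∃ T : Set Z, T.Finite ∧ ∀ z, ‖z‖ ≤ M → ∃ c ∈ T, S (z - c) < ε := by
  set L := max M 1
  have hL : 0 < L := lt_max_of_lt_right one_pos
  obtain ⟨T, hT, hcover⟩ := hS (ε / L) (div_pos hε hL)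
  refine ⟨(L • ·) '' T, hT.image _, fun z hz => ?_⟩
  have hscale : ‖L⁻¹ • z‖ ≤ 1 := by
    rw [norm_smul, norm_inv, Real.norm_eq_abs, abs_of_pos hL, inv_mul_le_one₀ hL]
    exact hz.trans (le_max_left _ _)
  obtain ⟨c, hc, hzc⟩ := hcover _ hscale
  refine ⟨L • c, mem_image_of_mem _ hc, ?_⟩
  have hsub : z - L • c = L • (L⁻¹ • z - c) := by
    rw [smul_sub, smul_inv_smul₀ hL.ne']
  rwa [hsub, map_smul_eq_mul, Real.norm_eq_abs, abs_of_pos hL, ← lt_div_iff₀' hL]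

/- On the finitely many points `c` of a net, `S c = ℓ c` for some functional `ℓ ≤ S`; hence `S` is
controlled by finitely many functionals up to `ε`. -/
theorem IsCompactSeminorm.tendsto_zero (hS : IsCompactSeminorm S) {x : ℕ → Z}
    (hx : TendstoWeak x 0) : Tendsto (fun k => S (x k)) atTop (𝓝 0) := by
  choose ℓ hℓ hle using exists_strongDual_apply_eq_seminorm hS.continuous
  obtain ⟨M, hM⟩ := hx.exists_norm_le
  rw [Metric.tendsto_atTop']
  intro ε hε
  obtain ⟨T, hT, hcover⟩ := hS.exists_finite_cover M (by positivity : 0 < ε / 3)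
  have hev : ∀ᶠ k in atTop, ∀ c ∈ T, ℓ c (x k) < ε / 3 :=
    (eventually_all_finite hT).2 fun c _ =>
      (hx (ℓ c)).eventually_lt_const (by rw [map_zero]; positivity)
  obtain ⟨n, hn⟩ := eventually_atTop.1 hev
  refine ⟨n, fun k hk => ?_⟩
  obtain ⟨c, hc, hxc⟩ := hcover (x k) (hM k)
  rw [Real.dist_eq, sub_zero, abs_of_nonneg (apply_nonneg S _)]
  have hneg := (neg_le_abs _).trans (hle c (x k - c))
  rw [map_sub, hℓ] at hneg
  calc S (x k) = S ((x k - c) + c) := by rw [sub_add_cancel]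
    _ ≤ S (x k - c) + S c := map_add_le_add S _ _
    _ < ε := by linarith [hn k hk.le c hc]

theorem IsCompactSeminorm.tendsto_apply (hS : IsCompactSeminorm S) {x : ℕ → Z} {x₀ : Z}
    (hx : TendstoWeak x x₀) : Tendsto (fun k => S (x k)) atTop (𝓝 (S x₀)) := by
  have hsub : TendstoWeak (fun k => x k - x₀) 0 := fun ℓ => by
    simpa using (hx ℓ).sub_const (ℓ x₀)
  rw [tendsto_iff_norm_sub_tendsto_zero]
  exact squeeze_zero (fun k => norm_nonneg _) (fun k => abs_sub_map_le_sub S (x k) x₀)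
    (hS.tendsto_zero hsub)

end CompactSeminorm

section SemiboundedVariation

theorem eq_zero_of_tendsto_div {c : ℝ → ℝ} (hc : ContinuousOn c (Ici 0))
    (h : Tendsto (fun t => c t / t) (𝓝[>] 0) (𝓝 0)) : c 0 = 0 := by
  have hmul := h.mul (tendsto_id.mono_left (nhdsWithin_le_nhds (s := Ioi (0 : ℝ)) (a := 0)))
  rw [zero_mul] at hmul
  refine tendsto_nhds_unique
    ((hc 0 self_mem_Ici).tendsto.mono_left (nhdsWithin_mono 0 Ioi_subset_Ici_self))
    (hmul.congr' ?_)
  filter_upwards [self_mem_nhdsWithin] with t ht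
  exact div_mul_cancel₀ _ (ne_of_gt ht)

theorem tendsto_comp_mul_div {c : ℝ → ℝ} (hc : ContinuousOn c (Ici 0))
    (h : Tendsto (fun t => c t / t) (𝓝[>] 0) (𝓝 0)) {s : ℝ} (hs : 0 ≤ s) :
    Tendsto (fun t => c (t * s) / t) (𝓝[>] 0) (𝓝 0) := by
  rcases hs.eq_or_lt with rfl | hs
  · simp [eq_zero_of_tendsto_div hc h]
  · have hscale : Tendsto (fun t : ℝ => t * s) (𝓝[>] 0) (𝓝[>] 0) := by
      refine tendsto_nhdsWithin_iff.2 ⟨?_, ?_⟩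
      · exact ((continuous_mul_const s).tendsto' 0 0 (zero_mul s)).mono_left nhdsWithin_le_nhds
      · filter_upwards [self_mem_nhdsWithin] with t ht using mul_pos ht hs
    have hmul := (h.comp hscale).mul_const s
    rw [zero_mul] at hmul
    refine hmul.congr fun t => ?_
    rw [Function.comp_apply, div_mul_eq_div_div, div_mul_cancel₀ _ hs.ne']

variable {Z : Type*} [NormedAddCommGroup Z] [NormedSpace ℝ Z]

/-- A sequence of operators `G k : Z → Z*` that are monotone on every ball of radius `R` up to a
common error `c R (S (z₁ - z₂))`, where `S` is a compact seminorm and `c R t = o(t)` as `t → 0⁺`.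
Compared with `HasUSBV`, the parameter runs through a sequence and the modulus does not depend on
it. -/
structure SemiboundedVariation (S : Seminorm ℝ Z) (c : ℝ → ℝ → ℝ) (G : ℕ → Z → StrongDual ℝ Z) :
    Prop where
  isCompactSeminorm : IsCompactSeminorm S
  continuousOn : ∀ R > 0, ContinuousOn (c R) (Ici 0)
  tendsto_div : ∀ R > 0, Tendsto (fun t => c R t / t) (𝓝[>] 0) (𝓝 0)
  le_apply : ∀ R > 0, ∀ k z₁ z₂, ‖z₁‖ ≤ R → ‖z₂‖ ≤ R →
    -c R (S (z₁ - z₂)) ≤ (G k z₁ - G k z₂) (z₁ - z₂)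

variable {S : Seminorm ℝ Z} {c : ℝ → ℝ → ℝ} {G : ℕ → Z → StrongDual ℝ Z} {z : ℕ → Z}
  {z₀ : Z} {G₀ : Z → StrongDual ℝ Z} {ν₀ : StrongDual ℝ Z}

theorem SemiboundedVariation.comp (hG : SemiboundedVariation S c G) (φ : ℕ → ℕ) :
    SemiboundedVariation S c (G ∘ φ) :=
  ⟨hG.isCompactSeminorm, hG.continuousOn, hG.tendsto_div, fun R hR k => hG.le_apply R hR (φ k)⟩

theorem SemiboundedVariation.exists_apply_le (hG : SemiboundedVariation S c G) {R₀ m A : ℝ}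
    (hz : ∀ k, ‖z k‖ ≤ R₀) (hm : ∀ k, G k (z k) (z k) ≤ m) {v : Z} (hA : ∀ k, ‖G k v‖ ≤ A) :
    ∃ L, ∀ k, G k (z k) v ≤ L := by
  set R := max R₀ (‖v‖ + 1)
  have hR : 0 < R := lt_max_of_lt_right (by positivity)
  have hzR : ∀ k, ‖z k‖ ≤ R := fun k => (hz k).trans (le_max_left _ _)
  have hvR : ‖v‖ ≤ R := (lt_add_one _).le.trans (le_max_right _ _)
  have hdiff : ∀ k, ‖z k - v‖ ≤ R + R := fun k => norm_sub_le_of_le (hzR k) hvR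
  obtain ⟨K, hK0, hK⟩ := S.bound_of_continuous_normedSpace hG.isCompactSeminorm.continuous
  obtain ⟨b, hb⟩ := (isCompact_Icc (a := 0) (b := K * (R + R))).bddAbove_image
    ((hG.continuousOn R hR).mono Icc_subset_Ici_self)
  refine ⟨m + A * (R + R) + b, fun k => ?_⟩
  have hvar := hG.le_apply R hR k (z k) v (hzR k) hvR
  have hc : c R (S (z k - v)) ≤ b := hb ⟨_, ⟨apply_nonneg S _,
    (hK _).trans (mul_le_mul_of_nonneg_left (hdiff k) hK0.le)⟩, rfl⟩
  have hGv : -(G k v (z k - v)) ≤ A * (R + R) :=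
    (neg_le_abs _).trans ((G k v).le_of_opNorm_le_of_le (hA k) (hdiff k))
  rw [sub_apply, map_sub (G k (z k))] at hvar
  linarith [hm k]

theorem SemiboundedVariation.exists_norm_le [CompleteSpace Z] (hG : SemiboundedVariation S c G)
    {R₀ m : ℝ} (hz : ∀ k, ‖z k‖ ≤ R₀) (hm : ∀ k, G k (z k) (z k) ≤ m)
    (hbdd : ∀ v, ∃ A, ∀ k, ‖G k v‖ ≤ A) : ∃ M, ∀ k, ‖G k (z k)‖ ≤ M := by
  have hle : ∀ v, ∃ L, ∀ k, G k (z k) v ≤ L := fun v =>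
    (hbdd v).elim fun _ hA => hG.exists_apply_le hz hm hA
  refine banach_steinhaus fun v => ?_
  obtain ⟨L, hL⟩ := hle v
  obtain ⟨L', hL'⟩ := hle (-v)
  refine ⟨max L L', fun k => abs_le'.2 ⟨(hL k).trans (le_max_left _ _), ?_⟩⟩
  rw [← map_neg]
  exact (hL' k).trans (le_max_right _ _)

theorem SemiboundedVariation.le_apply_of_tendsto (hG : SemiboundedVariation S c G) {R : ℝ}
    (hR : 0 < R) (hzR : ∀ k, ‖z k‖ ≤ R) (hz : TendstoWeak z z₀)
    (hν : ∀ v, Tendsto (fun k => G k (z k) v) atTop (𝓝 (ν₀ v)))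
    {u : ℕ → ℝ} (hle : ∀ k, G k (z k) (z k) ≤ u k) (hu : Tendsto u atTop (𝓝 (ν₀ z₀)))
    {v : Z} (hv : ‖v‖ ≤ R) (hGv : Tendsto (fun k => G k v) atTop (𝓝 (G₀ v))) :
    -c R (S (z₀ - v)) ≤ (ν₀ - G₀ v) (z₀ - v) := by
  have hdiff : TendstoWeak (fun k => z k - v) (z₀ - v) := fun ℓ => by
    simpa only [map_sub] using (hz ℓ).sub_const (ℓ v)
  have hlower : Tendsto (fun k => -c R (S (z k - v))) atTop (𝓝 (-c R (S (z₀ - v)))) :=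
    ((hG.continuousOn R hR _ (apply_nonneg S _)).tendsto.comp (tendsto_nhdsWithin_iff.2
      ⟨hG.isCompactSeminorm.tendsto_apply hdiff,
        Eventually.of_forall fun k => apply_nonneg S _⟩)).neg
  obtain ⟨M, hM⟩ := hdiff.exists_norm_le
  have hupper := (hu.sub (hν v)).sub (tendsto_apply_of_tendsto_of_bounded hGv hM (hdiff _))
  rw [sub_apply, map_sub ν₀]
  refine le_of_tendsto_of_tendsto' hlower hupper fun k => ?_
  have hvar := hG.le_apply R hR k (z k) v (hzR k) hv
  rw [sub_apply, map_sub (G k (z k))] at hvar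
  linarith [hle k]

theorem SemiboundedVariation.eq_of_tendsto (hG : SemiboundedVariation S c G)
    (hz : TendstoWeak z z₀) (hν : ∀ v, Tendsto (fun k => G k (z k) v) atTop (𝓝 (ν₀ v)))
    {u : ℕ → ℝ} (hle : ∀ k, G k (z k) (z k) ≤ u k) (hu : Tendsto u atTop (𝓝 (ν₀ z₀)))
    (hlim : ∀ v, Tendsto (fun k => G k v) atTop (𝓝 (G₀ v)))
    (hrad : ∀ w, Tendsto (fun t : ℝ => G₀ (z₀ + t • w) w) (𝓝[>] 0) (𝓝 (G₀ z₀ w))) :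
    G₀ z₀ = ν₀ := by
  obtain ⟨M, hM⟩ := hz.exists_norm_le
  let R : Z → ℝ := fun w => max M (‖z₀‖ + ‖w‖ + 1)
  have hR : ∀ w, 0 < R w := fun w => lt_max_of_lt_right (by positivity)
  refine eq_of_minty (ω := fun w t => c (R w) (t * S w)) (fun w => ?_) hrad fun w => ?_
  · exact tendsto_comp_mul_div (hG.continuousOn _ (hR w)) (hG.tendsto_div _ (hR w))
      (apply_nonneg S w)
  · filter_upwards [Ioo_mem_nhdsGT one_pos] with t ht
    have htw : ‖t • w‖ ≤ ‖w‖ := by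
      rw [norm_smul, Real.norm_eq_abs, abs_of_pos ht.1]
      exact mul_le_of_le_one_left (norm_nonneg w) ht.2.le
    have hv : ‖z₀ + t • w‖ ≤ R w :=
      ((norm_add_le _ _).trans (by linarith)).trans (le_max_right M _)
    have hvar := hG.le_apply_of_tendsto (hR w) (fun k => (hM k).trans (le_max_left _ _)) hz hν
      hle hu hv (hlim _)
    rw [sub_add_cancel_left, map_neg_eq_map, map_smul_eq_mul, Real.norm_eq_abs, abs_of_pos ht.1,
      map_neg, sub_apply] at hvar
    linarith

end SemiboundedVariation

theorem IsRadiallyContinuous.tendsto {N : ℕ} {p q : ℝ≥0∞} [Fact (1 ≤ p)] {Ω : Opens (Eucl N)}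
    {G : LSp p Ω → LSp q Ω} (hG : IsRadiallyContinuous G)
    (z w : LSp p Ω) : Tendsto (fun t : ℝ => pairing (G (z + t • w)) w) (𝓝[>] 0)
      (𝓝 (pairing (G z) w)) := by
  obtain ⟨ε, hε, hcont⟩ := hG z w
  simpa using (hcont 0 ⟨le_rfl, hε.le⟩).tendsto.mono_left
    (nhdsWithin_le_of_mem (Icc_mem_nhdsGT hε))

section Hammerstein

variable {N : ℕ} {p q : ℝ≥0∞} [Fact (1 ≤ p)] [Fact (1 ≤ q)] {Ω D : Opens (Eucl N)}

theorem integrable_mul_testFunction [IsFiniteMeasure (volume.restrict (Ω : Set (Eucl N)))]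
    (w : LSp p Ω) (φ : 𝓓(Ω, ℝ)) :
    Integrable (fun x => w x * φ x) (volume.restrict (Ω : Set (Eucl N))) := by
  obtain ⟨K, hK⟩ := φ.contDiff.continuous.bounded_above_of_compact_support φ.hasCompactSupport
  exact ((Lp.memLp w).integrable Fact.out).mul_bdd
    φ.contDiff.continuous.aestronglyMeasurable (ae_of_all _ hK)

theorem Lp_ext_of_integral_mul_testFunction
    [IsFiniteMeasure (volume.restrict (Ω : Set (Eucl N)))] {u v : LSp p Ω}
    (h : ∀ φ : 𝓓(Ω, ℝ), ∫ x in (Ω : Set (Eucl N)), u x * φ x =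
      ∫ x in (Ω : Set (Eucl N)), v x * φ x) : u = v := by
  have hint : ∀ w : LSp p Ω, Integrable w (volume.restrict (Ω : Set (Eucl N))) := fun w =>
    (Lp.memLp w).integrable Fact.out
  have hzero : ∀ᵐ x ∂volume, x ∈ (Ω : Set (Eucl N)) → u x - v x = 0 := by
    refine Ω.isOpen.ae_eq_zero_of_integral_contDiff_smul_eq_zero (μ := volume)
      (IntegrableOn.locallyIntegrableOn ((hint u).sub (hint v))) fun φ hφ hφc hφs => ?_
    rw [← setIntegral_eq_integral_of_forall_compl_eq_zero (s := (Ω : Set (Eucl N))) fun x hx => by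
      rw [image_eq_zero_of_notMem_tsupport fun hx' => hx (hφs hx'), zero_smul]]
    let φΩ : 𝓓(Ω, ℝ) := ⟨φ, hφ, hφc, hφs⟩
    have hsub := sub_eq_zero.2 (h φΩ)
    rw [← integral_sub (integrable_mul_testFunction u φΩ) (integrable_mul_testFunction v φΩ)]
      at hsub
    rw [← hsub]
    refine integral_congr_ae (ae_of_all _ fun x => ?_)
    change φ x * (u x - v x) = u x * φ x - v x * φ x
    ring
  refine Lp.ext ?_
  rw [EventuallyEq, ae_restrict_iff' Ω.isOpen.measurableSet]
  filter_upwards [hzero] with x hx hxΩ using sub_eq_zero.1 (hx hxΩ)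

theorem mem_hammersteinSet_iff [IsFiniteMeasure (volume.restrict (Ω : Set (Eucl N)))]
    (h : Ω ≤ D) {B : LSp q Ω →L[ℝ] LSp p Ω} {F : W0 p Ω → LSp p Ω → LSp q Ω} {g : LSp p D}
    {y : W0 p Ω} {z : LSp p Ω} :
    z ∈ hammersteinSet B F g y ↔ z + B (F y z) = restrictL h g := by
  have hrhs : ∀ φ : 𝓓(Ω, ℝ), ∫ x in (Ω : Set (Eucl N)), restrictL h g x * φ x =
      ∫ x in (Ω : Set (Eucl N)), g x * φ x := fun φ =>
    integral_congr_ae ((coeFn_restrictL h g).mul (EventuallyEq.refl _ φ))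
  have hlhs : ∀ φ : 𝓓(Ω, ℝ), ∫ x in (Ω : Set (Eucl N)), (z + B (F y z) : LSp p Ω) x * φ x =
      (∫ x in (Ω : Set (Eucl N)), z x * φ x) + ∫ x in (Ω : Set (Eucl N)), B (F y z) x * φ x := by
    intro φ
    rw [← integral_add (integrable_mul_testFunction _ φ) (integrable_mul_testFunction _ φ)]
    refine integral_congr_ae ?_
    filter_upwards [Lp.coeFn_add z (B (F y z))] with x hx
    rw [hx, Pi.add_apply, add_mul]
  refine ⟨fun hz => Lp_ext_of_integral_mul_testFunction fun φ => ?_, fun hz φ => ?_⟩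
  · rw [hlhs, hrhs]
    exact hz φ
  · rw [← hlhs, hz, hrhs]

variable [p.HolderConjugate q]

theorem pairing_eq_lpToDual (ν : LSp q Ω) (z : LSp p Ω) :
    pairing ν z = lpToDual (volume.restrict (Ω : Set (Eucl N))) q p ν z :=
  (lpToDual_apply ν z).symm

variable {B : LSp q Ω →L[ℝ] LSp p Ω} {b : LSp p Ω} {ν₁ ν₂ : LSp q Ω} {z₁ z₂ : LSp p Ω}

theorem pairing_sub_eq_neg_of_hammerstein (h₁ : z₁ + B ν₁ = b) (h₂ : z₂ + B ν₂ = b) :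
    pairing (ν₁ - ν₂) (z₁ - z₂) = -pairing (ν₁ - ν₂) (B (ν₁ - ν₂)) := by
  have hz : z₁ - z₂ = -B (ν₁ - ν₂) := by
    rw [eq_sub_of_add_eq h₁, eq_sub_of_add_eq h₂, map_sub]
    abel
  rw [hz, pairing_eq_lpToDual, pairing_eq_lpToDual, map_neg]

theorem eq_of_hammerstein (hB : ∀ ν : LSp q Ω, ν ≠ 0 → 0 < pairing ν (B ν))
    (h₁ : z₁ + B ν₁ = b) (h₂ : z₂ + B ν₂ = b) (h : 0 ≤ pairing (ν₁ - ν₂) (z₁ - z₂)) :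
    ν₁ = ν₂ := by
  by_contra hne
  rw [pairing_sub_eq_neg_of_hammerstein h₁ h₂] at h
  linarith [hB _ (sub_ne_zero.2 hne)]

theorem pairing_sub_nonpos_of_hammerstein (hB : ∀ ν : LSp q Ω, ν ≠ 0 → 0 < pairing ν (B ν))
    (h₁ : z₁ + B ν₁ = b) (h₂ : z₂ + B ν₂ = b) : pairing (ν₁ - ν₂) (z₁ - z₂) ≤ 0 := by
  by_contra! hpos
  have hν := eq_of_hammerstein hB h₁ h₂ hpos.le
  rw [hν, sub_self, pairing_eq_lpToDual, map_zero] at hpos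
  exact lt_irrefl _ hpos

/- `(γ, 0)` solves the same equation as `(ν, z)`. -/
theorem norm_le_of_hammerstein (hB : ∀ ν : LSp q Ω, ν ≠ 0 → 0 < pairing ν (B ν)) {r : ℝ}
    (hr : 0 ≤ r) {γ ν : LSp q Ω} {z : LSp p Ω} (hz : z + B ν = B γ)
    (h : r < ‖z‖ → 0 ≤ pairing (ν - γ) z) : ‖z‖ ≤ r := by
  by_contra! hlt
  have hν : ν = γ := eq_of_hammerstein hB hz (zero_add (B γ)) (by simpa using h hlt)
  rw [hν, add_eq_right] at hz
  rw [hz, norm_zero] at hlt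
  exact hr.not_gt hlt

theorem HasUSBV.exists_semiboundedVariation {Y : Type*} [NormedAddCommGroup Y]
    {F : Y → LSp p Ω → LSp q Ω} (hF : HasUSBV F) {y : ℕ → Y} {M : ℝ} (hy : ∀ k, ‖y k‖ ≤ M) :
    ∃ S c, SemiboundedVariation S c fun k z =>
      lpToDual (volume.restrict (Ω : Set (Eucl N))) q p (F (y k) z) := by
  have hmem : ∀ k, y k ∈ Metric.closedBall 0 M := fun k => mem_closedBall_zero_iff.2 (hy k)
  obtain ⟨S, C, hS, hC, hvar⟩ := hF _ (Metric.isBounded_closedBall (x := (0 : Y)) (r := M))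
  obtain ⟨hcont, hdiv⟩ := hC _ (hmem 0)
  refine ⟨S, C (y 0), hS, fun R hR => ?_, hdiv, fun R hR k z₁ z₂ h₁ h₂ => ?_⟩
  · exact hcont.comp (Continuous.prodMk_right R).continuousOn fun t ht => ⟨hR.le, ht⟩
  · rw [← map_sub, ← pairing_eq_lpToDual]
    exact hvar R hR (y k) (hmem k) z₁ z₂ h₁ h₂ (y 0) (hmem 0)

theorem exists_norm_le_of_hammerstein [IsFiniteMeasure (volume.restrict (Ω : Set (Eucl N)))]
    (hp : p ≠ ∞) (hB : ∀ ν : LSp q Ω, ν ≠ 0 → 0 < pairing ν (B ν)) {γ : LSp q Ω}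
    {G : ℕ → LSp p Ω → LSp q Ω} {S : Seminorm ℝ (LSp p Ω)} {c : ℝ → ℝ → ℝ}
    (hvar : SemiboundedVariation S c fun k z =>
      lpToDual (volume.restrict (Ω : Set (Eucl N))) q p (G k z))
    (hG : ∀ v, ∃ A, ∀ k, ‖G k v‖ ≤ A) {z : ℕ → LSp p Ω} {M : ℝ} (hz : ∀ k, ‖z k‖ ≤ M)
    (hsol : ∀ k, z k + B (G k (z k)) = B γ) : ∃ L, ∀ k, ‖G k (z k)‖ ≤ L := by
  have hle : ∀ k, lpToDual (volume.restrict (Ω : Set (Eucl N))) q p (G k (z k)) (z k) ≤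
      ‖γ‖ * M := fun k => by
    have hmono := pairing_sub_nonpos_of_hammerstein hB (hsol k) (zero_add (B γ))
    rw [sub_zero, pairing_eq_lpToDual, map_sub, sub_apply, sub_nonpos] at hmono
    exact hmono.trans ((le_abs_self _).trans
      (ContinuousLinearMap.le_of_opNorm_le_of_le _ (norm_lpToDual_le γ) (hz k)))
  simpa only [norm_lpToDual hp] using hvar.exists_norm_le hz hle fun v =>
    (hG v).imp fun A hA k => (norm_lpToDual_le _).trans (hA k)

theorem add_eq_of_tendstoWeak {E G : Type*} [NormedAddCommGroup E] [NormedSpace ℝ E]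
    [NormedAddCommGroup G] [NormedSpace ℝ G] {L : G →L[ℝ] E} {b : E} {x : ℕ → E} {x₀ : E}
    {ν : ℕ → G} {ν₀ : G} (hx : TendstoWeak x x₀) (hν : TendstoWeak ν ν₀)
    (h : ∀ k, x k + L (ν k) = b) : x₀ + L ν₀ = b := by
  refine (SeparatingDual.eq_iff_forall_dual_eq (R := ℝ)).2 fun ℓ => ?_
  refine tendsto_nhds_unique (f := fun k => ℓ (x k + L (ν k))) (l := atTop) ?_ ?_
  · simpa only [map_add] using (hx ℓ).add (hν.map L ℓ)
  · simp only [h, tendsto_const_nhds]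

/- Two solutions `(ν_k, z_k)` and `(ν₀, z₀)` satisfy `⟨ν_k - ν₀, z_k - z₀⟩ ≤ 0`, so that
`limsup ⟨ν_k, z_k⟩ ≤ ⟨ν₀, z₀⟩` and Minty's argument applies. -/
theorem eq_of_hammerstein_of_tendstoWeak
    [IsFiniteMeasure (volume.restrict (Ω : Set (Eucl N)))] (hp : p ≠ ∞)
    (hB : ∀ ν : LSp q Ω, ν ≠ 0 → 0 < pairing ν (B ν)) {G : ℕ → LSp p Ω → LSp q Ω}
    {S : Seminorm ℝ (LSp p Ω)} {c : ℝ → ℝ → ℝ}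
    (hvar : SemiboundedVariation S c fun k z =>
      lpToDual (volume.restrict (Ω : Set (Eucl N))) q p (G k z))
    {G₀ : LSp p Ω → LSp q Ω} (hG : ∀ v, Tendsto (fun k => G k v) atTop (𝓝 (G₀ v)))
    (hrad : IsRadiallyContinuous G₀) {z : ℕ → LSp p Ω} {z₀ : LSp p Ω} {ν₀ : LSp q Ω}
    (hz : TendstoWeak z z₀) (hν : TendstoWeak (fun k => G k (z k)) ν₀)
    (hsol : ∀ k, z k + B (G k (z k)) = b) : G₀ z₀ = ν₀ := by
  let P := lpToDual (volume.restrict (Ω : Set (Eucl N))) q p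
  have hsol₀ : z₀ + B ν₀ = b := add_eq_of_tendstoWeak hz hν hsol
  have hPν : ∀ v, Tendsto (fun k => P (G k (z k)) v) atTop (𝓝 (P ν₀ v)) := fun v =>
    hν (P.flip v)
  have hle : ∀ k, P (G k (z k)) (z k) ≤ P (G k (z k)) z₀ + (P ν₀ (z k) - P ν₀ z₀) := fun k => by
    have hmono := pairing_sub_nonpos_of_hammerstein hB (hsol k) hsol₀
    rw [pairing_eq_lpToDual, map_sub, map_sub, sub_apply, sub_apply] at hmono
    linarith
  have hu : Tendsto (fun k => P (G k (z k)) z₀ + (P ν₀ (z k) - P ν₀ z₀)) atTop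
      (𝓝 (P ν₀ z₀)) := by
    simpa using (hPν z₀).add ((hz (P ν₀)).sub_const (P ν₀ z₀))
  have hP : P (G₀ z₀) = P ν₀ := hvar.eq_of_tendsto hz hPν hle hu
    (fun v => (P.continuous.tendsto _).comp (hG v)) fun w => by
      simpa only [pairing_eq_lpToDual] using hrad.tendsto z₀ w
  rw [← sub_eq_zero, ← norm_eq_zero, ← norm_lpToDual hp, map_sub, norm_eq_zero]
  exact sub_eq_zero.2 hP

theorem mem_hammersteinSet_of_tendstoWeak (hp : 1 < p.toReal)
    [IsFiniteMeasure (volume.restrict (Ω : Set (Eucl N)))] (h : Ω ≤ D)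
    (hB : ∀ ν : LSp q Ω, ν ≠ 0 → 0 < pairing ν (B ν)) {g : LSp p D}
    (hg : restrictL h g ∈ range B) {F : W0 p Ω → LSp p Ω → LSp q Ω} (hFvar : HasUSBV F)
    (hFrad : ∀ y, IsRadiallyContinuous (F y)) (hFcomp : IsCompactInState F)
    {y : ℕ → W0 p Ω} {y₀ : W0 p Ω} (hy : TendstoWeak y y₀) {z : ℕ → LSp p Ω} {z₀ : LSp p Ω}
    (hz : TendstoWeak z z₀) (hmem : ∀ k, z k ∈ hammersteinSet B F g (y k)) :
    z₀ ∈ hammersteinSet B F g y₀ := by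
  have hp' := ne_top_of_one_lt_toReal hp
  obtain ⟨γ, hγ⟩ := hg
  simp only [mem_hammersteinSet_iff h, ← hγ] at hmem ⊢
  obtain ⟨My, hMy⟩ := hy.exists_norm_le
  obtain ⟨Mz, hMz⟩ := hz.exists_norm_le
  obtain ⟨S, c, hvar⟩ := hFvar.exists_semiboundedVariation hMy
  have hFlim : ∀ v, Tendsto (fun k => F (y k) v) atTop (𝓝 (F y₀ v)) := fun v =>
    hFcomp v y y₀ (tendsto_toWeakSpace_iff.2 hy)
  obtain ⟨L, hL⟩ := exists_norm_le_of_hammerstein hp' hB hvar (fun v =>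
    (hFlim v).norm.bddAbove_range.imp fun A hA k => hA (mem_range_self k)) hMz hmem
  obtain ⟨φ, ν₀, hφ, hν⟩ := exists_subseq_tendstoWeak_Lp
    (ENNReal.HolderConjugate.toReal (q := q) hp).symm.lt hL
  have hzφ := hz.comp hφ.tendsto_atTop
  rw [eq_of_hammerstein_of_tendstoWeak (G := fun k => F (y (φ k))) hp' hB (hvar.comp φ)
    (fun v => (hFlim v).comp hφ.tendsto_atTop) (hFrad y₀) hzφ hν fun k => hmem (φ k)]
  exact add_eq_of_tendstoWeak hzφ hν fun k => hmem (φ k)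

end Hammerstein

/-! ### Admissible triplets -/

theorem IsMClass.norm_le {N : ℕ} {p : ℝ≥0∞} {D : Opens (Eucl N)} {α β : ℝ} {U : Control D}
    (hU : IsMClass p α β U) (i j : Fin N) : ‖U i j‖ ≤ |β| := by
  rw [Lp.norm_def, eLpNorm_exponent_top]
  exact ENNReal.toReal_le_of_le_ofReal (abs_nonneg β) (eLpNormEssSup_le_of_ae_bound
    ((hU.growth i j).mono fun _ hx => hx.trans (le_abs_self β)))

section Triplets

variable {N : ℕ} {p q : ℝ≥0∞} [Fact (1 ≤ p)] {Ω D : Opens (Eucl N)}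

theorem tendsto_tau_iff {t : ℕ → Control D × W0 p Ω × LSp p Ω} {U₀ : Control D} {y₀ : W0 p Ω}
    {z₀ : LSp p Ω} : Tendsto t atTop (@nhds _ (tau p Ω D) (U₀, y₀, z₀)) ↔
      (∀ i j, TendstoWeakStar (fun k => (t k).1 i j) (U₀ i j)) ∧
      TendstoWeak (fun k => (t k).2.1) y₀ ∧ TendstoWeak (fun k => (t k).2.2) z₀ := by
  rw [nhds_induced, tendsto_comap_iff, nhds_prod_eq, nhds_prod_eq, tendsto_prod_iff',
    tendsto_prod_iff']
  refine and_congr ?_ (and_congr tendsto_toWeakSpace_iff tendsto_toWeakSpace_iff)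
  simp only [tendsto_pi_nhds]
  rfl

theorem exists_subseq_tendsto_control (hD : Bornology.IsBounded (D : Set (Eucl N)))
    {U : ℕ → Control D} {M : ℝ} (hU : ∀ k i j, ‖U k i j‖ ≤ M) :
    ∃ (φ : ℕ → ℕ) (U₀ : Control D), StrictMono φ ∧
      ∀ i j, TendstoWeakStar (fun k => U (φ k) i j) (U₀ i j) := by
  have : IsFiniteMeasure (volume.restrict (D : Set (Eucl N))) :=
    ⟨by simpa using hD.measure_lt_top⟩
  obtain ⟨φ, hφ, hlim⟩ := exists_common_subseq (ι := Fin N × Fin N)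
    (P := fun e φ => ∃ a₀ : LSp ∞ D, TendstoWeakStar (fun k => U (φ k) e.1 e.2) a₀)
    (fun e φ ψ hψ ⟨a₀, ha₀⟩ => ⟨a₀, ha₀.comp hψ.tendsto_atTop⟩) (fun e φ _ => by
      obtain ⟨ψ, a₀, hψ, ha₀⟩ := exists_subseq_tendstoWeakStar
        (a := fun k => U (φ k) e.1 e.2) fun k => hU (φ k) e.1 e.2
      exact ⟨ψ, hψ, a₀, ha₀⟩)
  choose a₀ ha₀ using hlim
  exact ⟨φ, fun i j => a₀ (i, j), hφ, fun i j => ha₀ (i, j)⟩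

theorem exists_subseq_tendsto_tau (hp : 1 < p.toReal) (h : Ω ≤ D)
    (hD : Bornology.IsBounded (D : Set (Eucl N))) {t : ℕ → Control D × W0 p Ω × LSp p Ω} {M : ℝ}
    (hU : ∀ k i j, ‖(t k).1 i j‖ ≤ M) (hy : ∀ k, ‖(t k).2.1‖ ≤ M) (hz : ∀ k, ‖(t k).2.2‖ ≤ M) :
    ∃ (φ : ℕ → ℕ) (t₀ : Control D × W0 p Ω × LSp p Ω), StrictMono φ ∧
      Tendsto (t ∘ φ) atTop (@nhds _ (tau p Ω D) t₀) := by
  have hΩ := hD.subset h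
  have : IsFiniteMeasure (volume.restrict (Ω : Set (Eucl N))) :=
    ⟨by simpa using hΩ.measure_lt_top⟩
  obtain ⟨φ, U₀, hφ, hU₀⟩ := exists_subseq_tendsto_control hD hU
  obtain ⟨ψ, y₀, hψ, hy₀⟩ := exists_subseq_tendstoWeak_W0 hp hΩ fun k => hy (φ k)
  obtain ⟨χ, z₀, hχ, hz₀⟩ := exists_subseq_tendstoWeak_Lp hp fun k => hz (φ (ψ k))
  refine ⟨φ ∘ ψ ∘ χ, (U₀, y₀, z₀), hφ.comp (hψ.comp hχ), tendsto_tau_iff.2 ⟨fun i j => ?_, ?_, hz₀⟩⟩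
  · exact (hU₀ i j).comp (hψ.comp hχ).tendsto_atTop
  · exact hy₀.comp hχ.tendsto_atTop

variable [Fact (1 ≤ q)] [p.HolderConjugate q] {h : Ω ≤ D} {α β : ℝ} {ξ₁ ξ₂ : LSp ∞ D}
  {Q : Fin N → Set (WNeg p D)} {f : WNeg p D} {g : LSp p D} {B : LSp q Ω →L[ℝ] LSp p Ω}
  {F : W0 p Ω → LSp p Ω → LSp q Ω}

theorem exists_norm_le_of_mem_admissibleTriplets (hp : 1 < p.toReal)
    (hD : Bornology.IsBounded (D : Set (Eucl N))) (hα : 0 < α)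
    (hB : ∀ ν : LSp q Ω, ν ≠ 0 → 0 < pairing ν (B ν)) {γ : LSp q Ω} (hγ : B γ = restrictL h g)
    (hF : ∀ Y₀ : Set (W0 p Ω), Bornology.IsBounded Y₀ → ∃ r : ℝ, 0 < r ∧
      ∀ y ∈ Y₀, ∀ z : LSp p Ω, r < ‖z‖ → 0 ≤ pairing (F y z - γ) z) :
    ∃ M, ∀ t ∈ admissibleTriplets h α β ξ₁ ξ₂ Q B F f g,
      (∀ i j, ‖t.1 i j‖ ≤ M) ∧ ‖t.2.1‖ ≤ M ∧ ‖t.2.2‖ ≤ M := by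
  have : IsFiniteMeasure (volume.restrict (Ω : Set (Eucl N))) :=
    ⟨by simpa using (hD.subset h).measure_lt_top⟩
  let r : ℝ := (‖f‖ / min α 1) ^ (p.toReal - 1)⁻¹
  have hy : ∀ t ∈ admissibleTriplets h α β ξ₁ ξ₂ Q B F f g, ‖t.2.1‖ ≤ r := fun t ht =>
    ht.2.1.norm_le hp hα ht.1.1.1
  obtain ⟨s, hs, hcoercive⟩ := hF (Metric.closedBall 0 r) Metric.isBounded_closedBall
  refine ⟨max |β| (max r s), fun t ht => ⟨fun i j => ?_, ?_, ?_⟩⟩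
  · exact (ht.1.1.1.norm_le i j).trans (le_max_left _ _)
  · exact (hy t ht).trans ((le_max_left r s).trans (le_max_right _ _))
  · have hsol := ((mem_hammersteinSet_iff h).1 ht.2.2).trans hγ.symm
    refine (norm_le_of_hammerstein hB hs.le hsol ?_).trans
      ((le_max_right r s).trans (le_max_right _ _))
    exact hcoercive _ (mem_closedBall_zero_iff.2 (hy t ht)) _

theorem mem_admissibleTriplets_of_tendsto (hp : 1 < p.toReal)
    (hD : Bornology.IsBounded (D : Set (Eucl N))) (hQ : ∀ i, IsCompact (Q i))
    (hB : ∀ ν : LSp q Ω, ν ≠ 0 → 0 < pairing ν (B ν)) (hg : restrictL h g ∈ range B)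
    (hFvar : HasUSBV F) (hFrad : ∀ y, IsRadiallyContinuous (F y)) (hFcomp : IsCompactInState F)
    {t : ℕ → Control D × W0 p Ω × LSp p Ω} {t₀ : Control D × W0 p Ω × LSp p Ω}
    (ht : ∀ k, t k ∈ admissibleTriplets h α β ξ₁ ξ₂ Q B F f g)
    (hlim : Tendsto t atTop (@nhds _ (tau p Ω D) t₀)) :
    t₀ ∈ admissibleTriplets h α β ξ₁ ξ₂ Q B F f g := by
  have : IsFiniteMeasure (volume.restrict (Ω : Set (Eucl N))) :=
    ⟨by simpa using (hD.subset h).measure_lt_top⟩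
  obtain ⟨hU, hy, hz⟩ := tendsto_tau_iff.1 hlim
  refine ⟨mem_admissibleControls_of_tendsto hp hD hQ hU fun k => (ht k).1, ?_, ?_⟩
  · exact .of_tendsto hp hD hQ (fun k => (ht k).1.2) hU (fun k => (ht k).2.1) hy
  · exact mem_hammersteinSet_of_tendstoWeak hp h hB hg hFvar hFrad hFcomp hy hz fun k => (ht k).2.2

end Triplets

end HammersteinControl

theorem mainTheorem2_general {N : ℕ} (p q : ℝ≥0∞) [Fact (1 ≤ p)] [Fact (1 ≤ q)]
    (hp : 1 < p) (hp' : p ≠ ∞) (hpq : p.HolderConjugate q)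
    (Ω D : Opens (Eucl N)) (hD : Bornology.IsBounded (D : Set (Eucl N))) (hΩD : Ω ≤ D)
    (α β : ℝ) (hα : 0 < α) (ξ₁ ξ₂ : LSp ∞ D)
    (Q : Fin N → Set (WNeg p D)) (hQ : ∀ i, IsCompact (Q i))
    (f : WNeg p D) (g : LSp p D)
    (B : LSp q Ω →L[ℝ] LSp p Ω) (hBpos : ∀ ν : LSp q Ω, ν ≠ 0 → 0 < pairing ν (B ν))
    (Br : LSp p Ω → LSp q Ω) (hBr : ∀ h ∈ Set.range B, B (Br h) = h)
    (hg : restrictL hΩD g ∈ Set.range B)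
    (F : W0 p Ω → LSp p Ω → LSp q Ω) (hFvar : HasUSBV F)
    (hFrad : ∀ y, IsRadiallyContinuous (F y))
    (hFcoer : ∀ Y₀ : Set (W0 p Ω), Bornology.IsBounded Y₀ → ∃ lam : ℝ, 0 < lam ∧
      ∀ y ∈ Y₀, ∀ z : LSp p Ω, lam < ‖z‖ → 0 ≤ pairing (F y z - Br (restrictL hΩD g)) z)
    (hFcomp : IsCompactInState F) :
    (∀ (t : ℕ → Control D × W0 p Ω × LSp p Ω) (U₀ : Control D) (y₀ : W0 p Ω) (z₀ : LSp p Ω),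
      (∀ k, t k ∈ admissibleTriplets hΩD α β ξ₁ ξ₂ Q B F f g) →
      Tendsto t atTop (@nhds _ (tau p Ω D) (U₀, y₀, z₀)) →
        U₀ ∈ admissibleControls p α β ξ₁ ξ₂ Q ∧
        (IsWeakSolution hΩD f U₀ y₀ ∧ ∀ y, IsWeakSolution hΩD f U₀ y → y = y₀) ∧
        z₀ ∈ hammersteinSet B F g y₀ ∧
        (U₀, y₀, z₀) ∈ admissibleTriplets hΩD α β ξ₁ ξ₂ Q B F f g) ∧
    @IsSeqClosed _ (tau p Ω D) (admissibleTriplets hΩD α β ξ₁ ξ₂ Q B F f g) ∧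
    @IsSeqCompact _ (tau p Ω D) (admissibleTriplets hΩD α β ξ₁ ξ₂ Q B F f g) := by
  have hp_real : 1 < p.toReal := by
    rwa [← ENNReal.toReal_one, ENNReal.toReal_lt_toReal ENNReal.one_ne_top hp']
  have hclosed : ∀ (t : ℕ → Control D × W0 p Ω × LSp p Ω) (t₀ : Control D × W0 p Ω × LSp p Ω),
      (∀ k, t k ∈ admissibleTriplets hΩD α β ξ₁ ξ₂ Q B F f g) →
      Tendsto t atTop (@nhds _ (tau p Ω D) t₀) →
        t₀ ∈ admissibleTriplets hΩD α β ξ₁ ξ₂ Q B F f g := fun _ _ ht hlim =>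
    mem_admissibleTriplets_of_tendsto hp_real hD hQ hBpos hg hFvar hFrad hFcomp ht hlim
  refine ⟨fun t U₀ y₀ z₀ ht hlim => ?_, fun t t₀ ht hlim => hclosed t t₀ ht hlim, fun t ht => ?_⟩
  · have hmem := hclosed t (U₀, y₀, z₀) ht hlim
    exact ⟨hmem.1, ⟨hmem.2.1, fun y hy => hy.unique hp_real hmem.1.1.1 hmem.2.1⟩, hmem.2.2, hmem⟩
  · obtain ⟨M, hM⟩ := exists_norm_le_of_mem_admissibleTriplets (β := β) (ξ₁ := ξ₁) (ξ₂ := ξ₂)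
      (Q := Q) (f := f) hp_real hD hα hBpos (hBr _ hg) hFcoer
    obtain ⟨φ, t₀, hφ, hlim⟩ := exists_subseq_tendsto_tau hp_real hΩD hD
      (fun k => (hM _ (ht k)).1) (fun k => (hM _ (ht k)).2.1) (fun k => (hM _ (ht k)).2.2)
    exact ⟨t₀, hclosed _ t₀ (fun k => ht (φ k)) hlim, φ, hφ, hlim⟩

theorem mainTheorem2 {N : ℕ} (hN : 1 ≤ N) (p q : ℝ≥0∞) [Fact (1 ≤ p)] [Fact (1 ≤ q)]
    (hp : 2 ≤ p) (hp' : p ≠ ∞) (hpq : p.HolderConjugate q)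
    (Ω D : Opens (Eucl N)) (hD : Bornology.IsBounded (D : Set (Eucl N))) (hΩD : Ω ≤ D)
    (α β : ℝ) (hα : 0 < α) (hαβ : α ≤ β)
    (ξ₁ ξ₂ : LSp ∞ D)
    (hξ : ∀ᵐ x ∂(volume.restrict (D : Set (Eucl N))), 0 ≤ ξ₁ x ∧ ξ₁ x ≤ ξ₂ x)
    (Q : Fin N → Set (WNeg p D))
    (hQ : ∀ i, (Q i).Nonempty ∧ IsCompact (Q i) ∧ Convex ℝ (Q i))
    (f : WNeg p D) (g : LSp p D)
    -- `B` is a linear continuous positive operator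
    (B : LSp q Ω →L[ℝ] LSp p Ω) (hBpos : ∀ ν : LSp q Ω, ν ≠ 0 → 0 < pairing ν (B ν))
    -- `Br` is a right inverse of `B` on the range of `B`, and `g` lies in this range
    -- (which is no restriction if `B` has a right inverse on all of `L^p(Ω)`)
    (Br : LSp p Ω → LSp q Ω) (hBr : ∀ h ∈ Set.range B, B (Br h) = h)
    (hg : restrictL hΩD g ∈ Set.range B)
    (F : W0 p Ω → LSp p Ω → LSp q Ω) (hFvar : HasUSBV F)
    (hFrad : ∀ y, IsRadiallyContinuous (F y))
    (hFcoer : ∀ Y₀ : Set (W0 p Ω), Bornology.IsBounded Y₀ → ∃ lam : ℝ, 0 < lam ∧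
      ∀ y ∈ Y₀, ∀ z : LSp p Ω, lam < ‖z‖ → 0 ≤ pairing (F y z - Br (restrictL hΩD g)) z)
    (hFcomp : IsCompactInState F) :
    -- every `τ`-limit of admissible triplets is admissible, and `y₀` is the unique state of `U₀`
    (∀ (t : ℕ → Control D × W0 p Ω × LSp p Ω) (U₀ : Control D) (y₀ : W0 p Ω) (z₀ : LSp p Ω),
      (∀ k, t k ∈ admissibleTriplets hΩD α β ξ₁ ξ₂ Q B F f g) →
      Tendsto t atTop (@nhds _ (tau p Ω D) (U₀, y₀, z₀)) →
        U₀ ∈ admissibleControls p α β ξ₁ ξ₂ Q ∧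
        (IsWeakSolution hΩD f U₀ y₀ ∧ ∀ y, IsWeakSolution hΩD f U₀ y → y = y₀) ∧
        z₀ ∈ hammersteinSet B F g y₀ ∧
        (U₀, y₀, z₀) ∈ admissibleTriplets hΩD α β ξ₁ ξ₂ Q B F f g) ∧
    @IsSeqClosed _ (tau p Ω D) (admissibleTriplets hΩD α β ξ₁ ξ₂ Q B F f g) ∧
    @IsSeqCompact _ (tau p Ω D) (admissibleTriplets hΩD α β ξ₁ ξ₂ Q B F f g) :=
  mainTheorem2_general p q (ENNReal.one_lt_two.trans_le hp) hp' hpq Ω D hD hΩD α β hα ξ₁ ξ₂ Q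
    (fun i => (hQ i).2.1) f g B hBpos Br hBr hg F hFvar hFrad hFcoer hFcomp
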